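/- Let $A\in\mathbb R^{n\times n}$ be a Hurwitz matrix, i.e. $sI_n-A$ is nonsingular for every $s\in\mathbb C$ with $\operatorname{Re}s\ge 0$. Let $B_1\in\mathbb R^{n\times k}$, $B_2\in\mathbb R^{n\times q}$, $Q\in\mathbb R^{(n+k+q)\times(n+k+q)}$, and put $B=[B_1,\ B_2]$, $$\sigma(x,v,w)=\begin{bmatrix}x\\ v\\ w\end{bmatrix}'Q\begin{bmatrix}x\\ v\\ w\end{bmatrix}\qquad(x\in\mathbb R^n,\ v\in\mathbb R^k,\ w\in\mathbb R^q),$$ $$\Pi(s)=\begin{bmatrix}(sI_n-A)^{-1}B\\ I_{k+q}\end{bmatrix}'Q\begin{bmatrix}(sI_n-A)^{-1}B\\ I_{k+q}\end{bmatrix}=\begin{bmatrix}\Pi_{11}(s)&\Pi_{12}(s)\\ \Pi_{21}(s)&\Pi_{22}(s)\end{bmatrix},\qquad \Pi_{11}(s)\in\mathbb C^{k\times k},\ \Pi_{22}(s)\in\mathbb C^{q\times q},$$ where the prime denotes the (conjugate) transpose. Assume that there exist $\varepsilon>0$ and $s_0\in j\mathbb R$ (the imaginary axis) such that $$\begin{bmatrix}\Pi_{11}(s)&\varepsilon\,\Pi_{12}(s)\\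 \varepsilon\,\Pi_{21}(s)&-\Pi_{22}(s)\end{bmatrix}\ge 0\quad\text{for all } s\in j\mathbb R,\qquad \Pi_{11}(s_0)>0,\qquad \Pi_{22}(s_0)<0,$$ where the inequalities mean that the matrices are Hermitian and positive semidefinite, positive definite, and negative definite, respectively. Let $L^2_m$ be the real Hilbert space of square integrable functions $[0,\infty)\to\mathbb R^m$. Then for every $a\in\mathbb R^n$ the following holds. For all $v\in L^2_k$, $w\in L^2_q$ the equation $\dot x(t)=Ax(t)+B_1v(t)+B_2w(t)$, $x(0)=a$, understood as $x(t)=a+\int_0^t[Ax(\tau)+B_1v(\tau)+B_2w(\tau)]\,d\tau$ for $t\ge0$, has a unique continuous solution $x$ on $[0,\infty)$, and the integral $$g(v,w)=\int_0^\infty\sigma(x(t),v(t),w(t))\,dt$$ converges absolutely. Moreover, the functional $g:L^2_k\times L^2_q\to\mathbb R$ has the following properties. (a) The partial optimal values $w\mapsto\inf_{v\in L^2_k}g(v,w)$ and $v\mapsto\sup_{w\in L^2_q}g(v,w)$ are finite everywhere, and they are continuous functions on $L^2_q$ and on $L^2_k$, respectively, in the norm topologies. (b) The minimax identity $$\inf_{v\in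 L^2_k}\ \sup_{w\in L^2_q}g(v,w)=\sup_{w\in L^2_q}\ \inf_{v\in L^2_k}g(v,w)$$ holds, and both sides are finite. -/

import Mathlib

open MeasureTheory
open scoped ComplexOrder

namespace MinimaxCT

/-- The real Hilbert space of square integrable functions from `[0, ∞)` to Euclidean `m`-space. -/
abbrev L2Signal (m : ℕ) : Type :=
  Lp (EuclideanSpace ℝ (Fin m)) 2 (volume.restrict (Set.Ici (0 : ℝ)))

/-- `A` is Hurwitz: `s I - A` is nonsingular whenever `Re s ≥ 0`. -/
def IsHurwitz {n : ℕ} (A : Matrix (Fin n) (Fin n) ℝ) : Prop :=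
  ∀ s : ℂ, 0 ≤ s.re →
    (s • (1 : Matrix (Fin n) (Fin n) ℂ) - A.map Complex.ofReal).det ≠ 0

/-- The quadratic form `σ(x, v, w) = [x; v; w]' Q [x; v; w]`. -/
def quadForm {n k q : ℕ}
    (Q : Matrix (Fin n ⊕ Fin k ⊕ Fin q) (Fin n ⊕ Fin k ⊕ Fin q) ℝ)
    (x : Fin n → ℝ) (v : Fin k → ℝ) (w : Fin q → ℝ) : ℝ :=
  Sum.elim x (Sum.elim v w) ⬝ᵥ Q.mulVec (Sum.elim x (Sum.elim v w))

/-- The frequency matrix `Π(s) = M(s)' Q M(s)`, where `M(s) = [(s I - A)⁻¹ B; I]`, `B = [B₁, B₂]`,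
and the prime is the conjugate transpose. -/
noncomputable def freqMatrix {n k q : ℕ} (A : Matrix (Fin n) (Fin n) ℝ)
    (B₁ : Matrix (Fin n) (Fin k) ℝ) (B₂ : Matrix (Fin n) (Fin q) ℝ)
    (Q : Matrix (Fin n ⊕ Fin k ⊕ Fin q) (Fin n ⊕ Fin k ⊕ Fin q) ℝ) (s : ℂ) :
    Matrix (Fin k ⊕ Fin q) (Fin k ⊕ Fin q) ℂ :=
  let M : Matrix (Fin n ⊕ Fin k ⊕ Fin q) (Fin k ⊕ Fin q) ℂ :=
    Matrix.fromRows
      ((s • (1 : Matrix (Fin n) (Fin n) ℂ) - A.map Complex.ofReal)⁻¹ *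
        (Matrix.fromCols B₁ B₂).map Complex.ofReal)
      1
  M.conjTranspose * Q.map Complex.ofReal * M

/-- `x` solves `ẋ = A x + B₁ v + B₂ w`, `x(0) = a` on `[0, ∞)`, in the integrated sense.
Values of `x` at negative times are irrelevant. -/
def IsTrajectory {n k q : ℕ} (A : Matrix (Fin n) (Fin n) ℝ)
    (B₁ : Matrix (Fin n) (Fin k) ℝ) (B₂ : Matrix (Fin n) (Fin q) ℝ) (a : Fin n → ℝ)
    (v : L2Signal k) (w : L2Signal q) (x : ℝ → Fin n → ℝ) : Prop :=
  ContinuousOn x (Set.Ici 0) ∧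
    ∀ t : ℝ, 0 ≤ t →
      x t = a + ∫ τ in (0 : ℝ)..t, (A.mulVec (x τ) + B₁.mulVec (v τ) + B₂.mulVec (w τ))

/-- The solution `x` of `ẋ = A x + B₁ v + B₂ w`, `x(0) = a`. -/
noncomputable def trajectory {n k q : ℕ} (A : Matrix (Fin n) (Fin n) ℝ)
    (B₁ : Matrix (Fin n) (Fin k) ℝ) (B₂ : Matrix (Fin n) (Fin q) ℝ) (a : Fin n → ℝ)
    (v : L2Signal k) (w : L2Signal q) : ℝ → Fin n → ℝ :=
  Classical.epsilon (IsTrajectory A B₁ B₂ a v w)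

/-- The functional `g(v, w) = ∫₀^∞ σ(x(t), v(t), w(t)) dt`. -/
noncomputable def cost {n k q : ℕ} (A : Matrix (Fin n) (Fin n) ℝ)
    (B₁ : Matrix (Fin n) (Fin k) ℝ) (B₂ : Matrix (Fin n) (Fin q) ℝ)
    (Q : Matrix (Fin n ⊕ Fin k ⊕ Fin q) (Fin n ⊕ Fin k ⊕ Fin q) ℝ) (a : Fin n → ℝ)
    (v : L2Signal k) (w : L2Signal q) : ℝ :=
  ∫ t in Set.Ici (0 : ℝ), quadForm Q (trajectory A B₁ B₂ a v w t) (v t) (w t)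

/-- For every pair of inputs the initial value problem has exactly one solution on `[0, ∞)`, and the
integral which defines the functional converges absolutely. -/
def IsWellPosed {n k q : ℕ} (A : Matrix (Fin n) (Fin n) ℝ)
    (B₁ : Matrix (Fin n) (Fin k) ℝ) (B₂ : Matrix (Fin n) (Fin q) ℝ)
    (Q : Matrix (Fin n ⊕ Fin k ⊕ Fin q) (Fin n ⊕ Fin k ⊕ Fin q) ℝ) (a : Fin n → ℝ) : Prop :=
  ∀ (v : L2Signal k) (w : L2Signal q),
    IsTrajectory A B₁ B₂ a v w (trajectory A B₁ B₂ a v w) ∧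
    (∀ y : ℝ → Fin n → ℝ, IsTrajectory A B₁ B₂ a v w y →
      Set.EqOn y (trajectory A B₁ B₂ a v w) (Set.Ici 0)) ∧
    IntegrableOn (fun t => quadForm Q (trajectory A B₁ B₂ a v w t) (v t) (w t)) (Set.Ici 0)

end MinimaxCT

/-! By superposition the signal `[x; v; w]` is `F + G + H`: the free response to `a` and the
zero-state responses to `v` and to `w`. Hence `g(v, w) = c + P(v, v) + 2 b(v, w) - R(w, w) + 2 l₁(v)
+ 2 l₂(w)`, where `P`, `b` and `-R` come from the form `Q` on `G` and `H`, and `l₁`, `l₂` are the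
cross terms with `F`.

By Plancherel the frequency inequality says `P(v, v) + 2ε b(v, w) + R(w, w) ≥ 0`, first for decaying
signals and then on all of `L²` by density (`IsHurwitz.symmForm_nonneg`). So `P` and `R` are
nonnegative, and the discriminant gives `b² ≤ ε⁻² P R` (`sq_le_of_forall_nonneg`).

`P` and `R` need not be coercive on `L²`: `Π₁₁(iω)` and `Π₂₂(iω)` may degenerate at some frequencies
or at infinity. A saddle point is therefore sought in the completions `E`, `F` of the input spaces
for the seminorms of `P` and `R` (`minimax_of_forms`). There `b` becomes a bounded operator `T`,
however small `ε` is. The functional becomes strongly convex in one variable and strongly concave in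
the other. Its partial optima are explicit and continuous, and a saddle point comes from solving `x
+ T T* x = z` by Lax–Milgram. Optimal values over `L²` and over the completions agree by density.

The crux is that `l₁` and `l₂` are bounded in these seminorms, `l₁² ≤ C₁ P` and `l₂² ≤ C₂ R`
(`IsHurwitz.exists_symmForm_sq_le`). Clearing denominators turns `Π₁₁(iω)` into a polynomial
positive semidefinite matrix whose determinant is not identically zero because of `s₀`. So `P(v, v)`
dominates, up to a constant, the energy of the spectrum of `[x; v]` weighted by `|D(ω)|² / (1 +
ω²)^N` with a polynomial `D ≠ 0` (`exists_polynomial_weight`). The weight may vanish at real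
frequencies, yet it still controls every functional `u ↦ ∫ ⟨K exp(tA) a, u⟩`
(`isAdmissibleWeight_polynomial`). A causal filter applied to `u` is transposed onto `exp(tA) a` as
a rational function of `A`, and the zeros of the weight are undone because `A` has no eigenvalue on
the imaginary axis. The same argument with `-Q` treats `l₂`. -/

namespace MinimaxCT

open Matrix Filter Topology NNReal

/-! ### Exponential decay of `exp(tA)` for Hurwitz `A`. -/

section MatrixNorm

attribute [local instance] Matrix.linftyOpNormedAddCommGroup Matrix.linftyOpNormedSpace
  Matrix.linftyOpNormedRing Matrix.linftyOpNormedAlgebra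

/-- Every element of the spectrum of `exp A` is the exponential of an element of the spectrum
of `A`. -/
theorem spectrum_exp_subset {n : ℕ} (A : Matrix (Fin n) (Fin n) ℂ) :
    spectrum ℂ (NormedSpace.exp A) ⊆ Complex.exp '' spectrum ℂ A := by
  rcases isEmpty_or_nonempty (Fin n) with h | h
  · intro l hl
    have : Subsingleton (Matrix (Fin n) (Fin n) ℂ) := inferInstance
    simp [spectrum.of_subsingleton] at hl
  -- The algebra generated by `A` is finite dimensional, hence closed, so `exp A` is a polynomial in
  -- `A` and polynomial spectral mapping applies.
  have hmem : NormedSpace.exp A ∈ Algebra.adjoin ℂ {A} := by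
    refine NormedSpace.exp_mem (R := ℂ) (s := Algebra.adjoin ℂ {A}) ?_
      (Algebra.subset_adjoin rfl)
    exact (Subalgebra.toSubmodule (Algebra.adjoin ℂ {A})).closed_of_finiteDimensional
  rw [Algebra.adjoin_singleton_eq_range_aeval] at hmem
  obtain ⟨p, hp⟩ := hmem
  have hp' : Polynomial.aeval A p = NormedSpace.exp A := hp
  intro l hl
  rw [← hp', spectrum.map_polynomial_aeval_of_nonempty _ _
    (spectrum.nonempty_of_isAlgClosed_of_finiteDimensional ℂ A)] at hl
  obtain ⟨μ, hμ, rfl⟩ := hl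
  refine ⟨μ, hμ, ?_⟩
  -- Evaluating `p(A) = exp A` on an eigenvector for `μ` identifies `p(μ)` with `exp μ`.
  have hμ' : Module.End.HasEigenvalue (Matrix.toLin' A) μ := by
    rw [Module.End.hasEigenvalue_iff_mem_spectrum, Matrix.spectrum_toLin']
    exact hμ
  obtain ⟨v, hv⟩ := hμ'.exists_hasEigenvector
  have hAv : A *ᵥ v = μ • v := by simpa using hv.apply_eq_smul
  have hpow : ∀ k : ℕ, (A ^ k) *ᵥ v = μ ^ k • v := by
    intro k
    induction k with
    | zero => simp
    | succ k ih => rw [pow_succ, ← Matrix.mulVec_mulVec, hAv, Matrix.mulVec_smul, ih, smul_smul,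
        pow_succ, mul_comm]
  have hpv : (Polynomial.aeval A p) *ᵥ v = p.eval μ • v := by
    rw [Polynomial.aeval_eq_sum_range, Polynomial.eval_eq_sum_range, Matrix.sum_mulVec,
      Finset.sum_smul]
    refine Finset.sum_congr rfl fun k _ => ?_
    rw [Matrix.smul_mulVec, hpow, smul_smul]
  have hev : NormedSpace.exp A *ᵥ v = Complex.exp μ • v := by
    have h1 := NormedSpace.exp_series_hasSum_exp' (𝕂 := ℂ) A
    have h2 := NormedSpace.exp_series_hasSum_exp' (𝕂 := ℂ) μ
    have hc : Continuous fun M : Matrix (Fin n) (Fin n) ℂ => M *ᵥ v :=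
      (LinearMap.continuous_of_finiteDimensional
        ((Matrix.mulVecBilin ℂ ℂ).flip v : Matrix (Fin n) (Fin n) ℂ →ₗ[ℂ] (Fin n → ℂ)))
    have h3 := h1.map ((Matrix.mulVecBilin ℂ ℂ).flip v : Matrix (Fin n) (Fin n) ℂ →ₗ[ℂ] (Fin n → ℂ)) hc
    have h4 := h2.smul_const v
    rw [← Complex.exp_eq_exp_ℂ] at h4
    refine h3.unique ?_
    convert h4 using 2 with k
    simp [hpow, smul_smul]
  have hne := hv.2
  rw [hp', hev] at hpv
  exact smul_left_injective ℂ hne hpv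

theorem norm_map_ofReal {m n : ℕ} (M : Matrix (Fin m) (Fin n) ℝ) :
    ‖M.map Complex.ofReal‖ = ‖M‖ := by
  simp [Matrix.linfty_opNorm_def]

theorem exp_map_ofReal {n : ℕ} (M : Matrix (Fin n) (Fin n) ℝ) :
    (NormedSpace.exp M).map Complex.ofReal = NormedSpace.exp (M.map Complex.ofReal) := by
  refine NormedSpace.map_exp (Complex.ofRealHom.mapMatrix) ?_ M
  exact Continuous.matrix_map continuous_id Complex.continuous_ofReal

theorem IsHurwitz.re_neg_of_mem_spectrum {n : ℕ} {A : Matrix (Fin n) (Fin n) ℝ}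
    (hA : IsHurwitz A) {μ : ℂ} (hμ : μ ∈ spectrum ℂ (A.map Complex.ofReal)) : μ.re < 0 := by
  by_contra! h
  rw [spectrum.mem_iff, Matrix.isUnit_iff_isUnit_det, isUnit_iff_ne_zero] at hμ
  refine hμ ?_
  have := hA μ h
  rwa [← Algebra.algebraMap_eq_smul_one] at this

/-- The eigenvalues of `exp A` have modulus `exp (Re μ) < 1`, so its spectral radius is below `1`,
and Gelfand's formula yields a power of norm below `1`. The argument runs over `ℂ` and returns to
`ℝ` because complexification preserves this matrix norm. -/
theorem IsHurwitz.exists_norm_exp_pow_lt {n : ℕ} {A : Matrix (Fin n) (Fin n) ℝ}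
    (hA : IsHurwitz A) : ∃ N : ℕ, 0 < N ∧ ‖NormedSpace.exp A ^ N‖ < 1 := by
  rcases isEmpty_or_nonempty (Fin n) with h | h
  · refine ⟨1, one_pos, ?_⟩
    rw [Subsingleton.elim (NormedSpace.exp A ^ 1) 0]
    simp
  set M := NormedSpace.exp (A.map Complex.ofReal) with hM
  have hr : spectralRadius ℂ M < 1 := by
    have := spectrum.spectralRadius_lt_of_forall_lt (a := M) (r := 1) ?_
    · simpa using this
    intro l hl
    obtain ⟨μ, hμ, rfl⟩ := spectrum_exp_subset _ hl
    rw [← NNReal.coe_lt_coe, coe_nnnorm, Complex.norm_exp]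
    simpa using hA.re_neg_of_mem_spectrum hμ
  have ht := spectrum.pow_nnnorm_pow_one_div_tendsto_nhds_spectralRadius M
  obtain ⟨N, hN, hN0⟩ := ((ht.eventually_lt_const hr).and (eventually_gt_atTop 0)).exists
  refine ⟨N, hN0, ?_⟩
  have h1 : ‖NormedSpace.exp A ^ N‖ = ‖M ^ N‖ := by
    rw [← norm_map_ofReal, hM, ← exp_map_ofReal]
    congr 1
    exact map_pow (Complex.ofRealHom.mapMatrix) _ _
  rw [h1, ← coe_nnnorm]
  have h2 : (‖M ^ N‖₊ : ENNReal) < 1 := by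
    by_contra! hcon
    exact absurd hN (not_lt.2 (ENNReal.one_le_rpow hcon (by positivity)))
  exact_mod_cast h2

theorem continuous_exp_smul {n : ℕ} (A : Matrix (Fin n) (Fin n) ℝ) :
    Continuous fun t : ℝ => NormedSpace.exp (t • A) :=
  continuous_iff_continuousAt.2 fun t => (hasDerivAt_exp_smul_const (𝕂 := ℝ) A t).continuousAt

/-- The matrix exponential of a Hurwitz matrix decays exponentially. -/
theorem IsHurwitz.exists_norm_exp_le {n : ℕ} {A : Matrix (Fin n) (Fin n) ℝ}
    (hA : IsHurwitz A) :
    ∃ C δ : ℝ, 0 < C ∧ 0 < δ ∧ ∀ t : ℝ, 0 ≤ t →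
      ‖NormedSpace.exp (t • A)‖ ≤ C * Real.exp (-δ * t) := by
  obtain ⟨N, hN0, hN⟩ := hA.exists_norm_exp_pow_lt
  have hNpos : (0 : ℝ) < N := by exact_mod_cast hN0
  obtain ⟨K, hK⟩ := (isCompact_Icc (a := (0 : ℝ)) (b := N)).exists_bound_of_continuousOn
    (continuous_exp_smul A).continuousOn
  -- The maximum with `1 / 2` keeps `r` positive, so that `-log r / N` can serve as the decay rate.
  set r := max ‖NormedSpace.exp A ^ N‖ (1 / 2) with hr
  have hr0 : 0 < r := lt_of_lt_of_le (by norm_num) (le_max_right _ _)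
  have hr1 : r < 1 := max_lt hN (by norm_num)
  have hlog : Real.log r < 0 := Real.log_neg hr0 hr1
  have hK0 : 0 ≤ K := (norm_nonneg _).trans (hK 0 ⟨le_rfl, hNpos.le⟩)
  refine ⟨(K + 1) / r, -Real.log r / N, by positivity, div_pos (neg_pos.2 hlog) hNpos, ?_⟩
  intro t ht
  -- Write `t` as `m N` plus a remainder in `[0, N)`: the first part contributes `r ^ m`, the second
  -- is bounded by compactness.
  set m := ⌊t / N⌋₊ with hm
  have hmle : (m : ℝ) * N ≤ t := by
    rw [← le_div_iff₀ hNpos]; exact Nat.floor_le (by positivity)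
  have hlt : t < (m + 1) * N := by
    rw [← div_lt_iff₀ hNpos]; exact Nat.lt_floor_add_one _
  have hpowN : ∀ j : ℕ, NormedSpace.exp A ^ j = NormedSpace.exp ((j : ℝ) • A) := by
    intro j
    rw [Nat.cast_smul_eq_nsmul, Matrix.exp_nsmul]
  have hsplit : NormedSpace.exp (t • A)
      = (NormedSpace.exp A ^ N) ^ m * NormedSpace.exp ((t - m * N) • A) := by
    rw [← pow_mul, hpowN, ← Matrix.exp_add_of_commute]
    · congr 1
      rw [← add_smul]
      congr 1
      push_cast
      ring
    · exact ((Commute.refl A).smul_left _).smul_right _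
  have hrm : r ^ m ≤ r⁻¹ * Real.exp (-(-Real.log r / N) * t) := by
    rw [← Real.exp_log (inv_pos.2 hr0), ← Real.exp_add, ← Real.exp_log (pow_pos hr0 m)]
    refine Real.exp_le_exp.2 ?_
    rw [Real.log_pow, Real.log_inv]
    have : t / N ≤ m + 1 := by rw [div_le_iff₀ hNpos]; exact hlt.le
    have h2 : -(-Real.log r / N) * t = Real.log r * (t / N) := by ring
    rw [h2]
    nlinarith
  rcases isEmpty_or_nonempty (Fin n) with h | h
  · rw [Subsingleton.elim (NormedSpace.exp (t • A)) 0, norm_zero]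
    positivity
  calc ‖NormedSpace.exp (t • A)‖
      ≤ ‖(NormedSpace.exp A ^ N) ^ m‖ * ‖NormedSpace.exp ((t - m * N) • A)‖ := by
        rw [hsplit]; exact norm_mul_le _ _
    _ ≤ r ^ m * (K + 1) := by
        gcongr
        · exact (norm_pow_le _ _).trans (pow_le_pow_left₀ (norm_nonneg _) (le_max_left _ _) _)
        · exact (hK _ ⟨by linarith, by linarith⟩).trans (by linarith)
    _ ≤ (r⁻¹ * Real.exp (-(-Real.log r / N) * t)) * (K + 1) := by gcongr
    _ = _ := by ring

end MatrixNorm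

end MinimaxCT

namespace MinimaxCT

open Matrix Filter Topology Set

/-! ### Variation of constants and an energy estimate for exponential convolutions. -/

section Flow

variable {n : ℕ} (A : Matrix (Fin n) (Fin n) ℝ)

/-- Stated entrywise, so that the auxiliary choice of a matrix norm stays inside the proof. -/
theorem hasDerivAt_exp_smul_entry (t : ℝ) (i j : Fin n) :
    HasDerivAt (fun s : ℝ => NormedSpace.exp (s • A) i j)
      ((A * NormedSpace.exp (t • A)) i j) t := by
  let := Matrix.linftyOpNormedAddCommGroup (m := Fin n) (n := Fin n) (α := ℝ)
  let := Matrix.linftyOpNormedSpace (m := Fin n) (n := Fin n) (α := ℝ) (R := ℝ)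
  let := Matrix.linftyOpNormedRing (n := Fin n) (α := ℝ)
  let := Matrix.linftyOpNormedAlgebra (n := Fin n) (α := ℝ) (R := ℝ)
  have h := hasDerivAt_exp_smul_const' (𝕂 := ℝ) A t
  let L : Matrix (Fin n) (Fin n) ℝ →L[ℝ] ℝ :=
    LinearMap.toContinuousLinearMap (Matrix.entryLinearMap ℝ ℝ i j)
  exact L.hasFDerivAt.comp_hasDerivAt t h

theorem continuous_exp_smul_entry (i j : Fin n) :
    Continuous fun s : ℝ => NormedSpace.exp (s • A) i j :=
  continuous_iff_continuousAt.2 fun t => (hasDerivAt_exp_smul_entry A t i j).continuousAt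

theorem continuous_exp_smul_matrix : Continuous fun s : ℝ => NormedSpace.exp (s • A) :=
  continuous_matrix fun i j => continuous_exp_smul_entry A i j

theorem exp_add_smul (s t : ℝ) :
    NormedSpace.exp ((s + t) • A) = NormedSpace.exp (s • A) * NormedSpace.exp (t • A) := by
  rw [add_smul, Matrix.exp_add_of_commute]
  exact ((Commute.refl A).smul_left _).smul_right _

theorem commute_exp_smul (t : ℝ) : Commute A (NormedSpace.exp (t • A)) :=
  ((Commute.refl A).smul_right t).exp_right

theorem IsHurwitz.exists_norm_exp_mulVec_le {A : Matrix (Fin n) (Fin n) ℝ} (hA : IsHurwitz A) :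
    ∃ C δ : ℝ, 0 < C ∧ 0 < δ ∧ ∀ t : ℝ, 0 ≤ t → ∀ a : Fin n → ℝ,
      ‖NormedSpace.exp (t • A) *ᵥ a‖ ≤ C * Real.exp (-δ * t) * ‖a‖ := by
  obtain ⟨C, δ, hC, hδ, h⟩ := hA.exists_norm_exp_le
  let := Matrix.linftyOpNormedAddCommGroup (m := Fin n) (n := Fin n) (α := ℝ)
  refine ⟨C, δ, hC, hδ, fun t ht a => (Matrix.linfty_opNorm_mulVec _ _).trans ?_⟩
  gcongr
  exact h t ht

theorem exists_norm_mulVec_le {κ ι : Type*} [Fintype κ] [Fintype ι] (M : Matrix κ ι ℝ) :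
    ∃ C : ℝ, 0 ≤ C ∧ ∀ v : ι → ℝ, ‖M *ᵥ v‖ ≤ C * ‖v‖ := by
  let := Matrix.linftyOpNormedAddCommGroup (m := κ) (n := ι) (α := ℝ)
  exact ⟨‖M‖, norm_nonneg _, fun v => Matrix.linfty_opNorm_mulVec _ _⟩

/-- Product rule for two primitives of integrable functions, in integrated form. -/
theorem mul_primitive_eq {p q : ℝ → ℝ} {T : ℝ} (hp : IntervalIntegrable p volume 0 T)
    (hq : IntervalIntegrable q volume 0 T) (c d : ℝ) :
    (c + ∫ s in (0 : ℝ)..T, p s) * (d + ∫ s in (0 : ℝ)..T, q s) = c * d +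
      ∫ t in (0 : ℝ)..T,
        (p t * (d + ∫ s in (0 : ℝ)..t, q s) + (c + ∫ s in (0 : ℝ)..t, p s) * q t) := by
  -- Primitives of integrable functions are absolutely continuous with the expected derivative
  -- almost everywhere, which is all that integration by parts needs.
  have key : ∀ {r : ℝ → ℝ} (e : ℝ), IntervalIntegrable r volume 0 T →
      AbsolutelyContinuousOnInterval (fun t => e + ∫ s in (0 : ℝ)..t, r s) 0 T ∧
      ∀ᵐ t, t ∈ uIcc 0 T → deriv (fun t => e + ∫ s in (0 : ℝ)..t, r s) t = r t := by
    intro r e hr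
    constructor
    · have h1 : AbsolutelyContinuousOnInterval (fun _ : ℝ => e) 0 T :=
        (contDiff_const (n := 1)).contDiffOn.absolutelyContinuousOnInterval
      exact h1.add (hr.absolutelyContinuousOnInterval_intervalIntegral (by simp))
    · filter_upwards [hr.ae_hasDerivAt_integral] with t ht htm
      exact ((ht htm 0 (by simp)).const_add e).deriv
  obtain ⟨hP, hP'⟩ := key c hp
  obtain ⟨hQ, hQ'⟩ := key d hq
  have h := hP.integral_deriv_mul_eq_sub hQ
  have h2 : (∫ t in (0 : ℝ)..T,
        (p t * (d + ∫ s in (0 : ℝ)..t, q s) + (c + ∫ s in (0 : ℝ)..t, p s) * q t)) =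
      ∫ x in (0 : ℝ)..T, deriv (fun t => c + ∫ s in (0 : ℝ)..t, p s) x *
        (fun t => d + ∫ s in (0 : ℝ)..t, q s) x +
        (fun t => c + ∫ s in (0 : ℝ)..t, p s) x *
        deriv (fun t => d + ∫ s in (0 : ℝ)..t, q s) x := by
    refine intervalIntegral.integral_congr_ae ?_
    filter_upwards [hP', hQ'] with t h1 h2 ht
    have ht' := uIoc_subset_uIcc ht
    simp only [h1 ht', h2 ht']
  rw [h2, h]
  simp

/-- The solution of `ẋ = A x + f`, `x(0) = a`, by variation of constants. -/
noncomputable def stateResponse (a : Fin n → ℝ) (f : ℝ → Fin n → ℝ) (t : ℝ) : Fin n → ℝ :=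
  NormedSpace.exp (t • A) *ᵥ (a + ∫ τ in (0 : ℝ)..t, NormedSpace.exp ((-τ) • A) *ᵥ f τ)


theorem intervalIntegrable_pi_iff {ι : Type*} [Fintype ι] {f : ℝ → ι → ℝ} {s t : ℝ} :
    IntervalIntegrable f volume s t ↔ ∀ i, IntervalIntegrable (fun τ => f τ i) volume s t := by
  simp only [intervalIntegrable_iff, IntegrableOn]
  exact integrable_pi_iff

theorem intervalIntegral_apply {ι : Type*} [Fintype ι] {f : ℝ → ι → ℝ} {s t : ℝ}
    (hf : IntervalIntegrable f volume s t) (i : ι) :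
    (∫ τ in s..t, f τ) i = ∫ τ in s..t, f τ i :=
  ((ContinuousLinearMap.proj (R := ℝ) (φ := fun _ : ι => ℝ) i).intervalIntegral_comp_comm
    (f := f) hf).symm

theorem intervalIntegrable_mulVec {κ ι : Type*} [Fintype ι] [Fintype κ] {M : ℝ → Matrix κ ι ℝ}
    (hM : Continuous M) {f : ℝ → ι → ℝ} {s t : ℝ} (hf : IntervalIntegrable f volume s t) :
    IntervalIntegrable (fun τ => M τ *ᵥ f τ) volume s t := by
  rw [intervalIntegrable_pi_iff] at hf ⊢
  intro i
  simp only [Matrix.mulVec, dotProduct]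
  have h := IntervalIntegrable.sum Finset.univ (f := fun j τ => M τ i j * f τ j)
    (μ := volume) (a := s) (b := t) fun j _ =>
      (hf j).continuousOn_mul (hM.matrix_elem i j).continuousOn
  simpa only [Finset.sum_fn] using h

theorem continuousOn_primitive_Ici {E : Type*} [NormedAddCommGroup E] [NormedSpace ℝ E]
    {f : ℝ → E} (hf : ∀ t, 0 ≤ t → IntervalIntegrable f volume 0 t) :
    ContinuousOn (fun t => ∫ τ in (0 : ℝ)..t, f τ) (Ici 0) := by
  intro t ht
  have ht0 : (0 : ℝ) ≤ t := ht
  have h := intervalIntegral.continuousOn_primitive_interval' (hf (t + 1) (by linarith))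
    (left_mem_uIcc)
  rw [uIcc_of_le (by linarith)] at h
  refine (h t ⟨ht0, by linarith⟩).mono_of_mem_nhdsWithin ?_
  rw [mem_nhdsWithin]
  exact ⟨Iio (t + 1), isOpen_Iio, by simp, fun s hs => ⟨hs.2, hs.1.le⟩⟩

theorem continuousOn_stateResponse (a : Fin n → ℝ) {f : ℝ → Fin n → ℝ}
    (hf : ∀ t, 0 ≤ t → IntervalIntegrable f volume 0 t) :
    ContinuousOn (stateResponse A a f) (Ici 0) := by
  have h1 := continuousOn_primitive_Ici fun t ht =>
    intervalIntegrable_mulVec ((continuous_exp_smul_matrix A).comp continuous_neg) (hf t ht)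
  have h2 : ContinuousOn (fun t => a +
      ∫ τ in (0 : ℝ)..t, NormedSpace.exp ((-τ) • A) *ᵥ f τ) (Ici 0) := continuousOn_const.add h1
  rw [continuousOn_pi] at h2 ⊢
  intro i
  simp only [stateResponse, Matrix.mulVec, dotProduct]
  exact continuousOn_finsetSum _ fun j _ =>
    (continuous_exp_smul_entry A i j).continuousOn.mul (h2 j)

/-- The forcing is merely integrable, so the response cannot be differentiated everywhere. The
integrated product rule `mul_primitive_eq`, applied to the entries of `exp(tA)` and to the primitive
of `exp(-τA) f(τ)`, takes the place of differentiation. -/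
theorem stateResponse_eq_integral (a : Fin n → ℝ) {f : ℝ → Fin n → ℝ} {t : ℝ}
    (hf : IntervalIntegrable f volume 0 t) :
    stateResponse A a f t = a + ∫ τ in (0 : ℝ)..t, (A *ᵥ stateResponse A a f τ + f τ) := by
  set g : ℝ → Fin n → ℝ := fun τ => NormedSpace.exp ((-τ) • A) *ᵥ f τ with hg
  have hgi : IntervalIntegrable g volume 0 t :=
    intervalIntegrable_mulVec ((continuous_exp_smul_matrix A).comp continuous_neg) hf
  have hgj := intervalIntegrable_pi_iff.1 hgi
  have hprim : ∀ s ∈ uIcc 0 t, ∀ j, (∫ τ in (0 : ℝ)..s, g τ) j = ∫ τ in (0 : ℝ)..s, g τ j :=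
    fun s hs j => intervalIntegral_apply (hgi.mono_set (uIcc_subset_uIcc_left hs)) j
  have hE : ∀ i j (s : ℝ), NormedSpace.exp (s • A) i j = (1 : Matrix (Fin n) (Fin n) ℝ) i j +
      ∫ τ in (0 : ℝ)..s, (A * NormedSpace.exp (τ • A)) i j := by
    intro i j s
    rw [intervalIntegral.integral_eq_sub_of_hasDerivAt
      (fun x _ => hasDerivAt_exp_smul_entry A x i j)]
    · simp
    · exact ((continuous_const.matrix_mul (continuous_exp_smul_matrix A)).matrix_elem
        i j).intervalIntegrable _ _
  have hEi : ∀ i j, IntervalIntegrable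
      (fun τ => (A * NormedSpace.exp (τ • A)) i j) volume 0 t := fun i j =>
    ((continuous_const.matrix_mul (continuous_exp_smul_matrix A)).matrix_elem
        i j).intervalIntegrable _ _
  have hint : IntervalIntegrable (fun τ => A *ᵥ stateResponse A a f τ + f τ) volume 0 t := by
    refine IntervalIntegrable.add ?_ hf
    refine intervalIntegrable_mulVec continuous_const ?_
    refine intervalIntegrable_mulVec (continuous_exp_smul_matrix A) ?_
    refine IntervalIntegrable.add (by simp) (ContinuousOn.intervalIntegrable ?_)
    exact intervalIntegral.continuousOn_primitive_interval' hgi left_mem_uIcc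
  have hprod : ∀ i j, NormedSpace.exp (t • A) i j * (a j + ∫ τ in (0 : ℝ)..t, g τ j) =
      (1 : Matrix (Fin n) (Fin n) ℝ) i j * a j + ∫ s in (0 : ℝ)..t,
        ((A * NormedSpace.exp (s • A)) i j * (a j + ∫ τ in (0 : ℝ)..s, g τ j) +
          NormedSpace.exp (s • A) i j * g s j) := by
    intro i j
    rw [hE i j t, mul_primitive_eq (hEi i j) (hgj j)]
    simp only [← hE]
  have hprodi : ∀ i j, IntervalIntegrable (fun s =>
      ((A * NormedSpace.exp (s • A)) i j * (a j + ∫ τ in (0 : ℝ)..s, g τ j) +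
          NormedSpace.exp (s • A) i j * g s j)) volume 0 t := by
    intro i j
    refine IntervalIntegrable.add ?_ ?_
    · refine (hEi i j).mul_continuousOn (continuousOn_const.add ?_)
      exact intervalIntegral.continuousOn_primitive_interval' (hgj j) left_mem_uIcc
    · exact (hgj j).continuousOn_mul (continuous_exp_smul_entry A i j).continuousOn
  ext i
  rw [Pi.add_apply, intervalIntegral_apply hint]
  have hL : stateResponse A a f t i =
      ∑ j, NormedSpace.exp (t • A) i j * (a j + ∫ τ in (0 : ℝ)..t, g τ j) := by
    simp only [stateResponse, Matrix.mulVec, dotProduct, Pi.add_apply]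
    refine Finset.sum_congr rfl fun j _ => ?_
    rw [← hprim t right_mem_uIcc]
  rw [hL]
  simp only [hprod]
  rw [Finset.sum_add_distrib, ← intervalIntegral.integral_finsetSum fun j _ => hprodi i j]
  congr 1
  · simp [Matrix.one_apply]
  refine intervalIntegral.integral_congr fun s hs => ?_
  have h1 : NormedSpace.exp (s • A) *ᵥ g s = f s := by
    simp only [hg]
    rw [Matrix.mulVec_mulVec, ← exp_add_smul]
    simp
  have h2 : A *ᵥ stateResponse A a f s =
      (A * NormedSpace.exp (s • A)) *ᵥ (a + ∫ τ in (0 : ℝ)..s, g τ) := by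
    rw [← Matrix.mulVec_mulVec]
    rfl
  rw [Pi.add_apply, h2, ← congrFun h1 i]
  simp only [Matrix.mulVec, dotProduct, Finset.sum_add_distrib, Pi.add_apply, hprim s hs]

theorem norm_stateResponse_le {C δ : ℝ}
    (hC : ∀ t : ℝ, 0 ≤ t → ∀ a : Fin n → ℝ,
      ‖NormedSpace.exp (t • A) *ᵥ a‖ ≤ C * Real.exp (-δ * t) * ‖a‖)
    (a : Fin n → ℝ) {f : ℝ → Fin n → ℝ} {t : ℝ} (ht : 0 ≤ t)
    (hf : IntervalIntegrable f volume 0 t) :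
    ‖stateResponse A a f t‖ ≤ C * Real.exp (-δ * t) * ‖a‖ +
      C * ∫ τ in (0 : ℝ)..t, Real.exp (-δ * (t - τ)) * ‖f τ‖ := by
  have hgi : IntervalIntegrable (fun τ => NormedSpace.exp ((-τ) • A) *ᵥ f τ) volume 0 t :=
    intervalIntegrable_mulVec ((continuous_exp_smul_matrix A).comp continuous_neg) hf
  rw [stateResponse, Matrix.mulVec_add]
  refine (norm_add_le _ _).trans (add_le_add (hC t ht a) ?_)
  have h1 : NormedSpace.exp (t • A) *ᵥ
      (∫ τ in (0 : ℝ)..t, NormedSpace.exp ((-τ) • A) *ᵥ f τ) =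
      ∫ τ in (0 : ℝ)..t, NormedSpace.exp ((t - τ) • A) *ᵥ f τ := by
    have := (LinearMap.toContinuousLinearMap
      (Matrix.mulVecLin (NormedSpace.exp (t • A)))).intervalIntegral_comp_comm hgi
    simp only [LinearMap.coe_toContinuousLinearMap', Matrix.mulVecLin_apply] at this
    rw [← this]
    simp only [Matrix.mulVec_mulVec, ← exp_add_smul, sub_eq_add_neg]
  rw [h1, ← intervalIntegral.integral_const_mul]
  refine intervalIntegral.norm_integral_le_of_norm_le ht (ae_of_all _ fun τ hτ => ?_) ?_
  · rw [← mul_assoc]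
    exact hC (t - τ) (by linarith [hτ.2]) _
  · exact (hf.norm.continuousOn_mul (Continuous.continuousOn (by fun_prop))).const_mul _

/-- The convolution `F` solves `F' = -δ F + f`, so `F(T)² = 2 ∫ F (f - δ F) ≤ ∫ (-δ F² + δ⁻¹ f²)`;
drop `F(T)² ≥ 0`. -/
theorem integral_expConv_sq_le {δ : ℝ} (hδ : 0 < δ) {f : ℝ → ℝ} {T : ℝ} (hT : 0 ≤ T)
    (hf : IntervalIntegrable f volume 0 T)
    (hf2 : IntervalIntegrable (fun t => f t ^ 2) volume 0 T) :
    ∫ t in (0 : ℝ)..T, (∫ τ in (0 : ℝ)..t, Real.exp (-δ * (t - τ)) * f τ) ^ 2 ≤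
      (δ ^ 2)⁻¹ * ∫ t in (0 : ℝ)..T, f t ^ 2 := by
  set F : ℝ → ℝ := fun t => ∫ τ in (0 : ℝ)..t, Real.exp (-δ * (t - τ)) * f τ with hF
  set g : ℝ → ℝ := fun τ => Real.exp (δ * τ) * f τ with hg
  have hgi : IntervalIntegrable g volume 0 T :=
    hf.continuousOn_mul (Continuous.continuousOn (by fun_prop))
  have hFg : ∀ t, F t = Real.exp (-δ * t) * ∫ τ in (0 : ℝ)..t, g τ := by
    intro t
    rw [hF, ← intervalIntegral.integral_const_mul]
    refine intervalIntegral.integral_congr fun τ _ => ?_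
    simp only [hg]
    rw [← mul_assoc, ← Real.exp_add]
    ring_nf
  have hFc : ContinuousOn F (uIcc 0 T) := by
    rw [funext hFg]
    exact (Continuous.continuousOn (by fun_prop)).mul
      (intervalIntegral.continuousOn_primitive_interval' hgi left_mem_uIcc)
  have hexp : ∀ t : ℝ, Real.exp (-δ * t) = 1 + ∫ s in (0 : ℝ)..t, -δ * Real.exp (-δ * s) := by
    intro t
    rw [intervalIntegral.integral_eq_sub_of_hasDerivAt (f := fun s => Real.exp (-δ * s))]
    · simp
    · intro x _
      have := ((hasDerivAt_id x).const_mul (-δ)).exp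
      simpa [mul_comm] using this
    · exact Continuous.intervalIntegrable (by fun_prop) _ _
  have hF' : ∀ t ∈ uIcc 0 T, F t = ∫ s in (0 : ℝ)..t, (-δ * F s + f s) := by
    intro t ht
    have h := mul_primitive_eq (p := fun s => -δ * Real.exp (-δ * s)) (q := g) (T := t)
      (Continuous.intervalIntegrable (by fun_prop) _ _)
      (hgi.mono_set (uIcc_subset_uIcc_left ht)) 1 0
    simp only [← hexp, zero_add, mul_zero] at h
    rw [hFg, h]
    refine intervalIntegral.integral_congr fun s _ => ?_
    simp only [hFg, hg]
    rw [← mul_assoc (Real.exp (-δ * s)), ← Real.exp_add]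
    simp [mul_assoc]
  have hpi : IntervalIntegrable (fun s => -δ * F s + f s) volume 0 T :=
    (hFc.intervalIntegrable.const_mul _).add hf
  have hsq := mul_primitive_eq hpi hpi 0 0
  simp only [zero_add, mul_zero] at hsq
  rw [← hF' T right_mem_uIcc] at hsq
  have hsq2 : ∫ t in (0 : ℝ)..T, ((-δ * F t + f t) * F t + F t * (-δ * F t + f t)) = F T * F T := by
    rw [hsq]
    refine intervalIntegral.integral_congr fun s hs => ?_
    simp only [← hF' s hs]
  have hF2 : IntervalIntegrable (fun t => F t ^ 2) volume 0 T := (hFc.pow 2).intervalIntegrable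
  have hle : F T * F T ≤ ∫ t in (0 : ℝ)..T, (-δ * F t ^ 2 + δ⁻¹ * f t ^ 2) := by
    rw [← hsq2]
    refine intervalIntegral.integral_mono_on hT ?_ ((hF2.const_mul _).add (hf2.const_mul _)) ?_
    · exact (hpi.mul_continuousOn hFc).add (hpi.continuousOn_mul hFc)
    · intro t _
      have h0 : 0 ≤ (δ * F t - f t) ^ 2 * δ⁻¹ := by positivity
      have h1 : (δ * F t - f t) ^ 2 * δ⁻¹ = δ * F t ^ 2 - 2 * F t * f t + δ⁻¹ * f t ^ 2 := by
        field_simp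
        ring
      nlinarith
  rw [intervalIntegral.integral_add (hF2.const_mul _) (hf2.const_mul _),
    intervalIntegral.integral_const_mul, intervalIntegral.integral_const_mul] at hle
  have h3 : δ * ∫ t in (0 : ℝ)..T, F t ^ 2 ≤ δ⁻¹ * ∫ t in (0 : ℝ)..T, f t ^ 2 := by
    nlinarith [mul_self_nonneg (F T)]
  calc ∫ t in (0 : ℝ)..T, F t ^ 2 = δ⁻¹ * (δ * ∫ t in (0 : ℝ)..T, F t ^ 2) := by
        field_simp
    _ ≤ δ⁻¹ * (δ⁻¹ * ∫ t in (0 : ℝ)..T, f t ^ 2) := by gcongr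
    _ = _ := by field_simp

end Flow

/-! ### Square integrability, linearity and uniqueness of the state response. -/

section Response

variable {n : ℕ} (A : Matrix (Fin n) (Fin n) ℝ)

theorem integrableOn_exp_neg_mul {δ : ℝ} (hδ : 0 < δ) :
    IntegrableOn (fun t : ℝ => Real.exp (-δ * t)) (Ioi 0) := exp_neg_integrableOn_Ioi 0 hδ

/-- The response of a Hurwitz system to a square integrable forcing term is square integrable. -/
theorem IsHurwitz.exists_integral_norm_stateResponse_sq_le {A : Matrix (Fin n) (Fin n) ℝ}
    (hA : IsHurwitz A) : ∃ K : ℝ, 0 ≤ K ∧ ∀ (a : Fin n → ℝ) (f : ℝ → Fin n → ℝ),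
      (∀ t, 0 ≤ t → IntervalIntegrable f volume 0 t) →
      IntegrableOn (fun t => ‖f t‖ ^ 2) (Ioi 0) →
      IntegrableOn (fun t => ‖stateResponse A a f t‖ ^ 2) (Ioi 0) ∧
      ∫ t in Ioi 0, ‖stateResponse A a f t‖ ^ 2 ≤ K * (‖a‖ ^ 2 + ∫ t in Ioi 0, ‖f t‖ ^ 2) := by
  obtain ⟨C, δ, hC0, hδ, hC⟩ := hA.exists_norm_exp_mulVec_le
  set J : ℝ := ∫ t in Ioi (0 : ℝ), Real.exp (-(2 * δ) * t) with hJ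
  have hJ0 : 0 ≤ J := integral_nonneg fun t => (Real.exp_pos _).le
  -- The first summand is the constant for the free response, the second the one for the forced
  -- response.
  refine ⟨2 * C ^ 2 * J + 2 * C ^ 2 * (δ ^ 2)⁻¹, by positivity, fun a f hf hf2 => ?_⟩
  set I := ∫ t in Ioi (0 : ℝ), ‖f t‖ ^ 2 with hI
  have hI0 : 0 ≤ I := integral_nonneg fun t => by positivity
  have hcont := continuousOn_stateResponse A a hf
  have hci : ∀ T : ℝ, 0 ≤ T →
      IntervalIntegrable (fun t => ‖stateResponse A a f t‖ ^ 2) volume 0 T := by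
    intro T hT
    refine ContinuousOn.intervalIntegrable ((hcont.mono ?_).norm.pow 2)
    rw [uIcc_of_le hT]
    exact Icc_subset_Ici_self
  have hsub : ∀ (h : ℝ → ℝ), IntegrableOn h (Ioi 0) → (∀ t, 0 ≤ h t) → ∀ T : ℝ, 0 ≤ T →
      ∫ t in (0 : ℝ)..T, h t ≤ ∫ t in Ioi 0, h t := by
    intro h hh h0 T hT
    rw [intervalIntegral.integral_of_le hT]
    exact setIntegral_mono_set hh (ae_of_all _ h0) Ioc_subset_Ioi_self.eventuallyLE
  have hbound : ∀ T : ℝ, 0 ≤ T → ∫ t in (0 : ℝ)..T, ‖stateResponse A a f t‖ ^ 2 ≤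
      (2 * C ^ 2 * J + 2 * C ^ 2 * (δ ^ 2)⁻¹) * (‖a‖ ^ 2 + I) := by
    intro T hT
    have hfT := hf T hT
    have hf2T : IntervalIntegrable (fun t => ‖f t‖ ^ 2) volume 0 T := by
      rw [intervalIntegrable_iff_integrableOn_Ioc_of_le hT]
      exact hf2.mono_set Ioc_subset_Ioi_self
    set F : ℝ → ℝ := fun t => ∫ τ in (0 : ℝ)..t, Real.exp (-δ * (t - τ)) * ‖f τ‖ with hF
    have hFc : ContinuousOn F (uIcc 0 T) := by
      have : F = fun t => Real.exp (-δ * t) * ∫ τ in (0 : ℝ)..t, Real.exp (δ * τ) * ‖f τ‖ := by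
        ext t
        rw [hF, ← intervalIntegral.integral_const_mul]
        refine intervalIntegral.integral_congr fun τ _ => ?_
        rw [← mul_assoc, ← Real.exp_add]
        ring_nf
      rw [this]
      refine (Continuous.continuousOn (by fun_prop)).mul
        (intervalIntegral.continuousOn_primitive_interval' ?_ left_mem_uIcc)
      exact hfT.norm.continuousOn_mul (Continuous.continuousOn (by fun_prop))
    have hFi : IntervalIntegrable (fun t => F t ^ 2) volume 0 T := (hFc.pow 2).intervalIntegrable
    have hei : IntervalIntegrable (fun t => Real.exp (-(2 * δ) * t)) volume 0 T :=
      Continuous.intervalIntegrable (by fun_prop) _ _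
    calc ∫ t in (0 : ℝ)..T, ‖stateResponse A a f t‖ ^ 2
        ≤ ∫ t in (0 : ℝ)..T, (2 * C ^ 2 * ‖a‖ ^ 2 * Real.exp (-(2 * δ) * t) +
            2 * C ^ 2 * F t ^ 2) := by
          refine intervalIntegral.integral_mono_on hT (hci T hT)
            ((hei.const_mul _).add (hFi.const_mul _)) fun t ht => ?_
          have h1 := norm_stateResponse_le A hC a ht.1 (hf t ht.1)
          have h2 : Real.exp (-(2 * δ) * t) = Real.exp (-δ * t) ^ 2 := by
            rw [← Real.exp_nat_mul]; congr 1; push_cast; ring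
          rw [h2]
          calc _ ≤ (C * Real.exp (-δ * t) * ‖a‖ + C * F t) ^ 2 :=
                pow_le_pow_left₀ (norm_nonneg _) h1 2
            _ ≤ _ := by
                nlinarith [sq_nonneg (C * Real.exp (-δ * t) * ‖a‖ - C * F t)]
      _ = 2 * C ^ 2 * ‖a‖ ^ 2 * (∫ t in (0 : ℝ)..T, Real.exp (-(2 * δ) * t)) +
            2 * C ^ 2 * ∫ t in (0 : ℝ)..T, F t ^ 2 := by
          rw [intervalIntegral.integral_add (hei.const_mul _) (hFi.const_mul _),
            intervalIntegral.integral_const_mul, intervalIntegral.integral_const_mul]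
      _ ≤ 2 * C ^ 2 * ‖a‖ ^ 2 * J + 2 * C ^ 2 * ((δ ^ 2)⁻¹ * I) := by
          gcongr
          · exact hsub _ (integrableOn_exp_neg_mul (by positivity)) (fun t => (Real.exp_pos _).le)
              T hT
          · refine (integral_expConv_sq_le hδ hT hfT.norm hf2T).trans ?_
            gcongr
            exact hsub _ hf2 (fun t => by positivity) T hT
      _ ≤ _ := by
          have : 0 ≤ 2 * C ^ 2 * J * I + 2 * C ^ 2 * (δ ^ 2)⁻¹ * ‖a‖ ^ 2 := by positivity
          nlinarith
  have hint : IntegrableOn (fun t => ‖stateResponse A a f t‖ ^ 2) (Ioi 0) := by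
    refine integrableOn_Ioi_of_intervalIntegral_norm_bounded (l := atTop) (b := fun i : ℕ => (i : ℝ))
      ((2 * C ^ 2 * J + 2 * C ^ 2 * (δ ^ 2)⁻¹) * (‖a‖ ^ 2 + I)) 0 (fun i => ?_)
      tendsto_natCast_atTop_atTop (Eventually.of_forall fun i => ?_)
    · exact (intervalIntegrable_iff_integrableOn_Ioc_of_le (Nat.cast_nonneg i)).1
        (hci i (Nat.cast_nonneg i))
    · simpa using hbound i (Nat.cast_nonneg i)
  refine ⟨hint, ?_⟩
  refine le_of_tendsto (intervalIntegral_tendsto_integral_Ioi 0 hint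
    (tendsto_natCast_atTop_atTop (R := ℝ))) (Eventually.of_forall fun i => ?_)
  exact hbound i (Nat.cast_nonneg i)

theorem stateResponse_add (a b : Fin n → ℝ) {f g : ℝ → Fin n → ℝ} {t : ℝ}
    (hf : IntervalIntegrable f volume 0 t) (hg : IntervalIntegrable g volume 0 t) :
    stateResponse A (a + b) (fun s => f s + g s) t =
      stateResponse A a f t + stateResponse A b g t := by
  simp only [stateResponse, ← Matrix.mulVec_add]
  have h := intervalIntegral.integral_add
    (intervalIntegrable_mulVec ((continuous_exp_smul_matrix A).comp continuous_neg) hf)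
    (intervalIntegrable_mulVec ((continuous_exp_smul_matrix A).comp continuous_neg) hg)
  simp only [Function.comp_apply, ← Matrix.mulVec_add] at h
  rw [h]
  congr 1
  abel

theorem stateResponse_smul (c : ℝ) (a : Fin n → ℝ) (f : ℝ → Fin n → ℝ) (t : ℝ) :
    stateResponse A (c • a) (fun s => c • f s) t = c • stateResponse A a f t := by
  simp only [stateResponse, Matrix.mulVec_smul, ← smul_add, intervalIntegral.integral_smul]

theorem stateResponse_congr (a : Fin n → ℝ) {f g : ℝ → Fin n → ℝ} {t : ℝ}
    (h : ∀ᵐ τ, τ ∈ uIoc 0 t → f τ = g τ) :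
    stateResponse A a f t = stateResponse A a g t := by
  simp only [stateResponse]
  congr 2
  refine intervalIntegral.integral_congr_ae ?_
  filter_upwards [h] with τ hτ hm
  rw [hτ hm]

theorem stateResponse_zero_right (a : Fin n → ℝ) (t : ℝ) :
    stateResponse A a 0 t = NormedSpace.exp (t • A) *ᵥ a := by
  simp [stateResponse]

theorem continuous_stateResponse (a : Fin n → ℝ) {f : ℝ → Fin n → ℝ} (hf : Continuous f) :
    Continuous (stateResponse A a f) := by
  have hg : Continuous fun τ : ℝ => NormedSpace.exp ((-τ) • A) *ᵥ f τ :=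
    ((continuous_exp_smul_matrix A).comp continuous_neg).matrix_mulVec hf
  exact (continuous_exp_smul_matrix A).matrix_mulVec (continuous_const.add
    (intervalIntegral.continuous_primitive (fun s t => hg.intervalIntegrable s t) 0))

theorem hasDerivAt_stateResponse (a : Fin n → ℝ) {f : ℝ → Fin n → ℝ} (hf : Continuous f) (t : ℝ) :
    HasDerivAt (stateResponse A a f) (A *ᵥ stateResponse A a f t + f t) t := by
  have hc : Continuous fun s => A *ᵥ stateResponse A a f s + f s :=
    (continuous_const.matrix_mulVec (continuous_stateResponse A a hf)).add hf
  have h1 := (intervalIntegral.integral_hasDerivAt_right (hc.intervalIntegrable 0 t)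
    (hc.stronglyMeasurableAtFilter _ _) hc.continuousAt).const_add a
  refine h1.congr_of_eventuallyEq (Eventually.of_forall fun s => ?_)
  exact stateResponse_eq_integral A a (hf.intervalIntegrable 0 s)

/-- Continuous solutions of the integral equation are unique. -/
theorem eqOn_of_integral_eq (a : Fin n → ℝ) {f y z : ℝ → Fin n → ℝ}
    (hf : ∀ t, 0 ≤ t → IntervalIntegrable f volume 0 t)
    (hy : ContinuousOn y (Ici 0)) (hz : ContinuousOn z (Ici 0))
    (hy' : ∀ t, 0 ≤ t → y t = a + ∫ τ in (0 : ℝ)..t, (A *ᵥ y τ + f τ))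
    (hz' : ∀ t, 0 ≤ t → z t = a + ∫ τ in (0 : ℝ)..t, (A *ᵥ z τ + f τ)) :
    EqOn y z (Ici 0) := by
  obtain ⟨K, hK0, hK⟩ := exists_norm_mulVec_le A
  have hmul : ∀ {x : ℝ → Fin n → ℝ}, ContinuousOn x (Ici 0) →
      ContinuousOn (fun t => A *ᵥ x t) (Ici 0) := fun hx =>
    (LinearMap.continuous_of_finiteDimensional A.mulVecLin).comp_continuousOn hx
  have hint : ∀ {x : ℝ → Fin n → ℝ}, ContinuousOn x (Ici 0) → ∀ t, 0 ≤ t →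
      IntervalIntegrable (fun τ => A *ᵥ x τ + f τ) volume 0 t := by
    intro x hx t ht
    refine IntervalIntegrable.add (ContinuousOn.intervalIntegrable ((hmul hx).mono ?_)) (hf t ht)
    rw [uIcc_of_le ht]
    exact Icc_subset_Ici_self
  set d : ℝ → Fin n → ℝ := fun t => y t - z t with hd
  have hdc : ContinuousOn d (Ici 0) := hy.sub hz
  have hdi : ∀ t, 0 ≤ t → d t = ∫ τ in (0 : ℝ)..t, A *ᵥ d τ := by
    intro t ht
    simp only [hd]
    rw [hy' t ht, hz' t ht, add_sub_add_left_eq_sub,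
      ← intervalIntegral.integral_sub (hint hy t ht) (hint hz t ht)]
    refine intervalIntegral.integral_congr fun τ _ => ?_
    rw [add_sub_add_right_eq_sub, Matrix.mulVec_sub]
  intro T hT
  have hT0 : (0 : ℝ) ≤ T := hT
  -- The difference satisfies `ḋ = A d` with `d(0) = 0`, and Grönwall applies. Only right
  -- derivatives are used, since continuity is known on `[0, ∞)` only.
  have h0 := eq_zero_of_abs_deriv_le_mul_abs_self_of_eq_zero_right (f := d)
    (f' := fun t => A *ᵥ d t) (K := K) (a := 0) (b := T) (hdc.mono Icc_subset_Ici_self) ?_ ?_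
    (fun x _ => hK _) T ⟨hT0, le_rfl⟩
  · exact sub_eq_zero.1 h0
  · intro t ht
    have hc := hmul hdc
    have h1 : HasDerivWithinAt (fun t => ∫ τ in (0 : ℝ)..t, A *ᵥ d τ) (A *ᵥ d t) (Ici t) t := by
      refine intervalIntegral.integral_hasDerivWithinAt_right ?_ (t := Ioi t) ?_ ?_
      · exact ContinuousOn.intervalIntegrable (hc.mono (by
          rw [uIcc_of_le ht.1]; exact Icc_subset_Ici_self))
      · exact ⟨Ioi t, self_mem_nhdsWithin, (hc.mono (fun s hs => ht.1.trans (le_of_lt hs))).aestronglyMeasurable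
          measurableSet_Ioi⟩
      · exact (hc t ht.1).mono fun s hs => ht.1.trans (le_of_lt hs)
    exact h1.congr (fun s hs => hdi s (ht.1.trans hs)) (hdi t ht.1)
  · rw [hdi 0 le_rfl]; simp

end Response

/-! ### A class of regular signals stable under the system. -/

/-- Continuous signals which vanish for nonpositive time and decay exponentially. -/
structure IsDecaying {κ : Type*} [Fintype κ] (u : ℝ → κ → ℝ) : Prop where
  continuous : Continuous u
  eq_zero : ∀ t ≤ 0, u t = 0
  decay : ∃ C δ : ℝ, 0 < C ∧ 0 < δ ∧ ∀ t, 0 ≤ t → ‖u t‖ ≤ C * Real.exp (-δ * t)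

namespace IsDecaying

variable {κ ι : Type*} [Fintype κ] [Fintype ι] {u v : ℝ → κ → ℝ}

theorem add (hu : IsDecaying u) (hv : IsDecaying v) : IsDecaying fun t => u t + v t := by
  refine ⟨hu.continuous.add hv.continuous, fun t ht => by
    simp [hu.eq_zero t ht, hv.eq_zero t ht], ?_⟩
  obtain ⟨C, δ, hC, hδ, h⟩ := hu.decay
  obtain ⟨C', δ', hC', hδ', h'⟩ := hv.decay
  refine ⟨C + C', min δ δ', by positivity, lt_min hδ hδ', fun t ht => ?_⟩
  calc ‖u t + v t‖ ≤ C * Real.exp (-δ * t) + C' * Real.exp (-δ' * t) :=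
        (norm_add_le _ _).trans (add_le_add (h t ht) (h' t ht))
    _ ≤ C * Real.exp (-(min δ δ') * t) + C' * Real.exp (-(min δ δ') * t) := by
        gcongr
        · exact min_le_left _ _
        · exact min_le_right _ _
    _ = _ := by ring

theorem mulVec (hu : IsDecaying u) (M : Matrix ι κ ℝ) : IsDecaying fun t => M *ᵥ u t := by
  refine ⟨continuous_const.matrix_mulVec hu.continuous, fun t ht => by
    simp [hu.eq_zero t ht], ?_⟩
  obtain ⟨C, δ, hC, hδ, h⟩ := hu.decay
  obtain ⟨K, hK0, hK⟩ := exists_norm_mulVec_le M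
  refine ⟨(K + 1) * C, δ, by positivity, hδ, fun t ht => (hK _).trans ?_⟩
  have := h t ht
  have h2 : 0 ≤ C * Real.exp (-δ * t) := by positivity
  nlinarith

theorem smul (hu : IsDecaying u) (c : ℝ) : IsDecaying fun t => c • u t := by
  classical
  have := hu.mulVec (c • (1 : Matrix κ κ ℝ))
  simpa [Matrix.smul_mulVec] using this

theorem sumElim {w : ℝ → ι → ℝ} (hu : IsDecaying u) (hw : IsDecaying w) :
    IsDecaying fun t => Sum.elim (u t) (w t) := by
  classical
  have h := (hu.mulVec (Matrix.fromRows (1 : Matrix κ κ ℝ) (0 : Matrix ι κ ℝ))).add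
    (hw.mulVec (Matrix.fromRows (0 : Matrix κ ι ℝ) (1 : Matrix ι ι ℝ)))
  convert h using 2 with t
  ext i
  rcases i with i | i <;> simp

theorem integrable (hu : IsDecaying u) : Integrable u := by
  obtain ⟨C, δ, hC, hδ, h⟩ := hu.decay
  have h1 : IntegrableOn u (Ioi 0) := by
    refine Integrable.mono' ((integrableOn_exp_neg_mul hδ).const_mul C)
      hu.continuous.aestronglyMeasurable ?_
    filter_upwards [ae_restrict_mem measurableSet_Ioi] with t ht
    exact h t (le_of_lt ht)
  rw [← integrableOn_univ, ← Iic_union_Ioi (a := (0 : ℝ))]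
  refine IntegrableOn.union ?_ h1
  exact integrableOn_zero.congr_fun (fun t ht => (hu.eq_zero t ht).symm) measurableSet_Iic

theorem integrable_apply (hu : IsDecaying u) (i : κ) : Integrable fun t => u t i :=
  integrable_pi_iff.1 hu.integrable i

theorem exists_bound (hu : IsDecaying u) : ∃ C, 0 < C ∧ ∀ t, ‖u t‖ ≤ C := by
  obtain ⟨C, δ, hC, hδ, h⟩ := hu.decay
  refine ⟨C, hC, fun t => ?_⟩
  rcases le_total t 0 with ht | ht
  · simp [hu.eq_zero t ht, hC.le]
  · refine (h t ht).trans ?_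
    have : Real.exp (-δ * t) ≤ 1 := Real.exp_le_one_iff.2 (by nlinarith)
    nlinarith

theorem integrable_mul_apply {w : ℝ → ι → ℝ} (hu : IsDecaying u) (hw : IsDecaying w) (i : κ)
    (j : ι) : Integrable fun t => u t i * w t j := by
  obtain ⟨C, hC, h⟩ := hw.exists_bound
  refine (hu.integrable_apply i).mul_bdd (c := C)
    ((continuous_apply j).comp hw.continuous).aestronglyMeasurable
    (ae_of_all _ fun t => (norm_le_pi_norm _ j).trans (h t))

theorem memLp_apply (hu : IsDecaying u) (i : κ) : MemLp (fun t => u t i) 2 := by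
  have hm : AEStronglyMeasurable (fun t => u t i) volume :=
    ((continuous_apply i).comp hu.continuous).aestronglyMeasurable
  rw [memLp_two_iff_integrable_sq hm]
  simpa [sq] using hu.integrable_mul_apply hu i i

/-- Convolving two exponentials of rate at least `m` gives a multiple of `t exp(-m t)`; lowering the
rate to `m / 2` absorbs the factor `t`. -/
theorem stateResponse {n : ℕ} {A : Matrix (Fin n) (Fin n) ℝ} (hA : IsHurwitz A)
    {f : ℝ → Fin n → ℝ} (hf : IsDecaying f) :
    IsDecaying (MinimaxCT.stateResponse A 0 f) := by
  refine ⟨continuous_stateResponse A 0 hf.continuous, fun t ht => ?_, ?_⟩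
  · rw [stateResponse_congr A 0 (g := 0), stateResponse_zero_right, Matrix.mulVec_zero]
    refine ae_of_all _ fun τ hτ => hf.eq_zero τ ?_
    rw [uIoc_of_ge ht] at hτ
    exact hτ.2
  obtain ⟨C, δ, hC, hδ, h⟩ := hA.exists_norm_exp_mulVec_le
  obtain ⟨C', δ', hC', hδ', h'⟩ := hf.decay
  set m := min δ δ' with hm
  have hm0 : 0 < m := lt_min hδ hδ'
  refine ⟨C * C' * (2 / m), m / 2, by positivity, by positivity, fun t ht => ?_⟩
  have h1 := norm_stateResponse_le A h 0 ht (hf.continuous.intervalIntegrable 0 t)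
  have h2 : ∫ τ in (0 : ℝ)..t, Real.exp (-δ * (t - τ)) * ‖f τ‖ ≤
      ∫ τ in (0 : ℝ)..t, C' * Real.exp (-m * t) := by
    refine intervalIntegral.integral_mono_on ht
      (Continuous.intervalIntegrable (by have := hf.continuous; fun_prop) _ _) (by simp) ?_
    intro τ hτ
    calc Real.exp (-δ * (t - τ)) * ‖f τ‖
        ≤ Real.exp (-m * (t - τ)) * (C' * Real.exp (-m * τ)) := by
          have h3 : Real.exp (-δ * (t - τ)) ≤ Real.exp (-m * (t - τ)) := by
            refine Real.exp_le_exp.2 ?_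
            have := min_le_left δ δ'
            nlinarith [hτ.2]
          have h4 : ‖f τ‖ ≤ C' * Real.exp (-m * τ) := by
            refine (h' τ hτ.1).trans ?_
            gcongr
            · exact hτ.1
            · exact min_le_right _ _
          gcongr
      _ = C' * (Real.exp (-m * (t - τ)) * Real.exp (-m * τ)) := by ring
      _ = C' * Real.exp (-m * t) := by rw [← Real.exp_add]; ring_nf
  rw [intervalIntegral.integral_const, sub_zero, smul_eq_mul] at h2
  have h5 : t * Real.exp (-m * t) ≤ (2 / m) * Real.exp (-(m / 2) * t) := by
    have h6 : m / 2 * t ≤ Real.exp (m / 2 * t) := by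
      have := Real.add_one_le_exp (m / 2 * t)
      linarith
    have h7 : Real.exp (-m * t) = Real.exp (-(m / 2) * t) * Real.exp (-(m / 2) * t) := by
      rw [← Real.exp_add]; ring_nf
    have h8 : Real.exp (m / 2 * t) * Real.exp (-(m / 2) * t) = 1 := by
      rw [← Real.exp_add]; ring_nf; exact Real.exp_zero
    have h9 : t ≤ (2 / m) * Real.exp (m / 2 * t) := by
      rw [div_mul_eq_mul_div, le_div_iff₀ hm0]; linarith
    calc t * Real.exp (-m * t) ≤ ((2 / m) * Real.exp (m / 2 * t)) *
          (Real.exp (-(m / 2) * t) * Real.exp (-(m / 2) * t)) := by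
          rw [h7]; gcongr
      _ = (2 / m) * (Real.exp (m / 2 * t) * Real.exp (-(m / 2) * t)) * Real.exp (-(m / 2) * t) := by
          ring
      _ = _ := by rw [h8, mul_one]
  calc _ ≤ C * (t * (C' * Real.exp (-m * t))) := by
        refine h1.trans ?_
        simp only [norm_zero, mul_zero, zero_add]
        gcongr
    _ = C * C' * (t * Real.exp (-m * t)) := by ring
    _ ≤ C * C' * ((2 / m) * Real.exp (-(m / 2) * t)) := by gcongr
    _ = _ := by ring

end IsDecaying

/-! ### Plancherel's formula and transfer functions. -/

section Fourier

open scoped FourierTransform SchwartzMap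

theorem continuous_fourier_of_integrable {f : ℝ → ℂ} (hf : Integrable f) : Continuous (𝓕 f) :=
  VectorFourier.fourierIntegral_continuous Real.continuous_fourierChar
    (by exact continuous_inner) hf

theorem integral_fourier_mul_eq {f g : ℝ → ℂ} (hf : Integrable f) (hg : Integrable g) :
    ∫ ξ, 𝓕 f ξ * g ξ = ∫ x, f x * 𝓕 g x := by
  have h := VectorFourier.integral_fourierIntegral_smul_eq_flip (L := innerₗ ℝ)
    Real.continuous_fourierChar (by exact continuous_inner) hf hg
  rw [flip_innerₗ] at h
  exact h

/-- On integrable and square integrable functions, the Fourier transform on `L²` is given by the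
Fourier integral. -/
theorem coeFn_fourier_toLp {f : ℝ → ℂ} (hf : Integrable f) (hf2 : MemLp f 2) :
    ((𝓕 (hf2.toLp f) : Lp ℂ 2 (volume : Measure ℝ)) : ℝ → ℂ) =ᵐ[volume] 𝓕 f := by
  -- Both transforms are tested against smooth compactly supported functions. For the `L²` transform
  -- the Fourier operator moves onto the test function by its distributional description, for the
  -- integral by Fubini.
  refine ae_eq_of_integral_contDiff_smul_eq
    ((Lp.memLp _).locallyIntegrable (by norm_num))
    (continuous_fourier_of_integrable hf).locallyIntegrable fun g g_smooth g_cpt => ?_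
  have hg₁ : HasCompactSupport (Complex.ofRealCLM ∘ g) := g_cpt.comp_left rfl
  have hg₂ : ContDiff ℝ (⊤ : ℕ∞) (Complex.ofRealCLM ∘ g) := by fun_prop
  set G : 𝓢(ℝ, ℂ) := hg₁.toSchwartzMap hg₂ with hG
  have h1 := congrArg (fun T => T G) (Lp.fourier_toTemperedDistribution_eq (hf2.toLp f))
  simp only [TemperedDistribution.fourier_apply, Lp.toTemperedDistribution_apply,
    smul_eq_mul] at h1
  have h2 : ∫ x, (𝓕 G) x * (hf2.toLp f) x = ∫ x, 𝓕 (G : ℝ → ℂ) x * f x := by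
    refine integral_congr_ae ?_
    filter_upwards [hf2.coeFn_toLp] with x hx
    rw [hx, SchwartzMap.fourier_coe]
  rw [h2, integral_fourier_mul_eq G.integrable hf] at h1
  have h3 : ∀ x, G x = (g x : ℂ) := fun x => rfl
  simp only [h3] at h1
  simp only [Complex.real_smul]
  exact h1.symm

theorem memLp_fourier {f : ℝ → ℂ} (hf : Integrable f) (hf2 : MemLp f 2) : MemLp (𝓕 f) 2 :=
  (memLp_congr_ae (coeFn_fourier_toLp hf hf2)).1 (Lp.memLp _)

/-- Plancherel's formula for integrable and square integrable functions. -/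
theorem integral_conj_fourier_mul_fourier {f g : ℝ → ℂ} (hf : Integrable f) (hf2 : MemLp f 2)
    (hg : Integrable g) (hg2 : MemLp g 2) :
    ∫ ξ, star (𝓕 f ξ) * 𝓕 g ξ = ∫ x, star (f x) * g x := by
  have h := Lp.inner_fourier_eq (hf2.toLp f) (hg2.toLp g)
  rw [L2.inner_def, L2.inner_def] at h
  have h1 : ∫ ξ, star (𝓕 f ξ) * 𝓕 g ξ = ∫ ξ, inner ℂ ((𝓕 (hf2.toLp f) : Lp ℂ 2 (volume : Measure ℝ)) ξ)
      ((𝓕 (hg2.toLp g) : Lp ℂ 2 (volume : Measure ℝ)) ξ) := by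
    refine integral_congr_ae ?_
    filter_upwards [coeFn_fourier_toLp hf hf2, coeFn_fourier_toLp hg hg2] with ξ h1 h2
    rw [h1, h2, RCLike.inner_apply, mul_comm]
    rfl
  have h2 : ∫ x, star (f x) * g x = ∫ ξ, inner ℂ (hf2.toLp f ξ) (hg2.toLp g ξ) := by
    refine integral_congr_ae ?_
    filter_upwards [hf2.coeFn_toLp, hg2.coeFn_toLp] with ξ h1 h2
    rw [h1, h2, RCLike.inner_apply, mul_comm]
    rfl
  rw [h1, h2, h]

/-- The Fourier transform of a real vector valued signal. -/
noncomputable def spectrumOf {κ : Type*} (u : ℝ → κ → ℝ) (ξ : ℝ) : κ → ℂ :=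
  fun i => 𝓕 (fun t => (u t i : ℂ)) ξ

namespace IsDecaying

variable {κ ι : Type*} [Fintype κ] [Fintype ι] {u v : ℝ → κ → ℝ}

theorem integrable_ofReal_apply (hu : IsDecaying u) (i : κ) :
    Integrable fun t => (u t i : ℂ) := (hu.integrable_apply i).ofReal

theorem memLp_ofReal_apply (hu : IsDecaying u) (i : κ) :
    MemLp (fun t => (u t i : ℂ)) 2 := (hu.memLp_apply i).ofReal

theorem memLp_spectrumOf_apply (hu : IsDecaying u) (i : κ) :
    MemLp (fun ξ => spectrumOf u ξ i) 2 :=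
  memLp_fourier (hu.integrable_ofReal_apply i) (hu.memLp_ofReal_apply i)

theorem integral_conj_spectrumOf_mul {w : ℝ → ι → ℝ} (hu : IsDecaying u) (hw : IsDecaying w)
    (i : κ) (j : ι) :
    ∫ ξ, star (spectrumOf u ξ i) * spectrumOf w ξ j = ((∫ t, u t i * w t j : ℝ) : ℂ) := by
  have h := integral_conj_fourier_mul_fourier (hu.integrable_ofReal_apply i)
    (hu.memLp_ofReal_apply i) (hw.integrable_ofReal_apply j) (hw.memLp_ofReal_apply j)
  rw [← integral_complex_ofReal]
  simpa [spectrumOf] using h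

theorem integrable_conj_spectrumOf_mul {w : ℝ → ι → ℝ} (hu : IsDecaying u) (hw : IsDecaying w)
    (i : κ) (j : ι) :
    Integrable fun ξ => star (spectrumOf u ξ i) * spectrumOf w ξ j :=
  (hu.memLp_spectrumOf_apply i).star.integrable_mul (hw.memLp_spectrumOf_apply j)

theorem spectrumOf_add (hu : IsDecaying u) (hv : IsDecaying v) (ξ : ℝ) :
    spectrumOf (fun t => u t + v t) ξ = spectrumOf u ξ + spectrumOf v ξ := by
  ext i
  simp only [spectrumOf, Real.fourier_real_eq_integral_exp_smul, Pi.add_apply, smul_eq_mul]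
  rw [← integral_add]
  · simp [mul_add]
  · have := (Real.fourierIntegral_convergent_iff ξ).2 (hu.integrable_ofReal_apply i)
    simpa [Real.fourierChar_apply, Circle.smul_def, mul_assoc, mul_comm] using this
  · have := (Real.fourierIntegral_convergent_iff ξ).2 (hv.integrable_ofReal_apply i)
    simpa [Real.fourierChar_apply, Circle.smul_def, mul_assoc, mul_comm] using this

end IsDecaying

theorem spectrumOf_sumElim {κ ι : Type*} (u : ℝ → κ → ℝ) (w : ℝ → ι → ℝ) (ξ : ℝ) :
    spectrumOf (fun t => Sum.elim (u t) (w t)) ξ = Sum.elim (spectrumOf u ξ) (spectrumOf w ξ) := by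
  ext i
  rcases i with i | i <;> rfl

theorem IsDecaying.spectrumOf_mulVec {κ ι : Type*} [Fintype κ] [Fintype ι] {u : ℝ → κ → ℝ}
    (hu : IsDecaying u) (M : Matrix ι κ ℝ) (ξ : ℝ) :
    spectrumOf (fun t => M *ᵥ u t) ξ = M.map Complex.ofReal *ᵥ spectrumOf u ξ := by
  ext i
  simp only [spectrumOf, Matrix.mulVec, dotProduct, Matrix.map_apply,
    Real.fourier_real_eq_integral_exp_smul, smul_eq_mul, Complex.ofReal_sum, Complex.ofReal_mul,
    Finset.mul_sum]
  rw [integral_finsetSum]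
  · refine Finset.sum_congr rfl fun j _ => ?_
    rw [← integral_const_mul]
    refine integral_congr_ae (ae_of_all _ fun t => ?_)
    ring
  · intro j _
    have := ((Real.fourierIntegral_convergent_iff ξ).2 (hu.integrable_ofReal_apply j)).const_mul
      (M i j : ℂ)
    simp only [Real.fourierChar_apply, Circle.smul_def, smul_eq_mul] at this
    refine this.congr (ae_of_all _ fun t => ?_)
    simp
    ring_nf

/-- The transfer function of a linear system, in product form. -/
theorem IsDecaying.spectrumOf_stateResponse {n : ℕ} {A : Matrix (Fin n) (Fin n) ℝ}
    (hA : IsHurwitz A) {f : ℝ → Fin n → ℝ} (hf : IsDecaying f) (ξ : ℝ) :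
    ((2 * Real.pi * Complex.I * ξ : ℂ) • (1 : Matrix (Fin n) (Fin n) ℂ) -
      A.map Complex.ofReal) *ᵥ spectrumOf (MinimaxCT.stateResponse A 0 f) ξ = spectrumOf f ξ := by
  set x := MinimaxCT.stateResponse A 0 f with hx
  have hxd : IsDecaying x := hf.stateResponse hA
  have hAx := hxd.mulVec A
  -- The forcing is continuous and vanishes for `t ≤ 0`, so `x` is differentiable on the whole line,
  -- including at `0`, and no boundary term appears in the transform of `ẋ`.
  have hder : ∀ i t, HasDerivAt (fun t => (x t i : ℂ)) (((A *ᵥ x t + f t) i : ℝ) : ℂ) t :=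
    fun i t => ((hasDerivAt_pi.1 (hasDerivAt_stateResponse A 0 hf.continuous t)) i).ofReal_comp
  have hsum := hAx.add hf
  have h1 : spectrumOf (fun t => A *ᵥ x t + f t) ξ =
      (2 * Real.pi * Complex.I * ξ : ℂ) • spectrumOf x ξ := by
    ext i
    have hd : deriv (fun t => (x t i : ℂ)) = fun t => (((A *ᵥ x t + f t) i : ℝ) : ℂ) :=
      funext fun t => (hder i t).deriv
    have := Real.fourier_deriv (hxd.integrable_ofReal_apply i)
      (fun t => (hder i t).differentiableAt) (by rw [hd]; exact hsum.integrable_ofReal_apply i)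
    rw [hd] at this
    simpa [spectrumOf] using congrFun this ξ
  rw [hAx.spectrumOf_add hf, hxd.spectrumOf_mulVec] at h1
  rw [Matrix.sub_mulVec, Matrix.smul_mulVec, Matrix.one_mulVec, ← h1]
  abel

end Fourier

/-! ### The filter with symbol `1 / (1 + iω)`. -/

section Lowpass

variable {κ : Type*} [Fintype κ]

/-- Makes the filter a special case of `stateResponse`, so that its decay and its transfer function
are already available. -/
theorem isHurwitz_neg_one (m : ℕ) : IsHurwitz (-1 : Matrix (Fin m) (Fin m) ℝ) := by
  intro s hs
  have h : s • (1 : Matrix (Fin m) (Fin m) ℂ) - (-1 : Matrix (Fin m) (Fin m) ℝ).map Complex.ofReal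
      = (s + 1) • (1 : Matrix (Fin m) (Fin m) ℂ) := by
    ext i j
    by_cases hij : i = j
    · subst hij; simp
    · simp [hij]
  rw [h, Matrix.det_smul, Matrix.det_one, mul_one]
  refine pow_ne_zero _ fun h0 => ?_
  have := congrArg Complex.re h0
  simp at this
  linarith

/-- The causal filter `y ↦ ẏ + y = u`, with zero initial value. -/
noncomputable def lowpass (u : ℝ → κ → ℝ) (t : ℝ) : κ → ℝ := fun i =>
  stateResponse (-1 : Matrix (Fin (Fintype.card κ)) (Fin (Fintype.card κ)) ℝ) 0
    (fun t j => u t ((Fintype.equivFin κ).symm j)) t (Fintype.equivFin κ i)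

theorem IsDecaying.comp_equiv {ι : Type*} [Fintype ι] {u : ℝ → κ → ℝ} (hu : IsDecaying u)
    (e : ι ≃ κ) : IsDecaying fun t i => u t (e i) := by
  refine ⟨continuous_pi fun i => (continuous_apply _).comp hu.continuous, fun t ht => by
    rw [hu.eq_zero t ht]; rfl, ?_⟩
  obtain ⟨C, δ, hC, hδ, h⟩ := hu.decay
  refine ⟨C, δ, hC, hδ, fun t ht => ?_⟩
  exact (pi_norm_le_iff_of_nonneg (by positivity)).2 fun i => (norm_le_pi_norm _ _).trans (h t ht)

theorem IsDecaying.lowpass {u : ℝ → κ → ℝ} (hu : IsDecaying u) :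
    IsDecaying (MinimaxCT.lowpass u) :=
  ((hu.comp_equiv (Fintype.equivFin κ).symm).stateResponse (isHurwitz_neg_one _)).comp_equiv
    (Fintype.equivFin κ)

theorem hasDerivAt_lowpass {u : ℝ → κ → ℝ} (hu : IsDecaying u) (t : ℝ) (i : κ) :
    HasDerivAt (fun t => lowpass u t i) (u t i - lowpass u t i) t := by
  have h := hasDerivAt_pi.1 (hasDerivAt_stateResponse (-1) 0
    (hu.comp_equiv (Fintype.equivFin κ).symm).continuous t) (Fintype.equivFin κ i)
  have h' : HasDerivAt (fun t => lowpass u t i) _ t := h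
  refine h'.congr_deriv ?_
  simp only [Matrix.neg_mulVec, Matrix.one_mulVec, Pi.add_apply, Pi.neg_apply,
    Equiv.symm_apply_apply, lowpass]
  ring

theorem spectrumOf_lowpass {u : ℝ → κ → ℝ} (hu : IsDecaying u) (ξ : ℝ) (i : κ) :
    (1 + 2 * Real.pi * Complex.I * ξ : ℂ) * spectrumOf (lowpass u) ξ i = spectrumOf u ξ i := by
  have h := congrFun ((hu.comp_equiv (Fintype.equivFin κ).symm).spectrumOf_stateResponse
    (isHurwitz_neg_one _) ξ) (Fintype.equivFin κ i)
  have h1 : (-1 : Matrix (Fin (Fintype.card κ)) (Fin (Fintype.card κ)) ℝ).map Complex.ofReal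
      = -1 := by
    ext i j
    by_cases hij : i = j
    · subst hij; simp
    · simp [hij]
  rw [h1, sub_neg_eq_add, Matrix.add_mulVec, Matrix.smul_mulVec, Matrix.one_mulVec] at h
  have h2 : spectrumOf (fun t j => u t ((Fintype.equivFin κ).symm j)) ξ (Fintype.equivFin κ i) =
      spectrumOf u ξ i := by simp [spectrumOf]
  rw [h2] at h
  rw [← h]
  simp only [Pi.add_apply, Pi.smul_apply, smul_eq_mul]
  have h3 : spectrumOf (lowpass u) ξ i = spectrumOf (stateResponse
    (-1 : Matrix (Fin (Fintype.card κ)) (Fin (Fintype.card κ)) ℝ) 0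
    (fun t j => u t ((Fintype.equivFin κ).symm j))) ξ (Fintype.equivFin κ i) := rfl
  rw [h3]
  ring

end Lowpass

theorem sq_integral_mul_le {α : Type*} [MeasurableSpace α] {μ : Measure α} {f g : α → ℝ}
    (hf : MemLp f 2 μ) (hg : MemLp g 2 μ) :
    (∫ x, f x * g x ∂μ) ^ 2 ≤ (∫ x, f x ^ 2 ∂μ) * ∫ x, g x ^ 2 ∂μ := by
  have key : ∀ {f g : α → ℝ} (hf : MemLp f 2 μ) (hg : MemLp g 2 μ),
      inner ℝ (hf.toLp f) (hg.toLp g) = ∫ x, f x * g x ∂μ := by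
    intro f g hf hg
    rw [L2.inner_def]
    refine integral_congr_ae ?_
    filter_upwards [hf.coeFn_toLp, hg.coeFn_toLp] with x h1 h2
    rw [h1, h2, real_inner_eq_re_inner]
    simp [mul_comm]
  have h := real_inner_mul_inner_self_le (hf.toLp f) (hg.toLp g)
  simp only [key] at h
  simpa only [sq] using h

theorem continuous_exp_mulVec {n : ℕ} {A : Matrix (Fin n) (Fin n) ℝ} {κ : Type*}
    (K : Matrix κ (Fin n) ℝ) (a : Fin n → ℝ) :
    Continuous fun t : ℝ => K *ᵥ (NormedSpace.exp (t • A) *ᵥ a) :=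
  continuous_const.matrix_mulVec ((continuous_exp_smul_matrix A).matrix_mulVec continuous_const)

/-! ### Pairing of free responses with signals. -/

section Weights

variable {n : ℕ} (A : Matrix (Fin n) (Fin n) ℝ) {κ : Type*} [Fintype κ]

/-- The pairing of the signal `t ↦ K exp(tA) a` with `u` on `[0, ∞)`. -/
noncomputable def expPairing (K : Matrix κ (Fin n) ℝ) (a : Fin n → ℝ) (u : ℝ → κ → ℝ) : ℝ :=
  ∫ t in Ioi (0 : ℝ), (K *ᵥ (NormedSpace.exp (t • A) *ᵥ a)) ⬝ᵥ u t

variable {A}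

theorem IsHurwitz.exists_norm_mulVec_exp_mulVec_le (hA : IsHurwitz A) (K : Matrix κ (Fin n) ℝ)
    (a : Fin n → ℝ) : ∃ C δ : ℝ, 0 ≤ C ∧ 0 < δ ∧ ∀ t : ℝ, 0 ≤ t →
      ‖K *ᵥ (NormedSpace.exp (t • A) *ᵥ a)‖ ≤ C * Real.exp (-δ * t) := by
  obtain ⟨C, δ, hC, hδ, h⟩ := hA.exists_norm_exp_mulVec_le
  obtain ⟨K', hK0, hK⟩ := exists_norm_mulVec_le K
  refine ⟨K' * C * ‖a‖, δ, by positivity, hδ, fun t ht => (hK _).trans ?_⟩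
  calc _ ≤ K' * (C * Real.exp (-δ * t) * ‖a‖) := by gcongr; exact h t ht a
    _ = _ := by ring

theorem integrableOn_expPairing (hA : IsHurwitz A) (K : Matrix κ (Fin n) ℝ) (a : Fin n → ℝ)
    {u : ℝ → κ → ℝ} (hu : IsDecaying u) :
    IntegrableOn (fun t => (K *ᵥ (NormedSpace.exp (t • A) *ᵥ a)) ⬝ᵥ u t) (Ioi 0) := by
  obtain ⟨C, δ, hC, hδ, h⟩ := hA.exists_norm_mulVec_exp_mulVec_le K a
  simp only [dotProduct]
  refine integrable_finsetSum _ fun i _ => ?_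
  refine (hu.integrable_apply i).integrableOn.bdd_mul (c := C)
    ((continuous_apply i).comp (continuous_exp_mulVec K a)).aestronglyMeasurable ?_
  filter_upwards [ae_restrict_mem measurableSet_Ioi] with t ht
  have ht0 : (0 : ℝ) < t := ht
  refine (norm_le_pi_norm _ i).trans ((h t ht0.le).trans ?_)
  have : Real.exp (-δ * t) ≤ 1 := Real.exp_le_one_iff.2 (by nlinarith)
  nlinarith

theorem expPairing_add_left (hA : IsHurwitz A) (K : Matrix κ (Fin n) ℝ) (a b : Fin n → ℝ)
    {u : ℝ → κ → ℝ} (hu : IsDecaying u) :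
    expPairing A K (a + b) u = expPairing A K a u + expPairing A K b u := by
  rw [expPairing, expPairing, expPairing, ← integral_add (integrableOn_expPairing hA K a hu)
    (integrableOn_expPairing hA K b hu)]
  simp only [Matrix.mulVec_add, add_dotProduct]

theorem expPairing_smul_left (K : Matrix κ (Fin n) ℝ) (c : ℝ) (a : Fin n → ℝ)
    (u : ℝ → κ → ℝ) :
    expPairing A K (c • a) u = c * expPairing A K a u := by
  rw [expPairing, expPairing, ← integral_const_mul]
  simp only [Matrix.mulVec_smul, smul_dotProduct, smul_eq_mul]

theorem expPairing_add_right (hA : IsHurwitz A) (K : Matrix κ (Fin n) ℝ) (a : Fin n → ℝ)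
    {u v : ℝ → κ → ℝ} (hu : IsDecaying u) (hv : IsDecaying v) :
    expPairing A K a (fun t => u t + v t) = expPairing A K a u + expPairing A K a v := by
  rw [expPairing, expPairing, expPairing, ← integral_add (integrableOn_expPairing hA K a hu)
    (integrableOn_expPairing hA K a hv)]
  simp only [dotProduct_add]

theorem expPairing_smul_right (K : Matrix κ (Fin n) ℝ) (c : ℝ) (a : Fin n → ℝ)
    (u : ℝ → κ → ℝ) :
    expPairing A K a (fun t => c • u t) = c * expPairing A K a u := by
  rw [expPairing, expPairing, ← integral_const_mul]
  simp only [dotProduct_smul, smul_eq_mul]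

/-- Integration by parts: for `y = lowpass u`, differentiate `⟨K exp(tA) a, y⟩` and insert `ẏ = u -
y`; the boundary terms vanish at `0` and at infinity. Thus a filter on the signal is traded for the
factor `1 - A` on the initial state. -/
theorem expPairing_lowpass (hA : IsHurwitz A) (K : Matrix κ (Fin n) ℝ) (a : Fin n → ℝ)
    {u : ℝ → κ → ℝ} (hu : IsDecaying u) :
    expPairing A K (a - A *ᵥ a) (lowpass u) = expPairing A K a u := by
  have hy := hu.lowpass
  set G : (Fin n → ℝ) → ℝ → κ → ℝ := fun b t => K *ᵥ (NormedSpace.exp (t • A) *ᵥ b) with hG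
  have hGd : ∀ t i, HasDerivAt (fun t => G a t i) (G (A *ᵥ a) t i) t := by
    intro t i
    have h := hasDerivAt_pi.1 (hasDerivAt_stateResponse A a (f := 0) continuous_const t)
    simp only [funext (stateResponse_zero_right A a), Pi.zero_apply, add_zero] at h
    have h1 : G (A *ᵥ a) t = K *ᵥ (A *ᵥ (NormedSpace.exp (t • A) *ᵥ a)) := by
      simp only [hG]
      rw [Matrix.mulVec_mulVec a A, (commute_exp_smul A t).eq, ← Matrix.mulVec_mulVec]
    rw [h1]
    exact HasDerivAt.fun_sum (u := Finset.univ) fun j _ => (h j).const_mul (K i j)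
  have hprod : ∀ t, HasDerivAt (fun t => G a t ⬝ᵥ lowpass u t)
      (G (A *ᵥ a) t ⬝ᵥ lowpass u t + G a t ⬝ᵥ (u t - lowpass u t)) t := by
    intro t
    simp only [dotProduct, ← Finset.sum_add_distrib]
    exact HasDerivAt.fun_sum fun i _ => (hGd t i).mul (hasDerivAt_lowpass hu t i)
  have hi1 := integrableOn_expPairing hA K (A *ᵥ a) hy
  have hi2 := integrableOn_expPairing hA K a hy
  have hi3 := integrableOn_expPairing hA K a hu
  have hsplit : ∀ t, G a t ⬝ᵥ (u t - lowpass u t) = G a t ⬝ᵥ u t - G a t ⬝ᵥ lowpass u t :=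
    fun t => dotProduct_sub _ _ _
  -- An integrable function with integrable derivative tends to zero.
  have hlim : Tendsto (fun t => G a t ⬝ᵥ lowpass u t) atTop (𝓝 0) :=
    tendsto_zero_of_hasDerivAt_of_integrableOn_Ioi (a := 0) (fun t _ => hprod t)
      (by simp only [hsplit]; exact hi1.add (hi3.sub hi2)) hi2
  have h := integral_Ioi_of_hasDerivAt_of_tendsto' (a := 0) (fun t _ => hprod t)
    (by simp only [hsplit]; exact hi1.add (hi3.sub hi2)) hlim
  simp only [hsplit] at h
  have e1 : ∫ t in Ioi 0, (G (A *ᵥ a) t ⬝ᵥ lowpass u t +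
      (G a t ⬝ᵥ u t - G a t ⬝ᵥ lowpass u t)) = _ := integral_add hi1 (hi3.sub hi2)
  have e2 := integral_sub hi3 hi2
  rw [e1.trans (congrArg _ e2), hy.eq_zero 0 le_rfl,
    dotProduct_zero, sub_zero] at h
  have h2 : expPairing A K (a - A *ᵥ a) (lowpass u) =
      expPairing A K a (lowpass u) - expPairing A K (A *ᵥ a) (lowpass u) := by
    rw [sub_eq_add_neg, expPairing_add_left hA K _ _ hy, ← neg_one_smul ℝ (A *ᵥ a),
      expPairing_smul_left]
    ring
  rw [h2]
  simp only [expPairing]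
  simp only [hG] at h
  linarith

end Weights

/-! ### Frequency weights that control the effect of the initial state. -/

section AdmissibleWeights

variable {n : ℕ} (A : Matrix (Fin n) (Fin n) ℝ) (κ : Type*) [Fintype κ]

/-- A weight `w` on the frequency axis is admissible for `A` if every functional
`u ↦ ∫ ⟨K exp(tA) a, u⟩` is bounded by the weighted energy of the spectrum of `u`. -/
def IsAdmissibleWeight (w : ℝ → ℝ) : Prop :=
  ∀ (K : Matrix κ (Fin n) ℝ) (a : Fin n → ℝ), ∃ C : ℝ, 0 ≤ C ∧ ∀ u : ℝ → κ → ℝ, IsDecaying u →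
    ENNReal.ofReal (expPairing A K a u ^ 2) ≤ ENNReal.ofReal C *
      ∫⁻ ξ : ℝ, ENNReal.ofReal (w (2 * Real.pi * ξ) * ∑ i, ‖spectrumOf u ξ i‖ ^ 2)

variable {A κ}

theorem IsAdmissibleWeight.mono {w w' : ℝ → ℝ} (hw : IsAdmissibleWeight A κ w) {c : ℝ}
    (hc : 0 ≤ c) (h : ∀ ω, w ω ≤ c * w' ω) : IsAdmissibleWeight A κ w' := by
  intro K a
  obtain ⟨C, hC, hC'⟩ := hw K a
  refine ⟨C * c, by positivity, fun u hu => (hC' u hu).trans ?_⟩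
  rw [ENNReal.ofReal_mul hC, mul_assoc]
  refine mul_le_mul' le_rfl ?_
  rw [← lintegral_const_mul' _ _ ENNReal.ofReal_ne_top]
  refine lintegral_mono fun ξ => ?_
  rw [← ENNReal.ofReal_mul hc, ← mul_assoc]
  refine ENNReal.ofReal_le_ofReal ?_
  gcongr
  exact h _

theorem IsDecaying.lintegral_spectrumOf {u : ℝ → κ → ℝ} (hu : IsDecaying u) :
    ∫⁻ ξ : ℝ, ENNReal.ofReal (∑ i, ‖spectrumOf u ξ i‖ ^ 2) =
      ENNReal.ofReal (∑ i, ∫ t, u t i ^ 2) := by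
  have hi : ∀ i, Integrable fun ξ => ‖spectrumOf u ξ i‖ ^ 2 := fun i =>
    (hu.memLp_spectrumOf_apply i).integrable_norm_pow (by norm_num)
  rw [← ofReal_integral_eq_lintegral_ofReal (integrable_finsetSum _ fun i _ => hi i)
    (ae_of_all _ fun ξ => by positivity), integral_finsetSum _ fun i _ => hi i]
  congr 1
  refine Finset.sum_congr rfl fun i _ => ?_
  have h := hu.integral_conj_spectrumOf_mul hu i i
  have h2 : ∀ ξ, star (spectrumOf u ξ i) * spectrumOf u ξ i =
      ((‖spectrumOf u ξ i‖ ^ 2 : ℝ) : ℂ) := by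
    intro ξ
    rw [Complex.star_def, mul_comm, Complex.mul_conj, Complex.normSq_eq_norm_sq]
  simp only [h2] at h
  rw [integral_complex_ofReal] at h
  simpa only [sq] using Complex.ofReal_injective h

/-- Cauchy–Schwarz in time, since `K exp(tA) a` is square integrable on `[0, ∞)`, followed by
Plancherel. -/
theorem isAdmissibleWeight_one (hA : IsHurwitz A) : IsAdmissibleWeight A κ 1 := by
  intro K a
  obtain ⟨C, δ, hC, hδ, h⟩ := hA.exists_norm_mulVec_exp_mulVec_le K a
  set G : ℝ → κ → ℝ := fun t => K *ᵥ (NormedSpace.exp (t • A) *ᵥ a) with hG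
  have hGm : ∀ i, MemLp (fun t => G t i) 2 (volume.restrict (Ioi 0)) := by
    intro i
    have hm : AEStronglyMeasurable (fun t => G t i) (volume.restrict (Ioi 0)) :=
      ((continuous_apply i).comp (continuous_exp_mulVec K a)).aestronglyMeasurable
    rw [memLp_two_iff_integrable_sq hm]
    refine Integrable.mono' ((integrableOn_exp_neg_mul (δ := 2 * δ) (by positivity)).const_mul
      (C ^ 2)) (((continuous_apply i).comp
        (continuous_exp_mulVec K a)).pow 2).aestronglyMeasurable ?_
    filter_upwards [ae_restrict_mem measurableSet_Ioi] with t ht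
    have ht0 : (0 : ℝ) < t := ht
    have h1 : |G t i| ≤ C * Real.exp (-δ * t) := (norm_le_pi_norm _ i).trans (h t ht0.le)
    have h2 : Real.exp (-(2 * δ) * t) = Real.exp (-δ * t) ^ 2 := by
      rw [← Real.exp_nat_mul]; congr 1; push_cast; ring
    rw [h2, ← mul_pow, Real.norm_eq_abs, abs_pow]
    exact pow_le_pow_left₀ (abs_nonneg _) h1 2
  set B : ℝ := ∑ i, ∫ t in Ioi (0 : ℝ), G t i ^ 2 with hB
  have hB0 : 0 ≤ B := Finset.sum_nonneg fun i _ => integral_nonneg fun t => sq_nonneg _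
  refine ⟨Fintype.card κ * B, by positivity, fun u hu => ?_⟩
  simp only [Pi.one_apply, one_mul]
  rw [hu.lintegral_spectrumOf, ← ENNReal.ofReal_mul (by positivity)]
  refine ENNReal.ofReal_le_ofReal ?_
  have hum : ∀ i, MemLp (fun t => u t i) 2 (volume.restrict (Ioi 0)) :=
    fun i => (hu.memLp_apply i).restrict _
  have h1 : expPairing A K a u = ∑ i, ∫ t in Ioi (0 : ℝ), G t i * u t i := by
    rw [expPairing]
    simp only [dotProduct]
    exact integral_finsetSum _ fun i _ => (hGm i).integrable_mul (hum i)
  have h2 : ∀ i, ∫ t in Ioi (0 : ℝ), u t i ^ 2 ≤ ∫ t, u t i ^ 2 := fun i =>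
    setIntegral_le_integral ((hu.memLp_apply i).integrable_sq) (ae_of_all _ fun t => sq_nonneg _)
  calc expPairing A K a u ^ 2
      ≤ Fintype.card κ * ∑ i, (∫ t in Ioi (0 : ℝ), G t i * u t i) ^ 2 := by
        rw [h1]; exact sq_sum_le_card_mul_sum_sq
    _ ≤ Fintype.card κ * ∑ i, B * ∫ t, u t i ^ 2 := by
        gcongr with i _
        refine (sq_integral_mul_le (hGm i) (hum i)).trans ?_
        refine mul_le_mul ?_ (h2 i) (integral_nonneg fun t => sq_nonneg _) hB0
        exact Finset.single_le_sum (f := fun i => ∫ t in Ioi (0 : ℝ), G t i ^ 2)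
          (fun i _ => integral_nonneg fun t => sq_nonneg _) (Finset.mem_univ i)
    _ = _ := by rw [← Finset.mul_sum, mul_assoc]

theorem normSq_one_add_I_mul (ω : ℝ) : ‖(1 + Complex.I * ω : ℂ)‖ ^ 2 = 1 + ω ^ 2 := by
  rw [← Complex.normSq_eq_norm_sq, Complex.normSq_apply]
  simp
  ring

theorem one_add_I_mul_ne_zero (ω : ℝ) : (1 + Complex.I * ω : ℂ) ≠ 0 := by
  intro h
  have := normSq_one_add_I_mul ω
  rw [h] at this
  simp at this
  nlinarith [sq_nonneg ω]

theorem IsDecaying.spectrumOf_lowpass_apply {u : ℝ → κ → ℝ} (hu : IsDecaying u) (ξ : ℝ) (i : κ) :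
    spectrumOf (MinimaxCT.lowpass u) ξ i =
      (1 + Complex.I * (2 * Real.pi * ξ : ℝ))⁻¹ * spectrumOf u ξ i := by
  rw [← MinimaxCT.spectrumOf_lowpass hu ξ i, ← mul_assoc]
  have : (1 + 2 * Real.pi * Complex.I * ξ : ℂ) = 1 + Complex.I * (2 * Real.pi * ξ : ℝ) := by
    push_cast; ring
  rw [this, inv_mul_cancel₀ (one_add_I_mul_ne_zero _), one_mul]

/-- Over `ℂ` the matrix factors as `(iθ - A)(-iθ - A)`, and both `±iθ` lie on the imaginary axis. -/
theorem IsHurwitz.det_sq_add_ne_zero (hA : IsHurwitz A) (θ : ℝ) :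
    (A * A + (θ ^ 2) • (1 : Matrix (Fin n) (Fin n) ℝ)).det ≠ 0 := by
  intro h
  have h1 := hA (Complex.I * θ) (by simp)
  have h2 := hA (-(Complex.I * θ)) (by simp)
  set A' := A.map Complex.ofReal with hA'
  have h3 : (Complex.ofRealHom.mapMatrix) (A * A + (θ ^ 2) • (1 : Matrix (Fin n) (Fin n) ℝ)) =
      ((Complex.I * θ : ℂ) • (1 : Matrix (Fin n) (Fin n) ℂ) - A') *
      ((-(Complex.I * θ) : ℂ) • (1 : Matrix (Fin n) (Fin n) ℂ) - A') := by
    have e1 : (Complex.ofRealHom.mapMatrix) A = A' := rfl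
    have e2 : (Complex.ofRealHom.mapMatrix) ((θ ^ 2) • (1 : Matrix (Fin n) (Fin n) ℝ)) =
        ((θ : ℂ) ^ 2) • (1 : Matrix (Fin n) (Fin n) ℂ) := by
      ext i j
      by_cases hij : i = j
      · subst hij; simp
      · simp [hij]
    rw [map_add, map_mul, e1, e2]
    simp only [sub_mul, mul_sub, smul_mul_assoc, mul_smul_comm, one_mul, mul_one, smul_sub, smul_smul]
    have e3 : -(Complex.I * (θ : ℂ)) * (Complex.I * θ) = θ ^ 2 := by
      linear_combination (-(θ : ℂ) ^ 2) * Complex.I_sq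
    rw [e3, neg_smul]
    abel
  have h4 := congrArg Matrix.det h3
  rw [← RingHom.map_det, h, map_zero, Matrix.det_mul] at h4
  exact mul_ne_zero h1 h2 h4.symm

theorem exists_mulVec_eq {M : Matrix (Fin n) (Fin n) ℝ} (hM : M.det ≠ 0) (a : Fin n → ℝ) :
    ∃ b, M *ᵥ b = a :=
  ⟨M⁻¹ *ᵥ a, by rw [Matrix.mulVec_mulVec, Matrix.mul_nonsing_inv _ (isUnit_iff_ne_zero.2 hM),
    Matrix.one_mulVec]⟩

/-- Test `w` on `lowpass u`, whose spectrum carries the factor `(1 + iω)⁻¹`, with initial state `a -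
A a`; by `expPairing_lowpass` the pairing is the one of `a` with `u`. -/
theorem IsAdmissibleWeight.div_one_add_sq {w : ℝ → ℝ} (hA : IsHurwitz A)
    (hw : IsAdmissibleWeight A κ w) : IsAdmissibleWeight A κ fun ω => w ω / (1 + ω ^ 2) := by
  intro K a
  obtain ⟨C, hC, h⟩ := hw K (a - A *ᵥ a)
  refine ⟨C, hC, fun u hu => ?_⟩
  have h1 := h _ hu.lowpass
  rw [expPairing_lowpass hA K a hu] at h1
  refine h1.trans_eq ?_
  congr 2 with ξ
  congr 1
  simp only [hu.spectrumOf_lowpass_apply, norm_mul, mul_pow, norm_inv, inv_pow,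
    normSq_one_add_I_mul]
  rw [← Finset.mul_sum]
  ring

/-- Test `w` on `u` passed through a filter that blocks the frequencies `±θ`. Transposed onto the
initial state, with `c₂ = (1 - A)² c`, the filter produces `(A² + θ²) c`; as `A² + θ²` is
invertible, `c` can be chosen to make this `a`. -/
theorem IsAdmissibleWeight.mul_sq_sub_sq {w : ℝ → ℝ} (hA : IsHurwitz A)
    (hw : IsAdmissibleWeight A κ w) (θ : ℝ) :
    IsAdmissibleWeight A κ fun ω => w ω * ((θ ^ 2 - ω ^ 2) ^ 2 / (1 + ω ^ 2) ^ 2) := by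
  intro K a
  obtain ⟨c, hc⟩ := exists_mulVec_eq (hA.det_sq_add_ne_zero θ) a
  set c₁ := c - A *ᵥ c with hc₁
  set c₂ := c₁ - A *ᵥ c₁ with hc₂
  obtain ⟨C, hC, h⟩ := hw K c₂
  refine ⟨C, hC, fun u hu => ?_⟩
  have hy := hu.lowpass
  have hz := hy.lowpass
  -- The coefficients come from `1 - 2 / (1 + iω) + (1 + θ²) / (1 + iω)² = (θ² - ω²) / (1 + iω)²`.
  have hyz := (hy.smul (-2)).add (hz.smul (1 + θ ^ 2))
  have hv := hu.add hyz
  have h1 := h _ hv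
  have hpair : expPairing A K c₂ (fun t => u t + ((-2 : ℝ) • lowpass u t +
      (1 + θ ^ 2) • lowpass (lowpass u) t)) = expPairing A K a u := by
    rw [expPairing_add_right hA K _ hu hyz, expPairing_add_right hA K _ (hy.smul _) (hz.smul _),
      expPairing_smul_right, expPairing_smul_right, hc₂, expPairing_lowpass hA K c₁ hy,
      expPairing_lowpass hA K c₁ hu, hc₁, expPairing_lowpass hA K c hu,
      ← expPairing_smul_left K (-2), ← expPairing_smul_left K (1 + θ ^ 2),
      ← expPairing_add_left hA K _ _ hu, ← expPairing_add_left hA K _ _ hu]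
    congr 1
    rw [← hc, Matrix.add_mulVec, Matrix.smul_mulVec, Matrix.one_mulVec, ← Matrix.mulVec_mulVec,
      Matrix.mulVec_sub]
    module
  rw [hpair] at h1
  refine h1.trans_eq ?_
  congr 2 with ξ
  congr 1
  set ω := 2 * Real.pi * ξ with hω
  have hne := one_add_I_mul_ne_zero ω
  have hspec : ∀ i, spectrumOf (fun t => u t + ((-2 : ℝ) • lowpass u t +
      (1 + θ ^ 2) • lowpass (lowpass u) t)) ξ i =
      ((θ ^ 2 - ω ^ 2 : ℝ) : ℂ) * (((1 + Complex.I * ω)⁻¹) ^ 2 * spectrumOf u ξ i) := by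
    intro i
    have hsm : ∀ {v : ℝ → κ → ℝ} (_ : IsDecaying v) (r : ℝ),
        spectrumOf (fun t => r • v t) ξ i = r * spectrumOf v ξ i := by
      classical
      intro v hv r
      have := congrFun (hv.spectrumOf_mulVec (r • (1 : Matrix κ κ ℝ)) ξ) i
      have e : (r • (1 : Matrix κ κ ℝ)).map Complex.ofReal = (r : ℂ) • (1 : Matrix κ κ ℂ) := by
        ext i j
        by_cases hij : i = j
        · subst hij; simp
        · simp [hij]
      rw [e] at this
      simpa [Matrix.smul_mulVec] using this
    rw [hu.spectrumOf_add hyz, (hy.smul (-2)).spectrumOf_add (hz.smul (1 + θ ^ 2))]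
    simp only [Pi.add_apply]
    rw [hsm hy, hsm hz, hy.spectrumOf_lowpass_apply, hu.spectrumOf_lowpass_apply, ← hω]
    field_simp
    push_cast
    ring_nf
    rw [Complex.I_sq]
    ring
  simp only [hspec, norm_mul, mul_pow, norm_pow, norm_inv, Complex.norm_real, Real.norm_eq_abs,
    sq_abs]
  rw [← Finset.mul_sum, ← Finset.mul_sum]
  have e4 : (‖(1 + Complex.I * ω : ℂ)‖⁻¹ ^ 2) ^ 2 = ((1 + ω ^ 2) ^ 2)⁻¹ := by
    rw [inv_pow, normSq_one_add_I_mul, inv_pow]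
  rw [e4]
  ring

/-- For real `r` the factor dominates the one of `mul_sq_sub_sq` with `θ = r`, up to a constant: the
extra zero at `-r` is compensated by the denominator. For nonreal `r` the factor is at least `(Im
r)² > 0`, so nothing is lost. -/
theorem IsAdmissibleWeight.mul_normSq_sub {w : ℝ → ℝ} (hA : IsHurwitz A) (hw0 : ∀ ω, 0 ≤ w ω)
    (hw : IsAdmissibleWeight A κ w) (r : ℂ) :
    IsAdmissibleWeight A κ fun ω => w ω * ‖(ω : ℂ) - r‖ ^ 2 := by
  have hns : ∀ ω : ℝ, ‖(ω : ℂ) - r‖ ^ 2 = (ω - r.re) ^ 2 + r.im ^ 2 := by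
    intro ω
    rw [← Complex.normSq_eq_norm_sq, Complex.normSq_apply]
    simp
    ring
  by_cases hr : r.im = 0
  · refine (hw.mul_sq_sub_sq hA r.re).mono (c := 2 * (1 + r.re ^ 2)) (by positivity) fun ω => ?_
    rw [hns, hr]
    have h1 : (r.re ^ 2 - ω ^ 2) ^ 2 / (1 + ω ^ 2) ^ 2 ≤ 2 * (1 + r.re ^ 2) * (ω - r.re) ^ 2 := by
      rw [div_le_iff₀ (by positivity)]
      have h2 : (ω + r.re) ^ 2 ≤ 2 * (1 + r.re ^ 2) * (1 + ω ^ 2) ^ 2 := by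
        nlinarith [sq_nonneg (ω - r.re), sq_nonneg (r.re * ω), sq_nonneg ω, sq_nonneg r.re,
          mul_nonneg (sq_nonneg r.re) (sq_nonneg (ω ^ 2)), sq_nonneg (ω ^ 2)]
      have h3 := mul_le_mul_of_nonneg_left h2 (sq_nonneg (ω - r.re))
      nlinarith
    have := mul_le_mul_of_nonneg_left h1 (hw0 ω)
    nlinarith
  · have hr2 : 0 < r.im ^ 2 := by positivity
    refine hw.mono (c := (r.im ^ 2)⁻¹) (by positivity) fun ω => ?_
    rw [hns]
    have h1 : 1 ≤ (r.im ^ 2)⁻¹ * ((ω - r.re) ^ 2 + r.im ^ 2) := by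
      rw [mul_add, inv_mul_cancel₀ hr2.ne']
      have : 0 ≤ (r.im ^ 2)⁻¹ * (ω - r.re) ^ 2 := by positivity
      linarith
    have := mul_le_mul_of_nonneg_left h1 (hw0 ω)
    nlinarith

/-- Squared moduli of nonzero rational functions without poles at `ω = ± i` only are admissible. -/
theorem isAdmissibleWeight_polynomial (hA : IsHurwitz A) {D : Polynomial ℂ} (hD : D ≠ 0) (N : ℕ) :
    IsAdmissibleWeight A κ fun ω => ‖D.eval (ω : ℂ)‖ ^ 2 / (1 + ω ^ 2) ^ N := by
  -- Denominators are produced by filtering, numerators by splitting off one root at a time.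
  induction N with
  | succ N ih =>
    refine (ih.div_one_add_sq hA).mono (c := 1) zero_le_one fun ω => ?_
    rw [one_mul, div_div, ← pow_succ]
  | zero =>
    -- Without a denominator the weighted energy may be infinite; the extended integral in
    -- `IsAdmissibleWeight` allows for this.
    simp only [pow_zero, div_one]
    induction h : D.natDegree generalizing D with
    | zero =>
      rw [Polynomial.eq_C_of_natDegree_eq_zero h] at hD ⊢
      have h0 : D.coeff 0 ≠ 0 := by simpa using hD
      refine (isAdmissibleWeight_one hA).mono (c := (‖D.coeff 0‖ ^ 2)⁻¹) (by positivity)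
        fun ω => ?_
      have : ‖D.coeff 0‖ ^ 2 ≠ 0 := by simpa using h0
      simp [this]
    | succ d ih =>
      obtain ⟨r, hr⟩ := IsAlgClosed.exists_root D (by
        rw [Polynomial.degree_eq_natDegree hD, h]; exact_mod_cast Nat.succ_ne_zero d)
      obtain ⟨E, rfl⟩ := Polynomial.dvd_iff_isRoot.2 hr
      have hE : E ≠ 0 := right_ne_zero_of_mul hD
      have hdeg : E.natDegree = d := by
        rw [Polynomial.natDegree_mul (left_ne_zero_of_mul hD) hE,
          Polynomial.natDegree_X_sub_C] at h
        omega
      refine ((ih hE hdeg).mul_normSq_sub hA (fun ω => by positivity) r).mono (c := 1)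
        zero_le_one fun ω => ?_
      simp only [Polynomial.eval_mul, Polynomial.eval_sub, Polynomial.eval_X, Polynomial.eval_C,
        norm_mul, mul_pow]
      rw [one_mul, mul_comm]

end AdmissibleWeights

end MinimaxCT

namespace MinimaxCT

open Matrix Filter Topology Set Polynomial

/-! ### Polynomial matrix families and a lower bound by the determinant. -/

section PolynomialGrowth

/-- Upper bound by a power of `1 + ω²`. -/
def HasPolyGrowth (f : ℝ → ℝ) : Prop :=
  ∃ (C : ℝ) (N : ℕ), 0 ≤ C ∧ ∀ ω, f ω ≤ C * (1 + ω ^ 2) ^ N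

theorem HasPolyGrowth.add {f g : ℝ → ℝ} (hf : HasPolyGrowth f) (hg : HasPolyGrowth g) :
    HasPolyGrowth fun ω => f ω + g ω := by
  obtain ⟨C, N, hC, hf⟩ := hf
  obtain ⟨C', N', hC', hg⟩ := hg
  refine ⟨C + C', N + N', by positivity, fun ω => ?_⟩
  have h1 : 1 ≤ 1 + ω ^ 2 := by nlinarith [sq_nonneg ω]
  calc f ω + g ω ≤ C * (1 + ω ^ 2) ^ N + C' * (1 + ω ^ 2) ^ N' := add_le_add (hf ω) (hg ω)
    _ ≤ C * (1 + ω ^ 2) ^ (N + N') + C' * (1 + ω ^ 2) ^ (N + N') := by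
        gcongr <;> first | exact h1 | omega
    _ = _ := by ring

theorem HasPolyGrowth.mono {f g : ℝ → ℝ} (hg : HasPolyGrowth g) (h : ∀ ω, f ω ≤ g ω) :
    HasPolyGrowth f := by
  obtain ⟨C, N, hC, hg⟩ := hg
  exact ⟨C, N, hC, fun ω => (h ω).trans (hg ω)⟩

theorem HasPolyGrowth.const_mul {f : ℝ → ℝ} (hf : HasPolyGrowth f) {c : ℝ} (hc : 0 ≤ c) :
    HasPolyGrowth fun ω => c * f ω := by
  obtain ⟨C, N, hC, hf⟩ := hf
  refine ⟨c * C, N, by positivity, fun ω => ?_⟩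
  rw [mul_assoc]
  exact mul_le_mul_of_nonneg_left (hf ω) hc

theorem hasPolyGrowth_sum {ι : Type*} (s : Finset ι) {f : ι → ℝ → ℝ}
    (hf : ∀ i, HasPolyGrowth (f i)) : HasPolyGrowth fun ω => ∑ i ∈ s, f i ω := by
  classical
  induction s using Finset.induction_on with
  | empty => exact ⟨0, 0, le_rfl, by simp⟩
  | insert i s hi ih => simpa only [Finset.sum_insert hi] using (hf i).add ih

theorem hasPolyGrowth_normSq_eval (p : ℂ[X]) :
    HasPolyGrowth fun ω => ‖p.eval (ω : ℂ)‖ ^ 2 := by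
  induction p using Polynomial.induction_on' with
  | add p q hp hq =>
    refine ((hp.add hq).const_mul zero_le_two).mono fun ω => ?_
    rw [Polynomial.eval_add]
    have h1 := norm_add_le (p.eval (ω : ℂ)) (q.eval (ω : ℂ))
    have h2 := pow_le_pow_left₀ (norm_nonneg _) h1 2
    nlinarith [sq_nonneg (‖p.eval (ω : ℂ)‖ - ‖q.eval (ω : ℂ)‖)]
  | monomial k c =>
    refine ⟨‖c‖ ^ 2, k, by positivity, fun ω => ?_⟩
    simp only [Polynomial.eval_monomial, norm_mul, norm_pow, Complex.norm_real, mul_pow,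
      Real.norm_eq_abs]
    gcongr
    rw [← pow_mul, mul_comm k 2, pow_mul, sq_abs]
    gcongr
    linarith

variable {ι κ : Type*}

theorem norm_star_dotProduct_sq_le [Fintype κ] (a b : κ → ℂ) :
    ‖star a ⬝ᵥ b‖ ^ 2 ≤ (∑ i, ‖a i‖ ^ 2) * ∑ i, ‖b i‖ ^ 2 := by
  have h1 : ‖star a ⬝ᵥ b‖ ≤ ∑ i, ‖a i‖ * ‖b i‖ := by
    refine (norm_sum_le _ _).trans (Finset.sum_le_sum fun i _ => ?_)
    rw [norm_mul, Pi.star_apply, norm_star]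
  exact (pow_le_pow_left₀ (norm_nonneg _) h1 2).trans (Finset.sum_mul_sq_le_sq_mul_sq _ _ _)

theorem sum_norm_mulVec_sq_le [Fintype ι] [Fintype κ] (M : Matrix ι κ ℂ) (z : κ → ℂ) :
    ∑ i, ‖(M *ᵥ z) i‖ ^ 2 ≤ (∑ i, ∑ j, ‖M i j‖ ^ 2) * ∑ j, ‖z j‖ ^ 2 := by
  rw [Finset.sum_mul]
  refine Finset.sum_le_sum fun i _ => ?_
  have h := norm_star_dotProduct_sq_le (star (M i)) z
  simpa [Matrix.mulVec] using h

theorem star_dotProduct_self [Fintype κ] (z : κ → ℂ) : star z ⬝ᵥ z = ((∑ i, ‖z i‖ ^ 2 : ℝ) : ℂ) := by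
  simp only [dotProduct, Pi.star_apply, Complex.ofReal_sum]
  refine Finset.sum_congr rfl fun i _ => ?_
  rw [Complex.star_def, mul_comm, Complex.mul_conj, Complex.normSq_eq_norm_sq]

/-- Matrix valued polynomial functions of a real variable. -/
def IsPolyMatrix (M : ℝ → Matrix ι κ ℂ) : Prop :=
  ∃ P : Matrix ι κ ℂ[X], ∀ ω : ℝ, M ω = P.map (Polynomial.eval (ω : ℂ))

theorem IsPolyMatrix.mul [Fintype κ] {l : Type*} {M : ℝ → Matrix ι κ ℂ} {M' : ℝ → Matrix κ l ℂ}
    (h : IsPolyMatrix M) (h' : IsPolyMatrix M') : IsPolyMatrix fun ω => M ω * M' ω := by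
  obtain ⟨P, hP⟩ := h
  obtain ⟨P', hP'⟩ := h'
  refine ⟨P * P', fun ω => ?_⟩
  simp only [hP, hP']
  exact (Matrix.map_mul (f := Polynomial.evalRingHom (ω : ℂ))).symm

theorem isPolyMatrix_const (M : Matrix ι κ ℂ) : IsPolyMatrix fun _ => M :=
  ⟨M.map Polynomial.C, fun ω => by ext i j; simp⟩

/-- Because `ω` is real, conjugating the coefficients conjugates the values. -/
theorem IsPolyMatrix.conjTranspose {M : ℝ → Matrix ι κ ℂ} (h : IsPolyMatrix M) :
    IsPolyMatrix fun ω => (M ω)ᴴ := by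
  obtain ⟨P, hP⟩ := h
  refine ⟨(P.map (Polynomial.map (starRingEnd ℂ)))ᵀ, fun ω => ?_⟩
  ext i j
  simp only [hP, Matrix.conjTranspose_apply, Matrix.map_apply, Matrix.transpose_apply]
  have := Polynomial.eval_map_apply (p := P j i) (f := starRingEnd ℂ) (ω : ℂ)
  rw [Complex.conj_ofReal] at this
  exact this.symm

theorem IsPolyMatrix.adjugate [Fintype κ] [DecidableEq κ] {M : ℝ → Matrix κ κ ℂ} (h : IsPolyMatrix M) :
    IsPolyMatrix fun ω => (M ω).adjugate := by
  obtain ⟨P, hP⟩ := h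
  refine ⟨P.adjugate, fun ω => ?_⟩
  simp only [hP]
  exact ((Polynomial.evalRingHom (ω : ℂ)).map_adjugate P).symm

theorem IsPolyMatrix.exists_det [Fintype κ] [DecidableEq κ] {M : ℝ → Matrix κ κ ℂ} (h : IsPolyMatrix M) :
    ∃ p : ℂ[X], ∀ ω : ℝ, (M ω).det = p.eval (ω : ℂ) := by
  obtain ⟨P, hP⟩ := h
  refine ⟨P.det, fun ω => ?_⟩
  rw [hP]
  exact ((Polynomial.evalRingHom (ω : ℂ)).map_det P).symm

theorem IsPolyMatrix.fromRows {l : Type*} {M : ℝ → Matrix ι κ ℂ}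
    {M' : ℝ → Matrix l κ ℂ} (h : IsPolyMatrix M) (h' : IsPolyMatrix M') :
    IsPolyMatrix fun ω => Matrix.fromRows (M ω) (M' ω) := by
  obtain ⟨P, hP⟩ := h
  obtain ⟨P', hP'⟩ := h'
  refine ⟨Matrix.fromRows P P', fun ω => ?_⟩
  simp only [hP, hP']
  ext i j
  rcases i with i | i <;> simp

theorem isPolyMatrix_smul_one [DecidableEq κ] (p : ℂ[X]) :
    IsPolyMatrix fun ω => p.eval (ω : ℂ) • (1 : Matrix κ κ ℂ) := by
  refine ⟨p • (1 : Matrix κ κ ℂ[X]), fun ω => ?_⟩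
  ext i j
  by_cases hij : i = j
  · subst hij; simp
  · simp [hij]

theorem IsPolyMatrix.sub {M M' : ℝ → Matrix ι κ ℂ} (h : IsPolyMatrix M) (h' : IsPolyMatrix M') :
    IsPolyMatrix fun ω => M ω - M' ω := by
  obtain ⟨P, hP⟩ := h
  obtain ⟨P', hP'⟩ := h'
  refine ⟨P - P', fun ω => ?_⟩
  simp only [hP, hP']
  ext i j
  simp

theorem IsPolyMatrix.hasPolyGrowth [Fintype ι] [Fintype κ] {M : ℝ → Matrix ι κ ℂ} (h : IsPolyMatrix M) :
    HasPolyGrowth fun ω => ∑ i, ∑ j, ‖M ω i j‖ ^ 2 := by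
  obtain ⟨P, hP⟩ := h
  simp only [hP, Matrix.map_apply]
  exact hasPolyGrowth_sum _ fun i => hasPolyGrowth_sum _ fun j => hasPolyGrowth_normSq_eval _

theorem IsPolyMatrix.exists_sum_norm_mulVec_sq_le [Fintype ι] [Fintype κ] {M : ℝ → Matrix ι κ ℂ} (h : IsPolyMatrix M) :
    ∃ (C : ℝ) (N : ℕ), 0 ≤ C ∧ ∀ (ω : ℝ) (z : κ → ℂ),
      ∑ i, ‖(M ω *ᵥ z) i‖ ^ 2 ≤ C * (1 + ω ^ 2) ^ N * ∑ j, ‖z j‖ ^ 2 := by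
  obtain ⟨C, N, hC, hb⟩ := h.hasPolyGrowth
  refine ⟨C, N, hC, fun ω z => (sum_norm_mulVec_sq_le _ _).trans ?_⟩
  gcongr
  exact hb ω

open scoped MatrixOrder Matrix.Norms.L2Operator in
theorem _root_.Matrix.PosSemidef.exists_eq_conjTranspose_mul_self [Fintype κ] [DecidableEq κ]
    {S : Matrix κ κ ℂ} (hS : S.PosSemidef) : ∃ F : Matrix κ κ ℂ, S = Fᴴ * F :=
  CStarAlgebra.nonneg_iff_eq_star_mul_self.1 hS.nonneg

/-- A polynomial family of positive semidefinite matrices is bounded below by the square of its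
determinant, up to polynomial factors. -/
theorem IsPolyMatrix.exists_det_sq_mul_le [Fintype κ] [DecidableEq κ] {S : ℝ → Matrix κ κ ℂ}
    (h : IsPolyMatrix S) (hS : ∀ ω, (S ω).PosSemidef) :
    ∃ (C : ℝ) (N : ℕ), 0 ≤ C ∧ ∀ (ω : ℝ) (z : κ → ℂ),
      ‖(S ω).det‖ ^ 2 * ∑ i, ‖z i‖ ^ 2 ≤ C * (1 + ω ^ 2) ^ N * (star z ⬝ᵥ (S ω *ᵥ z)).re := by
  obtain ⟨C, N, hC, hb⟩ :=
    ((h.adjugate.mul h).mul h.adjugate.conjTranspose).exists_sum_norm_mulVec_sq_le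
  refine ⟨1 + C, N, by positivity, fun ω z => ?_⟩
  obtain ⟨F, hF⟩ : ∃ F : Matrix κ κ ℂ, S ω = Fᴴ * F := (hS ω).exists_eq_conjTranspose_mul_self
  have hquad : ∀ a b : κ → ℂ, star a ⬝ᵥ (S ω *ᵥ b) = star (F *ᵥ a) ⬝ᵥ (F *ᵥ b) := by
    intro a b
    rw [hF, ← Matrix.mulVec_mulVec, Matrix.dotProduct_mulVec, Matrix.star_mulVec]
  have hre : ∀ a : κ → ℂ, (star a ⬝ᵥ (S ω *ᵥ a)).re = ∑ i, ‖(F *ᵥ a) i‖ ^ 2 := by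
    intro a
    rw [hquad, star_dotProduct_self, Complex.ofReal_re]
  set s := ∑ i, ‖z i‖ ^ 2 with hs
  have hs0 : 0 ≤ s := by positivity
  rcases hs0.eq_or_lt with h0 | hpos
  · rw [← h0, mul_zero, hre]
    positivity
  -- With this `y` one has `y* S z = det S · |z|²`. Cauchy–Schwarz for the semidefinite form `S`
  -- gives `|det S|² |z|⁴ ≤ (y* S y)(z* S z)`, and `y* S y` is at most a polynomial times `|z|²`.
  set y := (S ω).adjugateᴴ *ᵥ z with hy
  have hyz : star y ⬝ᵥ (S ω *ᵥ z) = (S ω).det * s := by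
    rw [hy, Matrix.star_mulVec, Matrix.conjTranspose_conjTranspose, ← Matrix.dotProduct_mulVec,
      Matrix.mulVec_mulVec, Matrix.adjugate_mul, Matrix.smul_mulVec, Matrix.one_mulVec,
      dotProduct_smul, star_dotProduct_self, smul_eq_mul]
  have hcs := norm_star_dotProduct_sq_le (F *ᵥ y) (F *ᵥ z)
  rw [← hquad, hyz, ← hre, ← hre, norm_mul, Complex.norm_real, Real.norm_of_nonneg hs0,
    mul_pow] at hcs
  set t := (star y ⬝ᵥ (S ω *ᵥ y)).re with ht
  set r := (star z ⬝ᵥ (S ω *ᵥ z)).re with hr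
  have hr0 : 0 ≤ r := by rw [hr, hre]; positivity
  have hyy : star y ⬝ᵥ (S ω *ᵥ y) =
      star z ⬝ᵥ (((S ω).adjugate * S ω * (S ω).adjugateᴴ) *ᵥ z) := by
    rw [hy, Matrix.star_mulVec, Matrix.conjTranspose_conjTranspose, ← Matrix.dotProduct_mulVec,
      Matrix.mulVec_mulVec, Matrix.mulVec_mulVec, Matrix.mul_assoc]
  have ht2 : t ^ 2 ≤ C * (1 + ω ^ 2) ^ N * s ^ 2 := by
    calc t ^ 2 ≤ ‖star y ⬝ᵥ (S ω *ᵥ y)‖ ^ 2 := by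
          rw [ht, sq_le_sq, abs_norm]
          exact Complex.abs_re_le_norm _
      _ ≤ s * (C * (1 + ω ^ 2) ^ N * s) := by
          rw [hyy]
          refine (norm_star_dotProduct_sq_le _ _).trans ?_
          gcongr
          exact hb ω z
      _ = _ := by ring
  have hP : 1 ≤ (1 + ω ^ 2) ^ N := one_le_pow₀ (by nlinarith [sq_nonneg ω])
  set P := (1 + ω ^ 2) ^ N with hPdef
  -- What is known bounds `t²`; `1 + C` is used in place of a square root, as `C P ≤ ((1 + C) P)²`
  -- when `P ≥ 1`.
  have ht1 : t ≤ (1 + C) * P * s := by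
    have h2 : t ^ 2 ≤ ((1 + C) * P * s) ^ 2 := by
      refine ht2.trans ?_
      have h3 : C * P ≤ ((1 + C) * P) ^ 2 := by
        have : C * P ≤ (1 + C) * P := by nlinarith
        have h4 : 1 ≤ (1 + C) * P := by nlinarith
        nlinarith
      calc C * P * s ^ 2 ≤ ((1 + C) * P) ^ 2 * s ^ 2 := by gcongr
        _ = _ := by ring
    exact (le_abs_self t).trans (abs_le_of_sq_le_sq h2 (by positivity))
  have h5 : ‖(S ω).det‖ ^ 2 * s ^ 2 ≤ ((1 + C) * P * s) * r :=
    hcs.trans (mul_le_mul_of_nonneg_right ht1 hr0)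
  have h6 : (‖(S ω).det‖ ^ 2 * s) * s ≤ ((1 + C) * P * r) * s := by nlinarith
  exact le_of_mul_le_mul_right h6 hpos

end PolynomialGrowth

/-! ### From the frequency condition to a scalar weight. -/

section Transfer

variable {n : ℕ} (A : Matrix (Fin n) (Fin n) ℝ) {ι κ : Type*} [Fintype ι] [DecidableEq ι]
  [Fintype κ] [DecidableEq κ] (B : Matrix (Fin n) ι ℝ)

/-- The transfer function from the input `u` to the signal `[x; u]`. -/
noncomputable def transferMatrix (s : ℂ) : Matrix (Fin n ⊕ ι) ι ℂ :=
  Matrix.fromRows ((s • (1 : Matrix (Fin n) (Fin n) ℂ) - A.map Complex.ofReal)⁻¹ *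
    B.map Complex.ofReal) 1

variable {A}

/-- The factor `det(iω - A)`, which never vanishes, clears the denominators of the transfer matrix
and makes the frequency form a polynomial family `S`. Its determinant `D` is a polynomial, and
`exists_det_sq_mul_le` bounds the form below by `|D|² |z|²` up to a power of `1 + ω²`. The
polynomial growth of the cleared transfer matrix then passes from the input to the whole signal. -/
theorem exists_polynomial_weight (hA : IsHurwitz A) (Q : Matrix (Fin n ⊕ ι) (Fin n ⊕ ι) ℂ)
    (Z : Matrix ι κ ℂ)
    (hpos : ∀ s : ℂ, s.re = 0 → ((transferMatrix A B s * Z)ᴴ * Q *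
      (transferMatrix A B s * Z)).PosSemidef)
    {s₀ : ℂ} (hs₀ : s₀.re = 0) (hdef : ((transferMatrix A B s₀ * Z)ᴴ * Q *
      (transferMatrix A B s₀ * Z)).det ≠ 0) :
    ∃ (D : ℂ[X]) (N : ℕ) (C : ℝ), D ≠ 0 ∧ 0 ≤ C ∧ ∀ (ω : ℝ) (z : κ → ℂ),
      ‖D.eval (ω : ℂ)‖ ^ 2 / (1 + ω ^ 2) ^ N *
        ∑ i, ‖((transferMatrix A B (Complex.I * ω) * Z) *ᵥ z) i‖ ^ 2 ≤
      C * (star z ⬝ᵥ (((transferMatrix A B (Complex.I * ω) * Z)ᴴ * Q *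
        (transferMatrix A B (Complex.I * ω) * Z)) *ᵥ z)).re := by
  set X : ℝ → Matrix (Fin n) (Fin n) ℂ := fun ω =>
    (Complex.I * ω : ℂ) • (1 : Matrix (Fin n) (Fin n) ℂ) - A.map Complex.ofReal with hX
  have hXpoly : IsPolyMatrix X := by
    refine IsPolyMatrix.sub ?_ (isPolyMatrix_const _)
    have := isPolyMatrix_smul_one (κ := Fin n) (Polynomial.C Complex.I * Polynomial.X)
    simpa using this
  have hXdet : ∀ ω, (X ω).det ≠ 0 := fun ω => hA _ (by simp)
  obtain ⟨χ, hχ⟩ := hXpoly.exists_det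
  set M : ℝ → Matrix (Fin n ⊕ ι) κ ℂ := fun ω =>
    Matrix.fromRows ((X ω).adjugate * B.map Complex.ofReal) (χ.eval (ω : ℂ) • 1) * Z with hM
  have hMpoly : IsPolyMatrix M :=
    ((hXpoly.adjugate.mul (isPolyMatrix_const _)).fromRows (isPolyMatrix_smul_one χ)).mul
      (isPolyMatrix_const _)
  have hMT : ∀ ω, M ω = (X ω).det • (transferMatrix A B (Complex.I * ω) * Z) := by
    intro ω
    rw [← Matrix.smul_mul]
    refine congrArg (· * Z) ?_
    have hinv : (X ω).adjugate = (X ω).det • (X ω)⁻¹ := by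
      rw [Matrix.inv_def, smul_smul, Ring.mul_inverse_cancel _ (isUnit_iff_ne_zero.2 (hXdet ω)),
        one_smul]
    ext i j
    rcases i with i | i
    · simp only [transferMatrix, hinv, Matrix.fromRows_apply_inl, Matrix.smul_apply,
        Matrix.smul_mul]
      rfl
    · simp [transferMatrix, hχ]
  set S : ℝ → Matrix κ κ ℂ := fun ω => (M ω)ᴴ * Q * M ω with hS
  have hSpoly : IsPolyMatrix S := (hMpoly.conjTranspose.mul (isPolyMatrix_const _)).mul hMpoly
  have hST : ∀ ω, S ω = ((‖(X ω).det‖ ^ 2 : ℝ) : ℂ) •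
      ((transferMatrix A B (Complex.I * ω) * Z)ᴴ * Q *
        (transferMatrix A B (Complex.I * ω) * Z)) := by
    intro ω
    simp only [hS, hMT, Matrix.conjTranspose_smul, Matrix.smul_mul, Matrix.mul_smul, smul_smul]
    congr 1
    rw [Complex.star_def, Complex.mul_conj, Complex.normSq_eq_norm_sq]
  have hSpos : ∀ ω, (S ω).PosSemidef := by
    intro ω
    rw [hST]
    exact (hpos _ (by simp)).smul (Complex.zero_le_real.2 (sq_nonneg _))
  obtain ⟨C₁, N₁, hC₁, h₁⟩ := hSpoly.exists_det_sq_mul_le hSpos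
  obtain ⟨C₂, N₂, hC₂, h₂⟩ := hMpoly.exists_sum_norm_mulVec_sq_le
  obtain ⟨D, hD⟩ := hSpoly.exists_det
  refine ⟨D, N₁ + N₂, C₁ * C₂, ?_, by positivity, fun ω z => ?_⟩
  -- If `D` were zero, the frequency form would be singular at `s₀ = i Im s₀`.
  · rintro rfl
    have h0 := hD s₀.im
    have hs : Complex.I * (s₀.im : ℂ) = s₀ := by
      apply Complex.ext <;> simp [hs₀]
    rw [Polynomial.eval_zero, hST, Matrix.det_smul, hs] at h0
    refine mul_ne_zero (pow_ne_zero _ ?_) hdef h0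
    have := hXdet s₀.im
    exact_mod_cast pow_ne_zero 2 (norm_ne_zero_iff.2 this)
  · set c := ‖(X ω).det‖ ^ 2 with hc
    have hc0 : 0 < c := by have := norm_pos_iff.2 (hXdet ω); positivity
    set T := transferMatrix A B (Complex.I * ω) * Z with hT
    have e1 : ∑ i, ‖(M ω *ᵥ z) i‖ ^ 2 = c * ∑ i, ‖(T *ᵥ z) i‖ ^ 2 := by
      simp only [hMT, Matrix.smul_mulVec, Pi.smul_apply, norm_smul, mul_pow, ← Finset.mul_sum, hc, hT]
    have e2 : (star z ⬝ᵥ (S ω *ᵥ z)).re = c * (star z ⬝ᵥ ((Tᴴ * Q * T) *ᵥ z)).re := by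
      rw [hST, Matrix.smul_mulVec, dotProduct_smul, smul_eq_mul, Complex.re_ofReal_mul]
    have a1 := h₁ ω z
    have a2 := h₂ ω z
    rw [e1] at a2
    rw [e2, hD] at a1
    have hP : 0 < (1 + ω ^ 2) ^ (N₁ + N₂) := by positivity
    rw [div_mul_eq_mul_div, div_le_iff₀ hP]
    refine le_of_mul_le_mul_left ?_ hc0
    calc c * (‖D.eval (ω : ℂ)‖ ^ 2 * ∑ i, ‖(T *ᵥ z) i‖ ^ 2)
        = ‖D.eval (ω : ℂ)‖ ^ 2 * (c * ∑ i, ‖(T *ᵥ z) i‖ ^ 2) := by ring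
      _ ≤ ‖D.eval (ω : ℂ)‖ ^ 2 * (C₂ * (1 + ω ^ 2) ^ N₂ * ∑ j, ‖z j‖ ^ 2) := by gcongr
      _ = C₂ * (1 + ω ^ 2) ^ N₂ * (‖D.eval (ω : ℂ)‖ ^ 2 * ∑ j, ‖z j‖ ^ 2) := by ring
      _ ≤ C₂ * (1 + ω ^ 2) ^ N₂ *
          (C₁ * (1 + ω ^ 2) ^ N₁ * (c * (star z ⬝ᵥ ((Tᴴ * Q * T) *ᵥ z)).re)) := by gcongr
      _ = _ := by ring

end Transfer

end MinimaxCT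

namespace MinimaxCT

open Matrix Filter Topology Set

/-! ### Quadratic forms of zero-state responses in the frequency domain. -/

section Signals

variable {n : ℕ} (A : Matrix (Fin n) (Fin n) ℝ) {ι κ : Type*} [Fintype ι] [Fintype κ]
  (B : Matrix (Fin n) ι ℝ)

/-- The signal `[x; u]`, where `x` is the zero initial state response to the input `u`. -/
noncomputable def inputSignal (u : ℝ → ι → ℝ) (t : ℝ) : Fin n ⊕ ι → ℝ :=
  Sum.elim (stateResponse A 0 (fun τ => B *ᵥ u τ) t) (u t)

/-- The bilinear form `∫ ⟨f, Q g⟩` on `[0, ∞)`. -/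
noncomputable def signalForm (Q : Matrix κ κ ℝ) (f g : ℝ → κ → ℝ) : ℝ :=
  ∫ t in Ioi (0 : ℝ), f t ⬝ᵥ (Q *ᵥ g t)

variable {A}

theorem IsDecaying.inputSignal (hA : IsHurwitz A) {u : ℝ → ι → ℝ} (hu : IsDecaying u) :
    IsDecaying (MinimaxCT.inputSignal A B u) :=
  ((hu.mulVec B).stateResponse hA).sumElim hu

theorem IsDecaying.spectrumOf_inputSignal [DecidableEq ι] (hA : IsHurwitz A) {u : ℝ → ι → ℝ}
    (hu : IsDecaying u) (ξ : ℝ) :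
    spectrumOf (MinimaxCT.inputSignal A B u) ξ =
      transferMatrix A B (Complex.I * (2 * Real.pi * ξ : ℝ)) *ᵥ spectrumOf u ξ := by
  have hs : (2 * Real.pi * Complex.I * ξ : ℂ) = Complex.I * (2 * Real.pi * ξ : ℝ) := by
    push_cast; ring
  have h := (hu.mulVec B).spectrumOf_stateResponse hA ξ
  rw [hu.spectrumOf_mulVec, hs] at h
  have hdet := hA (Complex.I * (2 * Real.pi * ξ : ℝ)) (by simp)
  have hx : spectrumOf (MinimaxCT.stateResponse A 0 (fun τ => B *ᵥ u τ)) ξ =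
      ((Complex.I * (2 * Real.pi * ξ : ℝ)) • (1 : Matrix (Fin n) (Fin n) ℂ) -
        A.map Complex.ofReal)⁻¹ *ᵥ (B.map Complex.ofReal *ᵥ spectrumOf u ξ) := by
    rw [← h, Matrix.mulVec_mulVec, Matrix.nonsing_inv_mul _ (isUnit_iff_ne_zero.2 hdet),
      Matrix.one_mulVec]
  have h2 : spectrumOf (MinimaxCT.inputSignal A B u) ξ =
      Sum.elim (spectrumOf (MinimaxCT.stateResponse A 0 (fun τ => B *ᵥ u τ)) ξ)
        (spectrumOf u ξ) := spectrumOf_sumElim _ _ ξ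
  rw [h2, hx, transferMatrix, Matrix.fromRows_mulVec, Matrix.one_mulVec, Matrix.mulVec_mulVec]

theorem IsDecaying.integrable_star_dotProduct (Q : Matrix κ κ ℝ) {f g : ℝ → κ → ℝ}
    (hf : IsDecaying f) (hg : IsDecaying g) :
    Integrable fun ξ => star (spectrumOf f ξ) ⬝ᵥ (Q.map Complex.ofReal *ᵥ spectrumOf g ξ) := by
  simp only [dotProduct, Matrix.mulVec, Finset.mul_sum]
  refine integrable_finsetSum _ fun i _ => integrable_finsetSum _ fun j _ => ?_
  refine ((hf.integrable_conj_spectrumOf_mul hg i j).const_mul (Q i j : ℂ)).congr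
    (ae_of_all _ fun ξ => ?_)
  simp only [Pi.star_apply, Matrix.map_apply]
  ring

/-- Plancherel's formula for quadratic forms of signals. -/
theorem IsDecaying.signalForm_eq (Q : Matrix κ κ ℝ) {f g : ℝ → κ → ℝ}
    (hf : IsDecaying f) (hg : IsDecaying g) :
    signalForm Q f g =
      ∫ ξ, (star (spectrumOf f ξ) ⬝ᵥ (Q.map Complex.ofReal *ᵥ spectrumOf g ξ)).re := by
  have h1 : signalForm Q f g = ∑ i, ∑ j, Q i j * ∫ t, f t i * g t j := by
    have h0 : signalForm Q f g = ∫ t, f t ⬝ᵥ (Q *ᵥ g t) := by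
      refine setIntegral_eq_integral_of_forall_compl_eq_zero fun t ht => ?_
      rw [hf.eq_zero t (not_lt.1 ht), zero_dotProduct]
    rw [h0]
    simp only [dotProduct, Matrix.mulVec, Finset.mul_sum]
    have hi : ∀ i j, Integrable fun t => f t i * (Q i j * g t j) := fun i j =>
      ((hf.integrable_mul_apply hg i j).const_mul (Q i j)).congr
        (ae_of_all _ fun t => by beta_reduce; ring)
    rw [integral_finsetSum _ fun i _ => integrable_finsetSum _ fun j _ => hi i j]
    refine Finset.sum_congr rfl fun i _ => ?_
    rw [integral_finsetSum _ fun j _ => hi i j]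
    refine Finset.sum_congr rfl fun j _ => ?_
    rw [← integral_const_mul]
    refine integral_congr_ae (ae_of_all _ fun t => ?_)
    ring
  have h2 : ∫ ξ, star (spectrumOf f ξ) ⬝ᵥ (Q.map Complex.ofReal *ᵥ spectrumOf g ξ) =
      ((∑ i, ∑ j, Q i j * ∫ t, f t i * g t j : ℝ) : ℂ) := by
    simp only [dotProduct, Matrix.mulVec, Finset.mul_sum]
    have hi : ∀ i j, Integrable fun ξ => star (spectrumOf f ξ) i *
        (Q.map Complex.ofReal i j * spectrumOf g ξ j) := fun i j =>
      ((hf.integrable_conj_spectrumOf_mul hg i j).const_mul (Q i j : ℂ)).congr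
        (ae_of_all _ fun t => by simp only [Pi.star_apply, Matrix.map_apply]; ring)
    rw [integral_finsetSum _ fun i _ => integrable_finsetSum _ fun j _ => hi i j]
    push_cast
    refine Finset.sum_congr rfl fun i _ => ?_
    rw [integral_finsetSum _ fun j _ => hi i j]
    refine Finset.sum_congr rfl fun j _ => ?_
    rw [← hf.integral_conj_spectrumOf_mul hg i j, ← integral_const_mul]
    refine integral_congr_ae (ae_of_all _ fun t => ?_)
    simp only [Pi.star_apply, Matrix.map_apply]
    ring
  rw [h1]
  have h3 := integral_re (hf.integrable_star_dotProduct Q hg)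
  simp only [RCLike.re_eq_complex_re] at h3
  rw [h3, h2, Complex.ofReal_re]

theorem star_mulVec_dotProduct_mulVec {μ : Type*} [Fintype μ] (M : Matrix κ ι ℂ)
    (N : Matrix κ μ ℂ) (Q : Matrix κ κ ℂ)
    (z : ι → ℂ) (z' : μ → ℂ) :
    star (M *ᵥ z) ⬝ᵥ (Q *ᵥ (N *ᵥ z')) = star z ⬝ᵥ ((Mᴴ * Q * N) *ᵥ z') := by
  rw [Matrix.star_mulVec, ← Matrix.dotProduct_mulVec, Matrix.mulVec_mulVec, Matrix.mulVec_mulVec,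
    Matrix.mul_assoc]

/-- If the frequency form restricted to the inputs `Z v` is positive semidefinite on the imaginary
axis and nondegenerate at one point, then the effect of the initial state on these inputs is bounded
by the quadratic form of the zero initial state responses. -/
theorem IsHurwitz.exists_expPairing_sq_le [DecidableEq ι] [DecidableEq κ] (hA : IsHurwitz A)
    (Q : Matrix (Fin n ⊕ ι) (Fin n ⊕ ι) ℝ) (Z : Matrix ι κ ℝ)
    (hpos : ∀ s : ℂ, s.re = 0 → ((transferMatrix A B s * Z.map Complex.ofReal)ᴴ *
      Q.map Complex.ofReal * (transferMatrix A B s * Z.map Complex.ofReal)).PosSemidef)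
    {s₀ : ℂ} (hs₀ : s₀.re = 0) (hdef : ((transferMatrix A B s₀ * Z.map Complex.ofReal)ᴴ *
      Q.map Complex.ofReal * (transferMatrix A B s₀ * Z.map Complex.ofReal)).det ≠ 0)
    (K : Matrix (Fin n ⊕ ι) (Fin n) ℝ) (a : Fin n → ℝ) :
    ∃ C : ℝ, 0 ≤ C ∧ ∀ v : ℝ → κ → ℝ, IsDecaying v →
      expPairing A K a (MinimaxCT.inputSignal A B fun t => Z *ᵥ v t) ^ 2 ≤
        C * signalForm Q (MinimaxCT.inputSignal A B fun t => Z *ᵥ v t)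
          (MinimaxCT.inputSignal A B fun t => Z *ᵥ v t) := by
  obtain ⟨D, N, C₁, hD, hC₁, h₁⟩ := exists_polynomial_weight B hA (Q.map Complex.ofReal)
    (Z.map Complex.ofReal) hpos hs₀ hdef
  -- The weight acts on the spectrum of the whole signal `[x; Z v]`, because this is what `K exp(tA)
  -- a` is paired with.
  obtain ⟨C₂, hC₂, h₂⟩ := isAdmissibleWeight_polynomial (κ := Fin n ⊕ ι) hA hD N K a
  refine ⟨C₂ * C₁, by positivity, fun v hv => ?_⟩
  set f := MinimaxCT.inputSignal A B fun t => Z *ᵥ v t with hf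
  have hfd : IsDecaying f := (hv.mulVec Z).inputSignal B hA
  have hspec : ∀ ξ, spectrumOf f ξ = (transferMatrix A B (Complex.I * (2 * Real.pi * ξ : ℝ)) *
      Z.map Complex.ofReal) *ᵥ spectrumOf v ξ := by
    intro ξ
    rw [hf, (hv.mulVec Z).spectrumOf_inputSignal B hA, hv.spectrumOf_mulVec, Matrix.mulVec_mulVec]
  set F : ℝ → ℝ := fun ξ =>
    (star (spectrumOf f ξ) ⬝ᵥ (Q.map Complex.ofReal *ᵥ spectrumOf f ξ)).re with hF
  have hFi : Integrable F := (hfd.integrable_star_dotProduct Q hfd).re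
  have hFeq : ∀ ξ, F ξ = (star (spectrumOf v ξ) ⬝ᵥ
      (((transferMatrix A B (Complex.I * (2 * Real.pi * ξ : ℝ)) * Z.map Complex.ofReal)ᴴ *
        Q.map Complex.ofReal * (transferMatrix A B (Complex.I * (2 * Real.pi * ξ : ℝ)) *
          Z.map Complex.ofReal)) *ᵥ spectrumOf v ξ)).re := by
    intro ξ
    rw [← star_mulVec_dotProduct_mulVec, ← hspec]
  have hF0 : ∀ ξ, 0 ≤ F ξ := by
    intro ξ
    rw [hFeq]
    exact (Complex.le_def.1 ((hpos _ (by simp)).dotProduct_mulVec_nonneg _)).1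
  have hint : 0 ≤ ∫ ξ, F ξ := integral_nonneg hF0
  have h3 := h₂ f hfd
  have h4 : ∫⁻ ξ : ℝ, ENNReal.ofReal (‖D.eval ((2 * Real.pi * ξ : ℝ) : ℂ)‖ ^ 2 /
      (1 + (2 * Real.pi * ξ) ^ 2) ^ N * ∑ i, ‖spectrumOf f ξ i‖ ^ 2) ≤
      ENNReal.ofReal (C₁ * ∫ ξ, F ξ) := by
    rw [← integral_const_mul, ofReal_integral_eq_lintegral_ofReal (hFi.const_mul _)
      (ae_of_all _ fun ξ => mul_nonneg hC₁ (hF0 ξ))]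
    refine lintegral_mono fun ξ => ENNReal.ofReal_le_ofReal ?_
    rw [hFeq, hspec]
    exact h₁ _ _
  have h5 := h3.trans (mul_le_mul' le_rfl h4)
  rw [← ENNReal.ofReal_mul hC₂, ENNReal.ofReal_le_ofReal_iff (by positivity)] at h5
  rw [hfd.signalForm_eq Q hfd, mul_assoc]
  exact h5

end Signals

/-! ### The frequency inequality in the time domain. -/

section Positivity

theorem fromRows_one_zero_map {κ μ : Type*} [DecidableEq κ] :
    (Matrix.fromRows (1 : Matrix κ κ ℝ) (0 : Matrix μ κ ℝ)).map Complex.ofReal =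
      Matrix.fromRows 1 0 := by
  ext i j
  rcases i with i | i
  · by_cases hij : i = j
    · subst hij; simp
    · simp [hij]
  · simp

theorem fromRows_zero_one_map {κ μ : Type*} [DecidableEq μ] :
    (Matrix.fromRows (0 : Matrix κ μ ℝ) (1 : Matrix μ μ ℝ)).map Complex.ofReal =
      Matrix.fromRows 0 1 := by
  ext i j
  rcases i with i | i
  · simp
  · by_cases hij : i = j
    · subst hij; simp
    · simp [hij]

theorem mul_conjTranspose_mul_mul {ι κ α β : Type*} [Fintype ι] [Fintype κ]
    (T : Matrix ι κ ℂ) (Q : Matrix ι ι ℂ) (X : Matrix κ α ℂ) (Y : Matrix κ β ℂ) :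
    (T * X)ᴴ * Q * (T * Y) = Xᴴ * (Tᴴ * Q * T) * Y := by
  simp only [Matrix.conjTranspose_mul, Matrix.mul_assoc]

variable {κ μ : Type*} [Fintype κ] [Fintype μ] [DecidableEq κ] [DecidableEq μ]

/-- Presents the blocks of `Π` as compressions to inputs `Z v`, so that one estimate with a general
`Z` serves both players. -/
theorem toBlocks_eq_compression (S : Matrix (κ ⊕ μ) (κ ⊕ μ) ℂ) :
    (Matrix.fromRows (1 : Matrix κ κ ℂ) (0 : Matrix μ κ ℂ))ᴴ * S *
        (Matrix.fromRows (1 : Matrix κ κ ℂ) (0 : Matrix μ κ ℂ)) = S.toBlocks₁₁ ∧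
    (Matrix.fromRows (1 : Matrix κ κ ℂ) (0 : Matrix μ κ ℂ))ᴴ * S *
        (Matrix.fromRows (0 : Matrix κ μ ℂ) (1 : Matrix μ μ ℂ)) = S.toBlocks₁₂ ∧
    (Matrix.fromRows (0 : Matrix κ μ ℂ) (1 : Matrix μ μ ℂ))ᴴ * S *
        (Matrix.fromRows (1 : Matrix κ κ ℂ) (0 : Matrix μ κ ℂ)) = S.toBlocks₂₁ ∧
    (Matrix.fromRows (0 : Matrix κ μ ℂ) (1 : Matrix μ μ ℂ))ᴴ * S *
        (Matrix.fromRows (0 : Matrix κ μ ℂ) (1 : Matrix μ μ ℂ)) = S.toBlocks₂₂ := by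
  obtain ⟨a, b, c, d, rfl⟩ : ∃ a b c d, S = Matrix.fromBlocks a b c d :=
    ⟨_, _, _, _, (Matrix.fromBlocks_toBlocks S).symm⟩
  simp only [Matrix.conjTranspose_fromRows_eq_fromCols_conjTranspose,
    Matrix.fromCols_mul_fromBlocks, Matrix.fromCols_mul_fromRows]
  simp

variable {n : ℕ} {A : Matrix (Fin n) (Fin n) ℝ} (B : Matrix (Fin n) (κ ⊕ μ) ℝ)

/-- By Plancherel the expression is the integral over the frequencies of the positive semidefinite
block form evaluated at the spectra of `v` and `w`. -/
theorem IsHurwitz.signalForm_nonneg (hA : IsHurwitz A)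
    (Q : Matrix (Fin n ⊕ (κ ⊕ μ)) (Fin n ⊕ (κ ⊕ μ)) ℝ) (ε : ℝ)
    (hfreq : ∀ s : ℂ, s.re = 0 →
      (Matrix.fromBlocks
        ((transferMatrix A B s)ᴴ * Q.map Complex.ofReal * transferMatrix A B s).toBlocks₁₁
        ((ε : ℂ) • ((transferMatrix A B s)ᴴ * Q.map Complex.ofReal *
          transferMatrix A B s).toBlocks₁₂)
        ((ε : ℂ) • ((transferMatrix A B s)ᴴ * Q.map Complex.ofReal *
          transferMatrix A B s).toBlocks₂₁)
        (-((transferMatrix A B s)ᴴ * Q.map Complex.ofReal *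
          transferMatrix A B s).toBlocks₂₂)).PosSemidef)
    {v : ℝ → κ → ℝ} {w : ℝ → μ → ℝ} (hv : IsDecaying v) (hw : IsDecaying w) :
    0 ≤ signalForm Q
          (inputSignal A B fun t => Matrix.fromRows (1 : Matrix κ κ ℝ) (0 : Matrix μ κ ℝ) *ᵥ v t)
          (inputSignal A B fun t => Matrix.fromRows (1 : Matrix κ κ ℝ) (0 : Matrix μ κ ℝ) *ᵥ v t) +
        ε * (signalForm Q
          (inputSignal A B fun t => Matrix.fromRows (1 : Matrix κ κ ℝ) (0 : Matrix μ κ ℝ) *ᵥ v t)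
          (inputSignal A B fun t => Matrix.fromRows (0 : Matrix κ μ ℝ) (1 : Matrix μ μ ℝ) *ᵥ w t) +
        signalForm Q
          (inputSignal A B fun t => Matrix.fromRows (0 : Matrix κ μ ℝ) (1 : Matrix μ μ ℝ) *ᵥ w t)
          (inputSignal A B fun t => Matrix.fromRows (1 : Matrix κ κ ℝ) (0 : Matrix μ κ ℝ) *ᵥ v t)) -
        signalForm Q
          (inputSignal A B fun t => Matrix.fromRows (0 : Matrix κ μ ℝ) (1 : Matrix μ μ ℝ) *ᵥ w t)
          (inputSignal A B fun t => Matrix.fromRows (0 : Matrix κ μ ℝ) (1 : Matrix μ μ ℝ) *ᵥ w t)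
          := by
  set Z₁ := Matrix.fromRows (1 : Matrix κ κ ℝ) (0 : Matrix μ κ ℝ) with hZ₁
  set Z₂ := Matrix.fromRows (0 : Matrix κ μ ℝ) (1 : Matrix μ μ ℝ) with hZ₂
  set f := inputSignal A B fun t => Z₁ *ᵥ v t with hf
  set g := inputSignal A B fun t => Z₂ *ᵥ w t with hg
  have hfd : IsDecaying f := (hv.mulVec Z₁).inputSignal B hA
  have hgd : IsDecaying g := (hw.mulVec Z₂).inputSignal B hA
  have hfs : ∀ ξ, spectrumOf f ξ = (transferMatrix A B (Complex.I * (2 * Real.pi * ξ : ℝ)) *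
      Z₁.map Complex.ofReal) *ᵥ spectrumOf v ξ := by
    intro ξ
    rw [hf, (hv.mulVec Z₁).spectrumOf_inputSignal B hA, hv.spectrumOf_mulVec,
      Matrix.mulVec_mulVec]
  have hgs : ∀ ξ, spectrumOf g ξ = (transferMatrix A B (Complex.I * (2 * Real.pi * ξ : ℝ)) *
      Z₂.map Complex.ofReal) *ᵥ spectrumOf w ξ := by
    intro ξ
    rw [hg, (hw.mulVec Z₂).spectrumOf_inputSignal B hA, hw.spectrumOf_mulVec,
      Matrix.mulVec_mulVec]
  have i1 := (hfd.integrable_star_dotProduct Q hfd).re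
  have i2 := (hfd.integrable_star_dotProduct Q hgd).re
  have i3 := (hgd.integrable_star_dotProduct Q hfd).re
  have i4 := (hgd.integrable_star_dotProduct Q hgd).re
  simp only [RCLike.re_eq_complex_re] at i1 i2 i3 i4
  have i23 : Integrable fun ξ =>
      ε * ((star (spectrumOf f ξ) ⬝ᵥ Q.map Complex.ofReal *ᵥ spectrumOf g ξ).re +
        (star (spectrumOf g ξ) ⬝ᵥ Q.map Complex.ofReal *ᵥ spectrumOf f ξ).re) :=
    (i2.add i3).const_mul ε
  have i123 : Integrable fun ξ =>
      (star (spectrumOf f ξ) ⬝ᵥ Q.map Complex.ofReal *ᵥ spectrumOf f ξ).re +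
        ε * ((star (spectrumOf f ξ) ⬝ᵥ Q.map Complex.ofReal *ᵥ spectrumOf g ξ).re +
          (star (spectrumOf g ξ) ⬝ᵥ Q.map Complex.ofReal *ᵥ spectrumOf f ξ).re) :=
    i1.add i23
  rw [hfd.signalForm_eq Q hfd, hfd.signalForm_eq Q hgd, hgd.signalForm_eq Q hfd,
    hgd.signalForm_eq Q hgd, ← integral_add i2 i3, ← integral_const_mul,
    ← integral_add i1 i23, ← integral_sub i123 i4]
  refine integral_nonneg fun ξ => ?_
  set T := transferMatrix A B (Complex.I * (2 * Real.pi * ξ : ℝ)) with hT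
  set S := Tᴴ * Q.map Complex.ofReal * T with hS
  have hpos := (hfreq (Complex.I * (2 * Real.pi * ξ : ℝ)) (by simp)).dotProduct_mulVec_nonneg
    (Sum.elim (spectrumOf v ξ) (spectrumOf w ξ))
  obtain ⟨e1, e2, e3, e4⟩ := toBlocks_eq_compression S
  have hstar : star (Sum.elim (spectrumOf v ξ) (spectrumOf w ξ)) =
      Sum.elim (star (spectrumOf v ξ)) (star (spectrumOf w ξ)) := by
    ext i; rcases i with i | i <;> rfl
  rw [← hT, ← hS, Matrix.fromBlocks_mulVec, hstar, sumElim_dotProduct_sumElim] at hpos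
  simp only [Sum.elim_comp_inl, Sum.elim_comp_inr, dotProduct_add, Matrix.smul_mulVec,
    Matrix.neg_mulVec, dotProduct_smul, dotProduct_neg, smul_eq_mul] at hpos
  have hre := (Complex.le_def.1 hpos).1
  simp only [Complex.zero_re, Complex.add_re, Complex.re_ofReal_mul, Complex.neg_re] at hre
  simp only [hfs, hgs, ← hT]
  rw [star_mulVec_dotProduct_mulVec, star_mulVec_dotProduct_mulVec, star_mulVec_dotProduct_mulVec,
    star_mulVec_dotProduct_mulVec, mul_conjTranspose_mul_mul,
    mul_conjTranspose_mul_mul, mul_conjTranspose_mul_mul, mul_conjTranspose_mul_mul, ← hS, hZ₁, hZ₂, fromRows_one_zero_map,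
    fromRows_zero_one_map, e1, e2, e3, e4]
  simp only [Pi.zero_apply]
  linarith

end Positivity

/-! ### Spaces of square integrable signals. -/

/-- Square integrable functions on `[0, ∞)` with values in Euclidean space over `κ`. -/
abbrev SignalSpace (κ : Type*) [Fintype κ] : Type _ :=
  Lp (EuclideanSpace ℝ κ) 2 (volume.restrict (Set.Ici (0 : ℝ)))

section Basic

variable {ι κ : Type*} [Fintype ι] [Fintype κ]

theorem SignalSpace.memLp_apply (u : SignalSpace κ) (i : κ) :
    MemLp (fun t => (u t).ofLp i) 2 (volume.restrict (Ici (0 : ℝ))) :=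
  memLp_piLp_iff.1 (Lp.memLp u) i

theorem SignalSpace.intervalIntegrable (u : SignalSpace κ) {t : ℝ} (ht : 0 ≤ t) :
    IntervalIntegrable (fun τ => (u τ).ofLp) volume 0 t := by
  refine intervalIntegrable_pi_iff.2 fun i => ?_
  rw [intervalIntegrable_iff_integrableOn_Ioc_of_le ht]
  have h : MemLp (fun t => (u t).ofLp i) 2 (volume.restrict (Ioc 0 t)) :=
    (u.memLp_apply i).mono_measure (Measure.restrict_mono (fun x hx => hx.1.le) le_rfl)
  exact h.integrable one_le_two

theorem SignalSpace.norm_sq_eq_integral (u : SignalSpace κ) :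
    ‖u‖ ^ 2 = ∫ t in Ioi (0 : ℝ), ‖u t‖ ^ 2 := by
  rw [← real_inner_self_eq_norm_sq, L2.inner_def, restrict_Ioi_eq_restrict_Ici]
  simp only [real_inner_self_eq_norm_sq]

theorem norm_ofLp_sq_le (x : EuclideanSpace ℝ κ) : ‖x.ofLp‖ ^ 2 ≤ ‖x‖ ^ 2 := by
  have h := (PiLp.lipschitzWith_ofLp 2 fun _ : κ => ℝ).norm_le_mul rfl x
  rw [NNReal.coe_one, one_mul] at h
  gcongr

theorem norm_toLp_sq_le (x : κ → ℝ) : ‖WithLp.toLp 2 x‖ ^ 2 ≤ Fintype.card κ * ‖x‖ ^ 2 := by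
  rw [EuclideanSpace.norm_sq_eq, ← nsmul_eq_mul]
  refine Finset.sum_le_card_nsmul _ _ _ fun i _ => ?_
  have := norm_le_pi_norm x i
  gcongr

theorem SignalSpace.integrableOn_norm_sq (u : SignalSpace κ) :
    IntegrableOn (fun t => ‖u t‖ ^ 2) (Ioi (0 : ℝ)) := by
  rw [IntegrableOn, restrict_Ioi_eq_restrict_Ici]
  simpa only [real_inner_self_eq_norm_sq] using L2.integrable_inner (𝕜 := ℝ) u u

theorem SignalSpace.aestronglyMeasurable_mulVec {μ : Type*} (M : Matrix μ κ ℝ) (u : SignalSpace κ) :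
    AEStronglyMeasurable (fun t => M *ᵥ (u t).ofLp) (volume.restrict (Ioi (0 : ℝ))) := by
  rw [restrict_Ioi_eq_restrict_Ici]
  have h : Continuous fun x : EuclideanSpace ℝ κ => M *ᵥ x.ofLp := by fun_prop
  exact h.comp_aestronglyMeasurable (Lp.memLp u).1

theorem SignalSpace.exists_integral_mulVec_sq_le (M : Matrix ι κ ℝ) :
    ∃ C, 0 ≤ C ∧ ∀ u : SignalSpace κ,
      IntegrableOn (fun t => ‖M *ᵥ (u t).ofLp‖ ^ 2) (Ioi (0 : ℝ)) ∧
      ∫ t in Ioi (0 : ℝ), ‖M *ᵥ (u t).ofLp‖ ^ 2 ≤ C * ‖u‖ ^ 2 := by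
  obtain ⟨C, hC, hM⟩ := exists_norm_mulVec_le M
  refine ⟨C ^ 2, by positivity, fun u => ?_⟩
  have hle : ∀ t, ‖M *ᵥ (u t).ofLp‖ ^ 2 ≤ C ^ 2 * ‖u t‖ ^ 2 := fun t =>
    calc ‖M *ᵥ (u t).ofLp‖ ^ 2 ≤ (C * ‖(u t).ofLp‖) ^ 2 := by gcongr; exact hM _
      _ = C ^ 2 * ‖(u t).ofLp‖ ^ 2 := by ring
      _ ≤ _ := by gcongr ?_ * ?_; exact norm_ofLp_sq_le _
  have hint : IntegrableOn (fun t => C ^ 2 * ‖u t‖ ^ 2) (Ioi (0 : ℝ)) :=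
    u.integrableOn_norm_sq.const_mul _
  have hi : IntegrableOn (fun t => ‖M *ᵥ (u t).ofLp‖ ^ 2) (Ioi (0 : ℝ)) :=
    hint.mono' ((u.aestronglyMeasurable_mulVec M).norm.pow 2)
      (ae_of_all _ fun t => by simpa using hle t)
  refine ⟨hi, ?_⟩
  rw [u.norm_sq_eq_integral, ← integral_const_mul]
  exact integral_mono hi hint hle

theorem intervalIntegrable_mulVec_signal (M : Matrix ι κ ℝ) (u : SignalSpace κ) {t : ℝ}
    (ht : 0 ≤ t) : IntervalIntegrable (fun τ => M *ᵥ (u τ).ofLp) volume 0 t :=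
  intervalIntegrable_mulVec (M := fun _ => M) continuous_const (u.intervalIntegrable ht)

variable [DecidableEq κ]

/-- Pointwise multiplication by a matrix. -/
noncomputable def mulL (M : Matrix ι κ ℝ) : SignalSpace κ →L[ℝ] SignalSpace ι :=
  ContinuousLinearMap.compLpL 2 _ (Matrix.toEuclideanLin M).toContinuousLinearMap

theorem mulL_ae_eq (M : Matrix ι κ ℝ) (u : SignalSpace κ) :
    ∀ᵐ t ∂volume.restrict (Ici (0 : ℝ)), ((mulL M u) t).ofLp = M *ᵥ (u t).ofLp := by
  filter_upwards [ContinuousLinearMap.coeFn_compLpL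
    (Matrix.toEuclideanLin M).toContinuousLinearMap u] with t ht
  rw [mulL, ht]
  simp

theorem inner_mulL_eq (Q : Matrix κ κ ℝ) (u v : SignalSpace κ) :
    inner ℝ u (mulL Q v) =
      signalForm Q (fun t => (u t).ofLp) (fun t => (v t).ofLp) := by
  rw [L2.inner_def, signalForm, restrict_Ioi_eq_restrict_Ici]
  refine integral_congr_ae ?_
  filter_upwards [mulL_ae_eq Q v] with t ht
  rw [EuclideanSpace.inner_eq_star_dotProduct, ht, star_trivial, dotProduct_comm]

end Basic

/-! ### The system as a bounded operator on `L²`. -/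

section Response

variable {n : ℕ} {ι : Type*} [Fintype ι] {A : Matrix (Fin n) (Fin n) ℝ}
  (B : Matrix (Fin n) ι ℝ)

theorem IsHurwitz.memLp_response (hA : IsHurwitz A) (a : Fin n → ℝ) (u : SignalSpace ι) :
    MemLp (fun t => WithLp.toLp 2 (Sum.elim
      (stateResponse A a (fun τ => B *ᵥ (u τ).ofLp) t) (u t).ofLp)) 2
      (volume.restrict (Ici (0 : ℝ))) := by
  refine memLp_piLp_iff.2 fun i => ?_
  rcases i with i | i
  · obtain ⟨K, -, hK⟩ := hA.exists_integral_norm_stateResponse_sq_le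
    obtain ⟨C, -, hC⟩ := SignalSpace.exists_integral_mulVec_sq_le B
    have hii := fun t ht => intervalIntegrable_mulVec_signal B u (t := t) ht
    have h1 := (hK a _ hii (hC u).1).1
    rw [IntegrableOn, restrict_Ioi_eq_restrict_Ici] at h1
    have hc := continuousOn_stateResponse A a hii
    have hm : AEStronglyMeasurable (stateResponse A a fun τ => B *ᵥ (u τ).ofLp)
        (volume.restrict (Ici (0 : ℝ))) := hc.aestronglyMeasurable measurableSet_Ici
    have h2 : MemLp (stateResponse A a fun τ => B *ᵥ (u τ).ofLp) 2
        (volume.restrict (Ici (0 : ℝ))) := (memLp_two_iff_integrable_sq_norm hm).2 h1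
    exact h2.eval i
  · exact u.memLp_apply i

/-- The signal `[x; u]`, where `x` solves `ẋ = A x + B u`, `x(0) = a`. -/
noncomputable def IsHurwitz.response (hA : IsHurwitz A) (a : Fin n → ℝ) (u : SignalSpace ι) :
    SignalSpace (Fin n ⊕ ι) :=
  (hA.memLp_response B a u).toLp _

theorem IsHurwitz.response_ae_eq (hA : IsHurwitz A) (a : Fin n → ℝ) (u : SignalSpace ι) :
    ∀ᵐ t ∂volume.restrict (Ici (0 : ℝ)), (hA.response B a u t).ofLp =
      Sum.elim (stateResponse A a (fun τ => B *ᵥ (u τ).ofLp) t) (u t).ofLp := by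
  filter_upwards [(hA.memLp_response B a u).coeFn_toLp] with t ht
  rw [IsHurwitz.response, ht]

theorem stateResponse_signal_congr {a : Fin n → ℝ} {f g : ℝ → Fin n → ℝ}
    (h : ∀ᵐ t ∂volume.restrict (Ici (0 : ℝ)), f t = g t) {t : ℝ} (ht : 0 ≤ t) :
    stateResponse A a f t = stateResponse A a g t := by
  refine stateResponse_congr A a ?_
  rw [ae_restrict_iff' measurableSet_Ici] at h
  filter_upwards [h] with τ hτ hτ'
  rw [uIoc_of_le ht] at hτ'
  exact hτ hτ'.1.le

theorem IsHurwitz.response_add (hA : IsHurwitz A) (a b : Fin n → ℝ) (u v : SignalSpace ι) :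
    hA.response B (a + b) (u + v) = hA.response B a u + hA.response B b v := by
  refine Lp.ext ?_
  have hadd : ∀ᵐ t ∂volume.restrict (Ici (0 : ℝ)), B *ᵥ ((u + v : SignalSpace ι) t).ofLp =
      B *ᵥ (u t).ofLp + B *ᵥ (v t).ofLp := by
    filter_upwards [Lp.coeFn_add u v] with t ht
    rw [ht, Pi.add_apply, WithLp.ofLp_add, Matrix.mulVec_add]
  filter_upwards [hA.response_ae_eq B (a + b) (u + v), hA.response_ae_eq B a u,
    hA.response_ae_eq B b v, Lp.coeFn_add (hA.response B a u) (hA.response B b v),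
    Lp.coeFn_add u v, ae_restrict_mem measurableSet_Ici] with t h1 h2 h3 h4 h5 ht
  refine WithLp.ofLp_injective 2 ?_
  rw [h4, Pi.add_apply, WithLp.ofLp_add, h1, h2, h3, h5,
    stateResponse_signal_congr hadd ht,
    stateResponse_add A a b (intervalIntegrable_mulVec_signal B u ht)
      (intervalIntegrable_mulVec_signal B v ht)]
  ext i
  rcases i with i | i <;> rfl

theorem IsHurwitz.response_smul (hA : IsHurwitz A) (c : ℝ) (a : Fin n → ℝ) (u : SignalSpace ι) :
    hA.response B (c • a) (c • u) = c • hA.response B a u := by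
  refine Lp.ext ?_
  have hsmul : ∀ᵐ t ∂volume.restrict (Ici (0 : ℝ)), B *ᵥ ((c • u : SignalSpace ι) t).ofLp =
      c • (B *ᵥ (u t).ofLp) := by
    filter_upwards [Lp.coeFn_smul c u] with t ht
    rw [ht, Pi.smul_apply, WithLp.ofLp_smul, Matrix.mulVec_smul]
  filter_upwards [hA.response_ae_eq B (c • a) (c • u), hA.response_ae_eq B a u,
    Lp.coeFn_smul c (hA.response B a u), Lp.coeFn_smul c u,
    ae_restrict_mem measurableSet_Ici] with t h1 h2 h4 h5 ht
  refine WithLp.ofLp_injective 2 ?_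
  rw [h4, Pi.smul_apply, WithLp.ofLp_smul, h1, h2, h5,
    stateResponse_signal_congr hsmul ht, stateResponse_smul]
  ext i
  rcases i with i | i <;> rfl

theorem IsHurwitz.exists_norm_response_le (hA : IsHurwitz A) :
    ∃ C, ∀ (a : Fin n → ℝ) (u : SignalSpace ι),
      ‖hA.response B a u‖ ≤ C * ‖(a, u)‖ := by
  obtain ⟨K, hK0, hK⟩ := hA.exists_integral_norm_stateResponse_sq_le
  obtain ⟨C, hC0, hC⟩ := SignalSpace.exists_integral_mulVec_sq_le B
  -- The factor `n` passes from the supremum norm of the state to the Euclidean norm; the `1`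
  -- accounts for the input component.
  set M : ℝ := n * (K * (1 + C)) + 1 with hM
  refine ⟨√M, fun a u => ?_⟩
  refine le_of_sq_le_sq ?_ (by positivity)
  rw [mul_pow, Real.sq_sqrt (by positivity)]
  set x := stateResponse A a (fun τ => B *ᵥ (u τ).ofLp) with hx
  obtain ⟨hi, hle⟩ := hK a _ (fun t ht => intervalIntegrable_mulVec_signal B u ht) (hC u).1
  have h1 : ‖hA.response B a u‖ ^ 2 ≤ n * (∫ t in Ioi (0 : ℝ), ‖x t‖ ^ 2) + ‖u‖ ^ 2 := by
    rw [SignalSpace.norm_sq_eq_integral, SignalSpace.norm_sq_eq_integral u, ← integral_const_mul,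
      ← integral_add (hi.const_mul _) u.integrableOn_norm_sq]
    refine integral_mono_ae (SignalSpace.integrableOn_norm_sq _)
      ((hi.const_mul _).add u.integrableOn_norm_sq) ?_
    have h := ae_restrict_of_ae_restrict_of_subset Ioi_subset_Ici_self (hA.response_ae_eq B a u)
    filter_upwards [h] with t ht
    have h2 := norm_toLp_sq_le (x t)
    rw [Fintype.card_fin] at h2
    rw [EuclideanSpace.norm_sq_eq, ht, Fintype.sum_sum_type]
    simp only [Sum.elim_inl, Sum.elim_inr]
    rw [← EuclideanSpace.norm_sq_eq (u t)]
    rw [EuclideanSpace.norm_sq_eq] at h2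
    exact add_le_add_left h2 _
  have ha : ‖a‖ ^ 2 ≤ ‖(a, u)‖ ^ 2 := by gcongr; exact norm_fst_le (a, u)
  have hu : ‖u‖ ^ 2 ≤ ‖(a, u)‖ ^ 2 := by gcongr; exact norm_snd_le (a, u)
  calc ‖hA.response B a u‖ ^ 2 ≤ n * (∫ t in Ioi (0 : ℝ), ‖x t‖ ^ 2) + ‖u‖ ^ 2 := h1
    _ ≤ n * (K * (‖(a, u)‖ ^ 2 + C * ‖(a, u)‖ ^ 2)) + ‖(a, u)‖ ^ 2 := by
      gcongr
      exact hle.trans (by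
        gcongr
        exact (hC u).2.trans (by gcongr))
    _ = M * ‖(a, u)‖ ^ 2 := by rw [hM]; ring

/-- The map `(a, u) ↦ [x; u]` as a bounded operator. -/
noncomputable def IsHurwitz.responseL (hA : IsHurwitz A) :
    ((Fin n → ℝ) × SignalSpace ι) →L[ℝ] SignalSpace (Fin n ⊕ ι) :=
  LinearMap.mkContinuousOfExistsBound
    { toFun := fun p => hA.response B p.1 p.2
      map_add' := fun p p' => hA.response_add B p.1 p'.1 p.2 p'.2
      map_smul' := fun c p => hA.response_smul B c p.1 p.2 }
    ((hA.exists_norm_response_le B).imp fun _ h p => h p.1 p.2)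

end Response

/-! ### Decaying signals are dense. -/

section Density

variable {κ : Type*} [Fintype κ]

theorem IsDecaying.memLp_toLp {v : ℝ → κ → ℝ} (hv : IsDecaying v) :
    MemLp (fun t => WithLp.toLp 2 (v t)) 2 (volume.restrict (Ici (0 : ℝ))) :=
  memLp_piLp_iff.2 fun i => (hv.memLp_apply i).restrict _

variable (κ) in
/-- The signals represented by continuous, exponentially decaying functions vanishing at `0`. -/
noncomputable def decayingSignals : Submodule ℝ (SignalSpace κ) where
  carrier := {u | ∃ v, IsDecaying v ∧ ∀ᵐ t ∂volume.restrict (Ici (0 : ℝ)), (u t).ofLp = v t}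
  add_mem' := by
    rintro u u' ⟨v, hv, h⟩ ⟨v', hv', h'⟩
    refine ⟨_, hv.add hv', ?_⟩
    filter_upwards [Lp.coeFn_add u u', h, h'] with t h1 h2 h3
    rw [h1, Pi.add_apply, WithLp.ofLp_add, h2, h3]
  zero_mem' := by
    refine ⟨fun _ => 0, ⟨continuous_const, fun _ _ => rfl, 1, 1, one_pos, one_pos, fun t _ => ?_⟩, ?_⟩
    · rw [norm_zero]; positivity
    · filter_upwards [Lp.coeFn_zero (EuclideanSpace ℝ κ) 2 (volume.restrict (Ici (0 : ℝ)))] with t h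
      rw [h]; rfl
  smul_mem' := by
    rintro c u ⟨v, hv, h⟩
    refine ⟨_, hv.smul c, ?_⟩
    filter_upwards [Lp.coeFn_smul c u, h] with t h1 h2
    rw [h1, Pi.smul_apply, WithLp.ofLp_smul, h2]

theorem isDecaying_smul_of_hasCompactSupport {φ : ℝ → ℝ} (hφ : Continuous φ)
    (hc : HasCompactSupport φ) (hs : tsupport φ ⊆ Ioi 0) (e : κ → ℝ) :
    IsDecaying fun t => φ t • e := by
  have hzero : ∀ t ≤ 0, φ t = 0 := fun t ht => by
    by_contra h
    exact absurd (hs (subset_tsupport φ h)) (not_lt.2 ht)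
  have hc' : HasCompactSupport fun t => Real.exp t • φ t • e :=
    (hc.smul_right (f' := fun _ => e)).smul_left (f := Real.exp)
  obtain ⟨C, hC⟩ := (by fun_prop : Continuous fun t => Real.exp t • φ t • e).bounded_above_of_compact_support
    hc'
  refine ⟨by fun_prop, fun t ht => by simp only [hzero t ht, zero_smul], |C| + 1, 1, by positivity,
    one_pos, fun t _ => ?_⟩
  have h := hC t
  rw [norm_smul, Real.norm_of_nonneg (Real.exp_pos t).le] at h
  rw [neg_one_mul, Real.exp_neg, ← div_eq_mul_inv, le_div_iff₀ (Real.exp_pos t), mul_comm]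
  linarith [le_abs_self C]

/-- A signal orthogonal to the subspace is orthogonal to every `φ • eᵢ` with a smooth `φ` compactly
supported in `(0, ∞)`. Hence it vanishes almost everywhere by the fundamental lemma of the calculus
of variations. -/
theorem dense_decayingSignals : Dense (decayingSignals κ : Set (SignalSpace κ)) := by
  classical
  rw [Submodule.dense_iff_topologicalClosure_eq_top, Submodule.topologicalClosure_eq_top_iff,
    Submodule.eq_bot_iff]
  intro u hu
  have key : ∀ i, ∀ᵐ t ∂volume.restrict (Ici (0 : ℝ)), t ∈ Ioi (0 : ℝ) → (u t).ofLp i = 0 := by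
    intro i
    refine isOpen_Ioi.ae_eq_zero_of_integral_contDiff_smul_eq_zero
      (((u.memLp_apply i).locallyIntegrable one_le_two).locallyIntegrableOn _) fun φ hφ hc hs => ?_
    have hd := isDecaying_smul_of_hasCompactSupport hφ.continuous hc hs (Pi.single i (1 : ℝ))
    have h := (Submodule.mem_orthogonal _ _).1 hu (hd.memLp_toLp.toLp _)
      ⟨_, hd, by filter_upwards [hd.memLp_toLp.coeFn_toLp] with t ht; rw [ht]⟩
    rw [L2.inner_def] at h
    refine Eq.trans (integral_congr_ae ?_) h
    filter_upwards [hd.memLp_toLp.coeFn_toLp] with t ht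
    rw [ht, EuclideanSpace.inner_eq_star_dotProduct, star_trivial, dotProduct_smul,
      dotProduct_single, mul_one]
  refine Lp.ext ?_
  have hpos : ∀ᵐ t ∂volume.restrict (Ici (0 : ℝ)), t ∈ Ioi (0 : ℝ) := by
    rw [← restrict_Ioi_eq_restrict_Ici]
    exact ae_restrict_mem measurableSet_Ioi
  filter_upwards [ae_all_iff.2 key, hpos,
    Lp.coeFn_zero (EuclideanSpace ℝ κ) 2 (volume.restrict (Ici (0 : ℝ)))] with t h1 h2 h3
  rw [h3]
  ext i
  exact h1 i h2

end Density

/-! ### Well-posedness and the cost as a quadratic form. -/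

section WellPosed

variable {n k q : ℕ} {A : Matrix (Fin n) (Fin n) ℝ}
  (B₁ : Matrix (Fin n) (Fin k) ℝ) (B₂ : Matrix (Fin n) (Fin q) ℝ)

theorem intervalIntegrable_input (v : L2Signal k) (w : L2Signal q) {t : ℝ} (ht : 0 ≤ t) :
    IntervalIntegrable (fun τ => B₁ *ᵥ (v τ).ofLp + B₂ *ᵥ (w τ).ofLp) volume 0 t :=
  (intervalIntegrable_mulVec_signal B₁ v ht).add (intervalIntegrable_mulVec_signal B₂ w ht)

theorem isTrajectory_stateResponse (a : Fin n → ℝ) (v : L2Signal k) (w : L2Signal q) :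
    IsTrajectory A B₁ B₂ a v w
      (stateResponse A a fun τ => B₁ *ᵥ (v τ).ofLp + B₂ *ᵥ (w τ).ofLp) := by
  refine ⟨continuousOn_stateResponse A a fun t ht => intervalIntegrable_input B₁ B₂ v w ht,
    fun t ht => ?_⟩
  simp only [add_assoc]
  exact stateResponse_eq_integral A a (intervalIntegrable_input B₁ B₂ v w ht)

theorem IsTrajectory.eqOn {a : Fin n → ℝ} {v : L2Signal k} {w : L2Signal q}
    {y z : ℝ → Fin n → ℝ} (hy : IsTrajectory A B₁ B₂ a v w y)
    (hz : IsTrajectory A B₁ B₂ a v w z) : EqOn y z (Ici 0) :=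
  eqOn_of_integral_eq A a (fun _ ht => intervalIntegrable_input B₁ B₂ v w ht) hy.1 hz.1
    (by simpa only [add_assoc] using hy.2) (by simpa only [add_assoc] using hz.2)

theorem isTrajectory_trajectory (a : Fin n → ℝ) (v : L2Signal k) (w : L2Signal q) :
    IsTrajectory A B₁ B₂ a v w (trajectory A B₁ B₂ a v w) :=
  Classical.epsilon_spec ⟨_, isTrajectory_stateResponse B₁ B₂ a v w⟩

/-- The pair `(v, w)` as a single signal. -/
noncomputable def pairSignal (v : L2Signal k) (w : L2Signal q) : SignalSpace (Fin k ⊕ Fin q) :=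
  mulL (Matrix.fromRows 1 0) v + mulL (Matrix.fromRows 0 1) w

theorem pairSignal_ae_eq (v : L2Signal k) (w : L2Signal q) :
    ∀ᵐ t ∂volume.restrict (Ici (0 : ℝ)),
      (pairSignal v w t).ofLp = Sum.elim (v t).ofLp (w t).ofLp := by
  filter_upwards [Lp.coeFn_add
    (mulL (Matrix.fromRows 1 0 : Matrix (Fin k ⊕ Fin q) (Fin k) ℝ) v)
    (mulL (Matrix.fromRows 0 1 : Matrix (Fin k ⊕ Fin q) (Fin q) ℝ) w), mulL_ae_eq (Matrix.fromRows 1 0 : Matrix (Fin k ⊕ Fin q) (Fin k) ℝ) v,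
    mulL_ae_eq (Matrix.fromRows 0 1 : Matrix (Fin k ⊕ Fin q) (Fin q) ℝ) w] with t h1 h2 h3
  rw [pairSignal, h1, Pi.add_apply, WithLp.ofLp_add, h2, h3, Matrix.fromRows_mulVec,
    Matrix.fromRows_mulVec]
  ext i
  rcases i with i | i <;> simp

/-- Uniqueness of solutions identifies the chosen `trajectory` with the explicit response, on which
the Hilbert space structure is available. -/
theorem IsHurwitz.quadForm_ae_eq (hA : IsHurwitz A)
    (Q : Matrix (Fin n ⊕ Fin k ⊕ Fin q) (Fin n ⊕ Fin k ⊕ Fin q) ℝ) (a : Fin n → ℝ)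
    (v : L2Signal k) (w : L2Signal q) :
    (fun t => quadForm Q (trajectory A B₁ B₂ a v w t) (v t) (w t))
      =ᵐ[volume.restrict (Ici (0 : ℝ))] fun t =>
      inner ℝ (hA.response (Matrix.fromCols B₁ B₂) a (pairSignal v w) t)
        (mulL Q (hA.response (Matrix.fromCols B₁ B₂) a (pairSignal v w)) t) := by
  have hin : ∀ᵐ t ∂volume.restrict (Ici (0 : ℝ)), Matrix.fromCols B₁ B₂ *ᵥ (pairSignal v w t).ofLp =
      B₁ *ᵥ (v t).ofLp + B₂ *ᵥ (w t).ofLp := by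
    filter_upwards [pairSignal_ae_eq v w] with t ht
    rw [ht, Matrix.fromCols_mulVec_sumElim]
  filter_upwards [mulL_ae_eq Q (hA.response (Matrix.fromCols B₁ B₂) a (pairSignal v w)),
    hA.response_ae_eq (Matrix.fromCols B₁ B₂) a (pairSignal v w), pairSignal_ae_eq v w,
    ae_restrict_mem measurableSet_Ici] with t h1 h2 h3 ht
  rw [EuclideanSpace.inner_eq_star_dotProduct, star_trivial, dotProduct_comm, h1, h2, h3,
    stateResponse_signal_congr hin ht, quadForm,
    (isTrajectory_trajectory B₁ B₂ a v w).eqOn B₁ B₂ (isTrajectory_stateResponse B₁ B₂ a v w) ht]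

theorem IsHurwitz.isWellPosed (hA : IsHurwitz A)
    (Q : Matrix (Fin n ⊕ Fin k ⊕ Fin q) (Fin n ⊕ Fin k ⊕ Fin q) ℝ) (a : Fin n → ℝ) :
    IsWellPosed A B₁ B₂ Q a := fun v w =>
  ⟨isTrajectory_trajectory B₁ B₂ a v w,
    fun _ hy => hy.eqOn B₁ B₂ (isTrajectory_trajectory B₁ B₂ a v w),
    (integrable_congr (hA.quadForm_ae_eq B₁ B₂ Q a v w)).2 (L2.integrable_inner _ _)⟩

theorem IsHurwitz.cost_eq (hA : IsHurwitz A)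
    (Q : Matrix (Fin n ⊕ Fin k ⊕ Fin q) (Fin n ⊕ Fin k ⊕ Fin q) ℝ) (a : Fin n → ℝ)
    (v : L2Signal k) (w : L2Signal q) :
    cost A B₁ B₂ Q a v w =
      inner ℝ (hA.response (Matrix.fromCols B₁ B₂) a (pairSignal v w))
        (mulL Q (hA.response (Matrix.fromCols B₁ B₂) a (pairSignal v w))) := by
  rw [cost, L2.inner_def]
  exact integral_congr_ae (hA.quadForm_ae_eq B₁ B₂ Q a v w)

end WellPosed

end MinimaxCT

namespace MinimaxCT
open Filter Topology Set
open scoped InnerProductSpace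

/-! ### Optimal values over dense subsets. -/

section Density

/-- The minimiser `y₀` need not lie in the range of `j`; a lower bound on a dense set is a lower
bound everywhere, by continuity. -/
theorem isGLB_range_comp_of_denseRange {X Y : Type*} [TopologicalSpace Y] {f : Y → ℝ}
    (hf : Continuous f) {y₀ : Y} (hmin : ∀ y, f y₀ ≤ f y) {j : X → Y} (hj : DenseRange j) :
    IsGLB (range fun x => f (j x)) (f y₀) := by
  refine ⟨?_, fun b hb => ?_⟩
  · rintro _ ⟨x, rfl⟩
    exact hmin _
  · refine hj.induction_on (p := fun y => b ≤ f y) y₀ (isClosed_le continuous_const hf) fun x => ?_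
    exact hb ⟨x, rfl⟩

theorem isLUB_range_comp_of_denseRange {X Y : Type*} [TopologicalSpace Y] {f : Y → ℝ}
    (hf : Continuous f) {y₀ : Y} (hmax : ∀ y, f y ≤ f y₀) {j : X → Y} (hj : DenseRange j) :
    IsLUB (range fun x => f (j x)) (f y₀) := by
  refine ⟨?_, fun b hb => ?_⟩
  · rintro _ ⟨x, rfl⟩
    exact hmax _
  · refine hj.induction_on (p := fun y => f y ≤ b) y₀ (isClosed_le hf continuous_const) fun x => ?_
    exact hb ⟨x, rfl⟩

end Density

/-! ### Saddle points of strongly convex-concave quadratic functionals. -/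

section Saddle

variable {E F : Type*} [NormedAddCommGroup E] [InnerProductSpace ℝ E]
  [NormedAddCommGroup F] [InnerProductSpace ℝ F]

/-- A quadratic functional, strongly convex in the first and strongly concave in the second
variable, with coupling operator `T`. -/
def saddleForm (T : F →L[ℝ] E) (p : E) (r : F) (c : ℝ) (x : E) (y : F) : ℝ :=
  c + ⟪x, x⟫_ℝ + 2 * ⟪x, T y⟫_ℝ - ⟪y, y⟫_ℝ + 2 * ⟪p, x⟫_ℝ + 2 * ⟪r, y⟫_ℝ

theorem continuous_saddleForm (T : F →L[ℝ] E) (p : E) (r : F) (c : ℝ) :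
    Continuous fun z : E × F => saddleForm T p r c z.1 z.2 := by
  unfold saddleForm
  fun_prop

/-- Completing the square: the difference of the two sides is `‖x + T y + p‖²`. -/
theorem saddleForm_argmin_le (T : F →L[ℝ] E) (p : E) (r : F) (c : ℝ) (x : E) (y : F) :
    saddleForm T p r c (-(T y + p)) y ≤ saddleForm T p r c x y := by
  have h : saddleForm T p r c x y - saddleForm T p r c (-(T y + p)) y =
      ⟪x + T y + p, x + T y + p⟫_ℝ := by
    simp only [saddleForm, inner_add_left, inner_add_right, inner_neg_left, inner_neg_right]
    rw [real_inner_comm x (T y), real_inner_comm x p, real_inner_comm p (T y)]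
    ring
  linarith [real_inner_self_nonneg (x := x + T y + p)]

variable [CompleteSpace E] [CompleteSpace F]

theorem saddleForm_le_argmax (T : F →L[ℝ] E) (p : E) (r : F) (c : ℝ) (x : E) (y : F) :
    saddleForm T p r c x y ≤ saddleForm T p r c x (T.adjoint x + r) := by
  have h : saddleForm T p r c x (T.adjoint x + r) - saddleForm T p r c x y =
      ⟪y - (T.adjoint x + r), y - (T.adjoint x + r)⟫_ℝ := by
    simp only [saddleForm, ← ContinuousLinearMap.adjoint_inner_left T]
    simp only [inner_add_left, inner_add_right, inner_sub_left, inner_sub_right]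
    rw [real_inner_comm (T.adjoint x) y, real_inner_comm r y, real_inner_comm r (T.adjoint x)]
    ring
  linarith [real_inner_self_nonneg (x := y - (T.adjoint x + r))]

/-- Lax–Milgram: `1 + T T*` is coercive with constant `1`. -/
theorem exists_add_adjoint_eq (T : F →L[ℝ] E) (z : E) : ∃ x, x + T (T.adjoint x) = z := by
  set S : E →L[ℝ] E := ContinuousLinearMap.id ℝ E + T.comp T.adjoint with hS
  have hco : IsCoercive ((innerSL ℝ).comp S : E →L[ℝ] E →L[ℝ] ℝ) := by
    refine ⟨1, one_pos, fun u => ?_⟩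
    have h : ((innerSL ℝ).comp S : E →L[ℝ] E →L[ℝ] ℝ) u u =
        ⟪u, u⟫_ℝ + ⟪T.adjoint u, T.adjoint u⟫_ℝ := by
      rw [ContinuousLinearMap.adjoint_inner_left]
      simp only [hS, ContinuousLinearMap.comp_apply, innerSL_apply_apply,
        _root_.add_apply, ContinuousLinearMap.id_apply, inner_add_left]
      rw [real_inner_comm u (T _)]
    rw [h, real_inner_self_eq_norm_mul_norm, one_mul]
    linarith [real_inner_self_nonneg (x := T.adjoint u)]
  obtain ⟨x, hx⟩ := hco.continuousLinearEquivOfBilin.surjective z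
  refine ⟨x, ?_⟩
  rw [← hx]
  refine ext_inner_right ℝ fun w => ?_
  rw [IsCoercive.continuousLinearEquivOfBilin_apply]
  simp only [hS, ContinuousLinearMap.comp_apply, innerSL_apply_apply,
    _root_.add_apply, ContinuousLinearMap.id_apply]

/-- Eliminating `y` from the two stationarity conditions leaves `x + T T* x = -(T r + p)`. -/
theorem exists_saddlePoint (T : F →L[ℝ] E) (p : E) (r : F) :
    ∃ x y, x = -(T y + p) ∧ y = T.adjoint x + r := by
  obtain ⟨x, hx⟩ := exists_add_adjoint_eq T (-(T r + p))
  refine ⟨x, T.adjoint x + r, ?_, rfl⟩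
  calc x = x + T (T.adjoint x) - T (T.adjoint x) := (add_sub_cancel_right _ _).symm
    _ = -(T (T.adjoint x + r) + p) := by rw [hx, map_add]; abel

/-- Over a dense range the partial optima are still given by the explicit optimisers in `E` and `F`,
hence are continuous. A saddle point in `E × F` gives the minimax identity there, and density
carries it to `V` and `W`. -/
theorem saddleForm_minimax {V W : Type*} [TopologicalSpace V] [TopologicalSpace W]
    [Nonempty V] [Nonempty W]
    (T : F →L[ℝ] E) (p : E) (r : F) (c : ℝ) {i : V → E} {j : W → F} (hi : Continuous i)
    (hj : Continuous j) (hi' : DenseRange i) (hj' : DenseRange j) {g : V → W → ℝ}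
    (hg : ∀ v w, g v w = saddleForm T p r c (i v) (j w)) :
    (∀ w, BddBelow (range fun v => g v w)) ∧
    (Continuous fun w => ⨅ v, g v w) ∧
    (∀ v, BddAbove (range fun w => g v w)) ∧
    (Continuous fun v => ⨆ w, g v w) ∧
    BddBelow (range fun v => ⨆ w, g v w) ∧
    BddAbove (range fun w => ⨅ v, g v w) ∧
    (⨅ v, ⨆ w, g v w) = ⨆ w, ⨅ v, g v w := by
  simp only [hg]
  have hc := continuous_saddleForm T p r c
  have h1 : ∀ y, IsGLB (range fun v => saddleForm T p r c (i v) y)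
      (saddleForm T p r c (-(T y + p)) y) := fun y =>
    isGLB_range_comp_of_denseRange (f := fun x => saddleForm T p r c x y)
      (hc.comp (by fun_prop : Continuous fun x => (x, y)))
      (fun x => saddleForm_argmin_le T p r c x y) hi'
  have h2 : ∀ x, IsLUB (range fun w => saddleForm T p r c x (j w))
      (saddleForm T p r c x (T.adjoint x + r)) := fun x =>
    isLUB_range_comp_of_denseRange (f := fun y => saddleForm T p r c x y)
      (hc.comp (by fun_prop : Continuous fun y => (x, y)))
      (fun y => saddleForm_le_argmax T p r c x y) hj'
  have h3 : Continuous fun y => saddleForm T p r c (-(T y + p)) y :=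
    hc.comp (by fun_prop : Continuous fun y => (-(T y + p), y))
  have h4 : Continuous fun x => saddleForm T p r c x (T.adjoint x + r) :=
    hc.comp (by fun_prop : Continuous fun x => (x, T.adjoint x + r))
  obtain ⟨x, y, hx, hy⟩ := exists_saddlePoint T p r
  -- The value at the saddle point is at most that at `(x', y)`, which is at most the supremum over
  -- the second variable at `x'`.
  have h5 := isGLB_range_comp_of_denseRange h4 (y₀ := x) (fun x' => by
    rw [← hy]
    refine le_trans ?_ (saddleForm_le_argmax T p r c x' y)
    conv_lhs => rw [hx]
    exact saddleForm_argmin_le T p r c x' y) hi'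
  have h6 := isLUB_range_comp_of_denseRange h3 (y₀ := y) (fun y' => by
    rw [← hx]
    refine (saddleForm_argmin_le T p r c x y').trans ?_
    conv_rhs => rw [hy]
    exact saddleForm_le_argmax T p r c x y') hj'
  simp only [(h1 _).ciInf_eq, (h2 _).ciSup_eq, h5.ciInf_eq, h6.ciSup_eq, ← hx, ← hy]
  exact ⟨fun w => ⟨_, (h1 _).1⟩, h3.comp hj, fun v => ⟨_, (h2 _).1⟩, h4.comp hi,
    ⟨_, h5.1⟩, ⟨_, h6.1⟩, trivial⟩

end Saddle

/-! ### Hilbert space completions of semidefinite forms. -/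

section Completion

universe u

/-- A nonnegative symmetric form makes `V` a seminormed inner product space; its separated
completion also kills the null vectors, so `j` need not be injective. -/
theorem exists_hilbert_of_form {V : Type u} [AddCommGroup V] [Module ℝ V]
    (P : V →ₗ[ℝ] V →ₗ[ℝ] ℝ) (hsymm : ∀ x y, P x y = P y x) (hP : ∀ x, 0 ≤ P x x) :
    ∃ (H : Type u) (_ : NormedAddCommGroup H) (_ : InnerProductSpace ℝ H) (_ : CompleteSpace H)
      (j : V →ₗ[ℝ] H), DenseRange j ∧ ∀ x y, ⟪j x, j y⟫_ℝ = P x y := by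
  let core : PreInnerProductSpace.Core ℝ V :=
    { inner := fun x y => P x y
      conj_inner_symm := fun x y => by simpa using hsymm y x
      re_inner_nonneg := fun x => by simpa using hP x
      add_left := fun x y z => by simp
      smul_left := fun x y r => by simp }
  let := @InnerProductSpace.Core.toSeminormedAddCommGroup ℝ V _ _ _ core
  let := @InnerProductSpace.ofCore ℝ V _ _ _ core
  refine ⟨UniformSpace.Completion V, inferInstance, inferInstance, inferInstance,
    (UniformSpace.Completion.toComplₗᵢ (𝕜 := ℝ) (E := V)).toLinearMap,
    UniformSpace.Completion.denseRange_coe, fun x y => ?_⟩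
  exact UniformSpace.Completion.inner_coe x y

/-- The estimate makes `l` factor through `j` as a bounded functional, which extends by density and
is represented by Riesz. -/
theorem exists_inner_eq_of_sq_le {V H : Type*} [AddCommGroup V] [Module ℝ V]
    [NormedAddCommGroup H] [InnerProductSpace ℝ H] [CompleteSpace H] {j : V →ₗ[ℝ] H}
    (hj : DenseRange j) (l : V →ₗ[ℝ] ℝ) {C : ℝ}
    (hl : ∀ v, l v ^ 2 ≤ C * ⟪j v, j v⟫_ℝ) : ∃ p, ∀ v, l v = ⟪p, j v⟫_ℝ := by
  have h : ∃ C, ∀ v, ‖l v‖ ≤ C * ‖j v‖ := by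
    refine ⟨√|C|, fun v => ?_⟩
    rw [Real.norm_eq_abs]
    refine abs_le_of_sq_le_sq ?_ (by positivity)
    rw [mul_pow, Real.sq_sqrt (abs_nonneg _), ← real_inner_self_eq_norm_sq]
    exact (hl v).trans (mul_le_mul_of_nonneg_right (le_abs_self _) real_inner_self_nonneg)
  refine ⟨(InnerProductSpace.toDual ℝ H).symm (l.extendOfNorm j), fun v => ?_⟩
  rw [InnerProductSpace.toDual_symm_apply, LinearMap.extendOfNorm_eq hj h]

/-- Riesz in the first variable represents `b(·, w)` by a vector `t w`. Density of `i` makes `t w`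
unique, hence linear in `w`, and the estimate makes it bounded in the norm of `F`. -/
theorem exists_inner_clm_eq_of_sq_le {V W E F : Type*} [AddCommGroup V] [Module ℝ V]
    [AddCommGroup W] [Module ℝ W] [NormedAddCommGroup E] [InnerProductSpace ℝ E] [CompleteSpace E]
    [NormedAddCommGroup F] [InnerProductSpace ℝ F] {i : V →ₗ[ℝ] E}
    (hi : DenseRange i) {j : W →ₗ[ℝ] F} (hj : DenseRange j) (b : V →ₗ[ℝ] W →ₗ[ℝ] ℝ) {C : ℝ}
    (hC : 0 ≤ C) (hb : ∀ v w, b v w ^ 2 ≤ C * (⟪i v, i v⟫_ℝ * ⟪j w, j w⟫_ℝ)) :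
    ∃ T : F →L[ℝ] E, ∀ v w, b v w = ⟪i v, T (j w)⟫_ℝ := by
  have hex : ∀ w, ∃ p, ∀ v, b v w = ⟪i v, p⟫_ℝ := fun w => by
    obtain ⟨p, hp⟩ := exists_inner_eq_of_sq_le hi (b.flip w) (C := C * ⟪j w, j w⟫_ℝ) fun v => by
      rw [LinearMap.flip_apply, mul_assoc, mul_comm ⟪j w, j w⟫_ℝ]
      exact hb v w
    exact ⟨p, fun v => by rw [real_inner_comm, ← hp, LinearMap.flip_apply]⟩
  choose t ht using hex
  have hext : ∀ p p' : E, (∀ v, ⟪i v, p⟫_ℝ = ⟪i v, p'⟫_ℝ) → p = p' := fun p p' h =>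
    ext_inner_left ℝ fun x => hi.induction_on (p := fun x => ⟪x, p⟫_ℝ = ⟪x, p'⟫_ℝ) x
      (isClosed_eq (by fun_prop) (by fun_prop)) h
  let t' : W →ₗ[ℝ] E :=
    { toFun := t
      map_add' := fun w w' => hext _ _ fun v => by
        rw [inner_add_right, ← ht, ← ht, ← ht, map_add]
      map_smul' := fun c w => hext _ _ fun v => by
        rw [RingHom.id_apply, inner_smul_right, ← ht, ← ht, map_smul, smul_eq_mul] }
  have hnorm : ∃ C, ∀ w, ‖t' w‖ ≤ C * ‖j w‖ := by
    refine ⟨√C, fun w => ?_⟩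
    have h : ∀ x, ⟪x, t w⟫_ℝ ^ 2 ≤ C * (⟪x, x⟫_ℝ * ⟪j w, j w⟫_ℝ) := fun x =>
      hi.induction_on (p := fun x => ⟪x, t w⟫_ℝ ^ 2 ≤ C * (⟪x, x⟫_ℝ * ⟪j w, j w⟫_ℝ)) x
        (isClosed_le (by fun_prop) (by fun_prop)) fun v => by rw [← ht]; exact hb v w
    -- The bound, extended from the range of `i` to `E`, is tested at `t w` itself.
    have h1 := h (t w)
    simp only [real_inner_self_eq_norm_sq] at h1
    rcases (norm_nonneg (t w)).eq_or_lt with h0 | h0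
    · change ‖t w‖ ≤ _
      rw [← h0]
      positivity
    · refine le_of_sq_le_sq ?_ (by positivity)
      rw [mul_pow, Real.sq_sqrt hC]
      have h2 : 0 < ‖t w‖ ^ 2 := by positivity
      change ‖t w‖ ^ 2 ≤ _
      nlinarith
  refine ⟨t'.extendOfNorm j, fun v w => ?_⟩
  rw [LinearMap.extendOfNorm_eq hj hnorm]
  exact ht w v

end Completion

/-! ### The abstract minimax theorem. -/

section Minimax

/-- Used for the maps into the completions: continuity of the form transfers continuity of the
optimal values back to the original norm. -/
theorem continuous_of_continuous_inner_self {X Y : Type*} [NormedAddCommGroup X]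
    [NormedSpace ℝ X] [NormedAddCommGroup Y] [InnerProductSpace ℝ Y] (f : X →ₗ[ℝ] Y)
    (hf : Continuous fun x => ⟪f x, f x⟫_ℝ) : Continuous f := by
  refine continuous_of_continuousAt_zero f ?_
  have h := (Real.continuous_sqrt.comp hf).tendsto 0
  simp only [Function.comp_def, real_inner_self_eq_norm_sq, Real.sqrt_sq (norm_nonneg _)] at h
  rw [ContinuousAt, map_zero]
  exact tendsto_zero_iff_norm_tendsto_zero.2 (by simpa using h)

/-- In the completions for `P` and `R` the bounds on `b`, `l₁`, `l₂` turn them into an operator and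
two vectors, which reduces the claim to `saddleForm_minimax`. No coercivity of `P` or `R` is
required. -/
theorem minimax_of_forms {V W : Type*} [NormedAddCommGroup V] [NormedSpace ℝ V]
    [NormedAddCommGroup W] [NormedSpace ℝ W]
    (P : V →ₗ[ℝ] V →ₗ[ℝ] ℝ) (R : W →ₗ[ℝ] W →ₗ[ℝ] ℝ) (b : V →ₗ[ℝ] W →ₗ[ℝ] ℝ)
    (l₁ : V →ₗ[ℝ] ℝ) (l₂ : W →ₗ[ℝ] ℝ) (c : ℝ)
    (hPs : ∀ x y, P x y = P y x) (hRs : ∀ x y, R x y = R y x)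
    (hP : ∀ x, 0 ≤ P x x) (hR : ∀ x, 0 ≤ R x x)
    (hPc : Continuous fun x => P x x) (hRc : Continuous fun x => R x x)
    {C C₁ C₂ : ℝ} (hC : 0 ≤ C) (hb : ∀ v w, b v w ^ 2 ≤ C * (P v v * R w w))
    (hl₁ : ∀ v, l₁ v ^ 2 ≤ C₁ * P v v) (hl₂ : ∀ w, l₂ w ^ 2 ≤ C₂ * R w w) {g : V → W → ℝ}
    (hg : ∀ v w, g v w = c + P v v + 2 * b v w - R w w + 2 * l₁ v + 2 * l₂ w) :
    (∀ w, BddBelow (range fun v => g v w)) ∧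
    (Continuous fun w => ⨅ v, g v w) ∧
    (∀ v, BddAbove (range fun w => g v w)) ∧
    (Continuous fun v => ⨆ w, g v w) ∧
    BddBelow (range fun v => ⨆ w, g v w) ∧
    BddAbove (range fun w => ⨅ v, g v w) ∧
    (⨅ v, ⨆ w, g v w) = ⨆ w, ⨅ v, g v w := by
  obtain ⟨E, _, _, _, i, hi, hi'⟩ := exists_hilbert_of_form P hPs hP
  obtain ⟨F, _, _, _, j, hj, hj'⟩ := exists_hilbert_of_form R hRs hR
  obtain ⟨p, hp⟩ := exists_inner_eq_of_sq_le hi l₁ (C := C₁) (by simpa only [hi'] using hl₁)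
  obtain ⟨r, hr⟩ := exists_inner_eq_of_sq_le hj l₂ (C := C₂) (by simpa only [hj'] using hl₂)
  obtain ⟨T, hT⟩ := exists_inner_clm_eq_of_sq_le hi hj b hC (by simpa only [hi', hj'] using hb)
  refine saddleForm_minimax T p r c (continuous_of_continuous_inner_self i (by simpa only [hi'] using hPc))
    (continuous_of_continuous_inner_self j (by simpa only [hj'] using hRc)) hi hj fun v w => ?_
  rw [hg, saddleForm, hi', hj', ← hT, ← hp, ← hr]

end Minimax

end MinimaxCT

namespace MinimaxCT

open Matrix Filter Topology Set

/-! ### Symmetric forms on signals. -/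

section Forms

variable {κ : Type*} [Fintype κ] [DecidableEq κ]

/-- The symmetric bilinear form on signals induced by a matrix. -/
noncomputable def symmForm (Q : Matrix κ κ ℝ) :
    SignalSpace κ →ₗ[ℝ] SignalSpace κ →ₗ[ℝ] ℝ :=
  LinearMap.mk₂ ℝ (fun σ τ => (inner ℝ σ (mulL Q τ) + inner ℝ τ (mulL Q σ)) / 2)
    (fun σ σ' τ => by simp only [map_add, inner_add_left, inner_add_right]; ring)
    (fun c σ τ => by
      simp only [map_smul, real_inner_smul_left, real_inner_smul_right, smul_eq_mul]; ring)
    (fun σ τ τ' => by simp only [map_add, inner_add_left, inner_add_right]; ring)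
    (fun c σ τ => by
      simp only [map_smul, real_inner_smul_left, real_inner_smul_right, smul_eq_mul]; ring)

theorem symmForm_apply (Q : Matrix κ κ ℝ) (σ τ : SignalSpace κ) :
    symmForm Q σ τ = (inner ℝ σ (mulL Q τ) + inner ℝ τ (mulL Q σ)) / 2 :=
  rfl

theorem symmForm_comm (Q : Matrix κ κ ℝ) (σ τ : SignalSpace κ) :
    symmForm Q σ τ = symmForm Q τ σ := by
  rw [symmForm_apply, symmForm_apply, add_comm]

/-- `Q` is not assumed symmetric; symmetrising leaves the quadratic form, and so the cost,
unchanged. -/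
theorem symmForm_self (Q : Matrix κ κ ℝ) (σ : SignalSpace κ) :
    symmForm Q σ σ = inner ℝ σ (mulL Q σ) := by
  rw [symmForm_apply]; ring

theorem continuous_symmForm (Q : Matrix κ κ ℝ) {X : Type*} [TopologicalSpace X]
    {f g : X → SignalSpace κ} (hf : Continuous f) (hg : Continuous g) :
    Continuous fun x => symmForm Q (f x) (g x) := by
  simp only [symmForm_apply]
  fun_prop

theorem signalForm_congr {κ : Type*} [Fintype κ] (Q : Matrix κ κ ℝ) {f f' g g' : ℝ → κ → ℝ}
    (hf : ∀ᵐ t ∂volume.restrict (Ici (0 : ℝ)), f t = f' t)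
    (hg : ∀ᵐ t ∂volume.restrict (Ici (0 : ℝ)), g t = g' t) :
    signalForm Q f g = signalForm Q f' g' := by
  rw [signalForm, signalForm, restrict_Ioi_eq_restrict_Ici]
  refine integral_congr_ae ?_
  filter_upwards [hf, hg] with t h1 h2
  rw [h1, h2]

theorem symmForm_eq_signalForm (Q : Matrix κ κ ℝ) {σ τ : SignalSpace κ} {f g : ℝ → κ → ℝ}
    (hf : ∀ᵐ t ∂volume.restrict (Ici (0 : ℝ)), (σ t).ofLp = f t)
    (hg : ∀ᵐ t ∂volume.restrict (Ici (0 : ℝ)), (τ t).ofLp = g t) :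
    symmForm Q σ τ = (signalForm Q f g + signalForm Q g f) / 2 := by
  rw [symmForm_apply, inner_mulL_eq, inner_mulL_eq, signalForm_congr Q hf hg,
    signalForm_congr Q hg hf]

theorem signalForm_neg {κ : Type*} [Fintype κ] (Q : Matrix κ κ ℝ) (f g : ℝ → κ → ℝ) :
    signalForm (-Q) f g = -signalForm Q f g := by
  simp only [signalForm, Matrix.neg_mulVec, dotProduct_neg, integral_neg]

theorem symmForm_neg (Q : Matrix κ κ ℝ) (σ τ : SignalSpace κ) :
    symmForm (-Q) σ τ = -symmForm Q σ τ := by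
  rw [symmForm_eq_signalForm (-Q) (ae_of_all _ fun _ => rfl) (ae_of_all _ fun _ => rfl),
    symmForm_eq_signalForm Q (ae_of_all _ fun _ => rfl) (ae_of_all _ fun _ => rfl),
    signalForm_neg, signalForm_neg]
  ring

/-- Replacing `v` by `s • v` gives a quadratic polynomial in `s` that is never negative, so its
discriminant is at most zero. -/
theorem sq_le_of_forall_nonneg {V W : Type*} [AddCommGroup V] [Module ℝ V]
    [AddCommGroup W] [Module ℝ W] (P : V →ₗ[ℝ] V →ₗ[ℝ] ℝ) (R : W →ₗ[ℝ] W →ₗ[ℝ] ℝ)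
    (b : V →ₗ[ℝ] W →ₗ[ℝ] ℝ) {ε : ℝ} (hε : 0 < ε)
    (h : ∀ v w, 0 ≤ P v v + 2 * ε * b v w + R w w) (v : V) (w : W) :
    b v w ^ 2 ≤ (ε ^ 2)⁻¹ * (P v v * R w w) := by
  have hd := discrim_le_zero (a := P v v) (b := 2 * ε * b v w) (c := R w w) fun s => by
    have := h (s • v) w
    simp only [map_smul, LinearMap.smul_apply, smul_eq_mul] at this
    linarith
  rw [discrim] at hd
  rw [← div_eq_inv_mul, le_div_iff₀ (by positivity)]
  nlinarith

end Forms

/-! ### Cross terms between free and forced responses. -/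

section InputOperator

variable {n : ℕ} {A : Matrix (Fin n) (Fin n) ℝ} {ι κ : Type*} [Fintype ι] [Fintype κ]
  [DecidableEq κ] (B : Matrix (Fin n) ι ℝ)

/-- The response to the input `Z v` with zero initial state. -/
noncomputable def IsHurwitz.inputL (hA : IsHurwitz A) (Z : Matrix ι κ ℝ) :
    SignalSpace κ →L[ℝ] SignalSpace (Fin n ⊕ ι) :=
  (hA.responseL B).comp ((ContinuousLinearMap.inr ℝ (Fin n → ℝ) (SignalSpace ι)).comp (mulL Z))

theorem IsHurwitz.inputL_apply (hA : IsHurwitz A) (Z : Matrix ι κ ℝ) (v : SignalSpace κ) :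
    hA.inputL B Z v = hA.response B 0 (mulL Z v) :=
  rfl

theorem IsHurwitz.inputL_ae_eq (hA : IsHurwitz A) (Z : Matrix ι κ ℝ) {v : SignalSpace κ}
    {f : ℝ → κ → ℝ} (hf : ∀ᵐ t ∂volume.restrict (Ici (0 : ℝ)), (v t).ofLp = f t) :
    ∀ᵐ t ∂volume.restrict (Ici (0 : ℝ)),
      (hA.inputL B Z v t).ofLp = inputSignal A B (fun t => Z *ᵥ f t) t := by
  have h : ∀ᵐ t ∂volume.restrict (Ici (0 : ℝ)), B *ᵥ (mulL Z v t).ofLp = B *ᵥ (Z *ᵥ f t) := by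
    filter_upwards [hf, mulL_ae_eq Z v] with t h1 h2
    rw [h2, h1]
  filter_upwards [hf, mulL_ae_eq Z v, hA.response_ae_eq B 0 (mulL Z v),
    ae_restrict_mem measurableSet_Ici] with t h1 h2 h3 ht
  rw [hA.inputL_apply, h3, stateResponse_signal_congr h ht, h2, h1, inputSignal]

theorem IsHurwitz.response_zero_ae_eq (hA : IsHurwitz A) (a : Fin n → ℝ) :
    ∀ᵐ t ∂volume.restrict (Ici (0 : ℝ)), (hA.response B a 0 t).ofLp =
      Matrix.fromRows (1 : Matrix (Fin n) (Fin n) ℝ) (0 : Matrix ι (Fin n) ℝ) *ᵥ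
        (NormedSpace.exp (t • A) *ᵥ a) := by
  have hz := Lp.coeFn_zero (EuclideanSpace ℝ ι) 2 (volume.restrict (Ici (0 : ℝ)))
  have h : ∀ᵐ t ∂volume.restrict (Ici (0 : ℝ)), B *ᵥ ((0 : SignalSpace ι) t).ofLp = 0 := by
    filter_upwards [hz] with t ht
    rw [ht]
    exact Matrix.mulVec_zero B
  filter_upwards [hz, hA.response_ae_eq B a 0, ae_restrict_mem measurableSet_Ici] with t h1 h2 ht
  rw [h2, stateResponse_signal_congr (g := 0) h ht, stateResponse_zero_right, h1,
    Matrix.fromRows_mulVec]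
  ext i
  rcases i with i | i <;> simp

variable [DecidableEq ι]

/-- Brings the linear term of the cost into the form of an `expPairing`, to which the theory of
admissible weights applies. -/
theorem IsHurwitz.symmForm_response_inputL (hA : IsHurwitz A)
    (Q : Matrix (Fin n ⊕ ι) (Fin n ⊕ ι) ℝ) (Z : Matrix ι κ ℝ) (a : Fin n → ℝ)
    {v : SignalSpace κ} {f : ℝ → κ → ℝ}
    (hf : ∀ᵐ t ∂volume.restrict (Ici (0 : ℝ)), (v t).ofLp = f t) :
    symmForm Q (hA.response B a 0) (hA.inputL B Z v) =
      expPairing A (((1 / 2 : ℝ) • (Q + Qᵀ)) *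
        Matrix.fromRows (1 : Matrix (Fin n) (Fin n) ℝ) (0 : Matrix ι (Fin n) ℝ)) a
        (inputSignal A B fun t => Z *ᵥ f t) := by
  have h1 := hA.response_zero_ae_eq B a
  have h2 := hA.inputL_ae_eq B Z hf
  rw [symmForm_apply, L2.inner_def, L2.inner_def, ← integral_add (L2.integrable_inner _ _)
    (L2.integrable_inner _ _), ← integral_div, expPairing, restrict_Ioi_eq_restrict_Ici]
  refine integral_congr_ae ?_
  filter_upwards [h1, h2, mulL_ae_eq Q (hA.response B a 0), mulL_ae_eq Q (hA.inputL B Z v)]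
    with t e1 e2 e3 e4
  rw [EuclideanSpace.inner_eq_star_dotProduct, EuclideanSpace.inner_eq_star_dotProduct,
    star_trivial, star_trivial, e3, e4, e1, e2, ← Matrix.mulVec_mulVec]
  set x := Matrix.fromRows (1 : Matrix (Fin n) (Fin n) ℝ) (0 : Matrix ι (Fin n) ℝ) *ᵥ
    (NormedSpace.exp (t • A) *ᵥ a)
  set y := inputSignal A B (fun t => Z *ᵥ f t) t
  rw [Matrix.smul_mulVec, Matrix.add_mulVec, smul_dotProduct, add_dotProduct, smul_eq_mul,
    Matrix.mulVec_transpose, ← Matrix.dotProduct_mulVec, dotProduct_comm (Q *ᵥ y) x]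
  ring

/-- `exists_expPairing_sq_le` gives the bound on decaying signals; both sides are continuous in `v`,
so it extends to `L²` by density. -/
theorem IsHurwitz.exists_symmForm_sq_le (hA : IsHurwitz A)
    (Q : Matrix (Fin n ⊕ ι) (Fin n ⊕ ι) ℝ) (Z : Matrix ι κ ℝ)
    (hpos : ∀ s : ℂ, s.re = 0 →
      ((transferMatrix A B s * Z.map Complex.ofReal)ᴴ * Q.map Complex.ofReal *
        (transferMatrix A B s * Z.map Complex.ofReal)).PosSemidef)
    {s₀ : ℂ} (hs₀ : s₀.re = 0)
    (hdet : ((transferMatrix A B s₀ * Z.map Complex.ofReal)ᴴ * Q.map Complex.ofReal *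
        (transferMatrix A B s₀ * Z.map Complex.ofReal)).det ≠ 0) (a : Fin n → ℝ) :
    ∃ C, ∀ v : SignalSpace κ,
      symmForm Q (hA.response B a 0) (hA.inputL B Z v) ^ 2 ≤
        C * symmForm Q (hA.inputL B Z v) (hA.inputL B Z v) := by
  obtain ⟨C, -, hC⟩ := hA.exists_expPairing_sq_le B Q Z hpos hs₀ hdet
    (((1 / 2 : ℝ) • (Q + Qᵀ)) *
      Matrix.fromRows (1 : Matrix (Fin n) (Fin n) ℝ) (0 : Matrix ι (Fin n) ℝ)) a
  refine ⟨C, fun v => ?_⟩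
  have hcl : IsClosed {v : SignalSpace κ |
      symmForm Q (hA.response B a 0) (hA.inputL B Z v) ^ 2 ≤
        C * symmForm Q (hA.inputL B Z v) (hA.inputL B Z v)} :=
    isClosed_le ((continuous_symmForm Q continuous_const (hA.inputL B Z).continuous).pow 2)
      ((continuous_symmForm Q (hA.inputL B Z).continuous (hA.inputL B Z).continuous).const_mul C)
  refine closure_minimal ?_ hcl (dense_decayingSignals v)
  rintro u ⟨f, hfd, hf⟩
  have h2 := hA.inputL_ae_eq B Z hf
  rw [mem_ofPred_eq, hA.symmForm_response_inputL B Q Z a hf, symmForm_eq_signalForm Q h2 h2,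
    add_self_div_two]
  exact hC f hfd

end InputOperator

/-! ### Assembling the quadratic functional. -/

section Main

variable {n k q : ℕ} {A : Matrix (Fin n) (Fin n) ℝ}
  (B₁ : Matrix (Fin n) (Fin k) ℝ) (B₂ : Matrix (Fin n) (Fin q) ℝ)
  (Q : Matrix (Fin n ⊕ Fin k ⊕ Fin q) (Fin n ⊕ Fin k ⊕ Fin q) ℝ)

theorem freqMatrix_eq (s : ℂ) : freqMatrix A B₁ B₂ Q s =
    (transferMatrix A (Matrix.fromCols B₁ B₂) s)ᴴ * Q.map Complex.ofReal *
      transferMatrix A (Matrix.fromCols B₁ B₂) s :=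
  rfl

/-- The extension of `signalForm_nonneg` to all square integrable inputs, again by density in both
variables. -/
theorem IsHurwitz.symmForm_nonneg (hA : IsHurwitz A) (ε : ℝ)
    (hfreq : ∀ s : ℂ, s.re = 0 →
      (Matrix.fromBlocks (freqMatrix A B₁ B₂ Q s).toBlocks₁₁
        ((ε : ℂ) • (freqMatrix A B₁ B₂ Q s).toBlocks₁₂)
        ((ε : ℂ) • (freqMatrix A B₁ B₂ Q s).toBlocks₂₁)
        (-(freqMatrix A B₁ B₂ Q s).toBlocks₂₂)).PosSemidef)
    {Z₁ : Matrix (Fin k ⊕ Fin q) (Fin k) ℝ} (hZ₁ : Z₁ = Matrix.fromRows 1 0)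
    {Z₂ : Matrix (Fin k ⊕ Fin q) (Fin q) ℝ} (hZ₂ : Z₂ = Matrix.fromRows 0 1)
    (v : L2Signal k) (w : L2Signal q) :
    0 ≤ symmForm Q (hA.inputL (Matrix.fromCols B₁ B₂) Z₁ v)
          (hA.inputL (Matrix.fromCols B₁ B₂) Z₁ v) +
        2 * ε * symmForm Q (hA.inputL (Matrix.fromCols B₁ B₂) Z₁ v)
          (hA.inputL (Matrix.fromCols B₁ B₂) Z₂ w) -
        symmForm Q (hA.inputL (Matrix.fromCols B₁ B₂) Z₂ w)
          (hA.inputL (Matrix.fromCols B₁ B₂) Z₂ w) := by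
  set G₁ := hA.inputL (Matrix.fromCols B₁ B₂) Z₁ with hG₁
  set G₂ := hA.inputL (Matrix.fromCols B₁ B₂) Z₂ with hG₂
  set S := {z : L2Signal k × L2Signal q |
      0 ≤ symmForm Q (G₁ z.1) (G₁ z.1) + 2 * ε * symmForm Q (G₁ z.1) (G₂ z.2) -
        symmForm Q (G₂ z.2) (G₂ z.2)} with hS
  have hcl : IsClosed S := by
    have h1 : Continuous fun z : L2Signal k × L2Signal q => G₁ z.1 := G₁.continuous.comp continuous_fst
    have h2 : Continuous fun z : L2Signal k × L2Signal q => G₂ z.2 := G₂.continuous.comp continuous_snd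
    exact isClosed_le continuous_const (((continuous_symmForm Q h1 h1).add
      ((continuous_symmForm Q h1 h2).const_mul _)).sub (continuous_symmForm Q h2 h2))
  have hd : Dense ((decayingSignals (Fin k) : Set (L2Signal k)) ×ˢ
    (decayingSignals (Fin q) : Set (L2Signal q))) :=
    dense_decayingSignals.prod dense_decayingSignals
  suffices h : (v, w) ∈ S from h
  refine closure_minimal ?_ hcl (hd (v, w))
  rintro ⟨v, w⟩ ⟨⟨f, hfd, hf⟩, ⟨g, hgd, hg⟩⟩
  have h1 := hA.inputL_ae_eq (Matrix.fromCols B₁ B₂) Z₁ hf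
  have h2 := hA.inputL_ae_eq (Matrix.fromCols B₁ B₂) Z₂ hg
  have h := hA.signalForm_nonneg (Matrix.fromCols B₁ B₂) Q ε hfreq hfd hgd
  rw [← hZ₁, ← hZ₂] at h
  rw [hS, mem_ofPred_eq, hG₁, hG₂, symmForm_eq_signalForm Q h1 h1, symmForm_eq_signalForm Q h1 h2,
    symmForm_eq_signalForm Q h2 h2]
  linarith

theorem IsHurwitz.cost_eq_symmForm (hA : IsHurwitz A) (a : Fin n → ℝ)
    (v : L2Signal k) (w : L2Signal q) {F G H : SignalSpace (Fin n ⊕ Fin k ⊕ Fin q)}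
    (hF : F = hA.response (Matrix.fromCols B₁ B₂) a 0)
    (hG : G = hA.inputL (Matrix.fromCols B₁ B₂) (Matrix.fromRows 1 0) v)
    (hH : H = hA.inputL (Matrix.fromCols B₁ B₂) (Matrix.fromRows 0 1) w) :
    cost A B₁ B₂ Q a v w = symmForm Q F F + symmForm Q G G + 2 * symmForm Q G H +
      symmForm Q H H + 2 * symmForm Q F G + 2 * symmForm Q F H := by
  have h : hA.response (Matrix.fromCols B₁ B₂) a (pairSignal v w) = F + (G + H) := by
    rw [hF, hG, hH, hA.inputL_apply, hA.inputL_apply, ← hA.response_add, ← hA.response_add]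
    simp only [add_zero, zero_add]
    rfl
  rw [hA.cost_eq, h, ← symmForm_self]
  simp only [map_add, LinearMap.add_apply]
  rw [symmForm_comm Q H G, symmForm_comm Q G F, symmForm_comm Q H F]
  ring

end Main

end MinimaxCT

theorem mainTheorem9 {n k q : ℕ} (A : Matrix (Fin n) (Fin n) ℝ)
    (B₁ : Matrix (Fin n) (Fin k) ℝ) (B₂ : Matrix (Fin n) (Fin q) ℝ)
    (Q : Matrix (Fin n ⊕ Fin k ⊕ Fin q) (Fin n ⊕ Fin k ⊕ Fin q) ℝ)
    (hA : MinimaxCT.IsHurwitz A)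
    (ε : ℝ) (hε : 0 < ε)
    (hfreq : ∀ s : ℂ, s.re = 0 →
      (Matrix.fromBlocks
        (MinimaxCT.freqMatrix A B₁ B₂ Q s).toBlocks₁₁
        ((ε : ℂ) • (MinimaxCT.freqMatrix A B₁ B₂ Q s).toBlocks₁₂)
        ((ε : ℂ) • (MinimaxCT.freqMatrix A B₁ B₂ Q s).toBlocks₂₁)
        (-(MinimaxCT.freqMatrix A B₁ B₂ Q s).toBlocks₂₂)).PosSemidef)
    (s₀ : ℂ) (hs₀ : s₀.re = 0)
    (h₁₁ : (MinimaxCT.freqMatrix A B₁ B₂ Q s₀).toBlocks₁₁.PosDef)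
    (h₂₂ : (-(MinimaxCT.freqMatrix A B₁ B₂ Q s₀).toBlocks₂₂).PosDef)
    (a : Fin n → ℝ) :
    -- the functional is well defined
    MinimaxCT.IsWellPosed A B₁ B₂ Q a ∧
    -- the partial infimum is finite and continuous
    (∀ w : MinimaxCT.L2Signal q,
      BddBelow (Set.range fun v : MinimaxCT.L2Signal k => MinimaxCT.cost A B₁ B₂ Q a v w)) ∧
    Continuous (fun w : MinimaxCT.L2Signal q =>
      ⨅ v : MinimaxCT.L2Signal k, MinimaxCT.cost A B₁ B₂ Q a v w) ∧
    -- the partial supremum is finite and continuous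
    (∀ v : MinimaxCT.L2Signal k,
      BddAbove (Set.range fun w : MinimaxCT.L2Signal q => MinimaxCT.cost A B₁ B₂ Q a v w)) ∧
    Continuous (fun v : MinimaxCT.L2Signal k =>
      ⨆ w : MinimaxCT.L2Signal q, MinimaxCT.cost A B₁ B₂ Q a v w) ∧
    -- both sides of the minimax identity are finite, and they are equal
    BddBelow (Set.range fun v : MinimaxCT.L2Signal k =>
      ⨆ w : MinimaxCT.L2Signal q, MinimaxCT.cost A B₁ B₂ Q a v w) ∧
    BddAbove (Set.range fun w : MinimaxCT.L2Signal q =>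
      ⨅ v : MinimaxCT.L2Signal k, MinimaxCT.cost A B₁ B₂ Q a v w) ∧
    (⨅ v : MinimaxCT.L2Signal k, ⨆ w : MinimaxCT.L2Signal q,
        MinimaxCT.cost A B₁ B₂ Q a v w) =
      ⨆ w : MinimaxCT.L2Signal q, ⨅ v : MinimaxCT.L2Signal k,
        MinimaxCT.cost A B₁ B₂ Q a v w := by

  refine ⟨hA.isWellPosed B₁ B₂ Q a, ?_⟩
  have hblock := fun s => MinimaxCT.toBlocks_eq_compression (MinimaxCT.freqMatrix A B₁ B₂ Q s)
  have hcomp₁ : ∀ s, (MinimaxCT.transferMatrix A (Matrix.fromCols B₁ B₂) s *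
      (Matrix.fromRows 1 0 : Matrix (Fin k ⊕ Fin q) (Fin k) ℝ).map Complex.ofReal).conjTranspose *
      Q.map Complex.ofReal * (MinimaxCT.transferMatrix A (Matrix.fromCols B₁ B₂) s *
      (Matrix.fromRows 1 0 : Matrix (Fin k ⊕ Fin q) (Fin k) ℝ).map Complex.ofReal) =
      (MinimaxCT.freqMatrix A B₁ B₂ Q s).toBlocks₁₁ := fun s => by
    rw [MinimaxCT.mul_conjTranspose_mul_mul, MinimaxCT.fromRows_one_zero_map, ← (hblock s).1,
      MinimaxCT.freqMatrix_eq]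
  have hcomp₂ : ∀ s, (MinimaxCT.transferMatrix A (Matrix.fromCols B₁ B₂) s *
      (Matrix.fromRows 0 1 : Matrix (Fin k ⊕ Fin q) (Fin q) ℝ).map Complex.ofReal).conjTranspose *
      (-Q).map Complex.ofReal * (MinimaxCT.transferMatrix A (Matrix.fromCols B₁ B₂) s *
      (Matrix.fromRows 0 1 : Matrix (Fin k ⊕ Fin q) (Fin q) ℝ).map Complex.ofReal) =
      -(MinimaxCT.freqMatrix A B₁ B₂ Q s).toBlocks₂₂ := fun s => by
    have hneg : (-Q).map Complex.ofReal = -Q.map Complex.ofReal := by ext; simp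
    rw [hneg, Matrix.mul_neg, Matrix.neg_mul, MinimaxCT.mul_conjTranspose_mul_mul,
      MinimaxCT.fromRows_zero_one_map, ← (hblock s).2.2.2, MinimaxCT.freqMatrix_eq]
  -- Diagonal blocks of a positive semidefinite matrix are positive semidefinite, and definiteness
  -- at `s₀` enters only through a nonzero determinant.
  obtain ⟨C₁, hC₁⟩ := hA.exists_symmForm_sq_le (Matrix.fromCols B₁ B₂) Q (Matrix.fromRows 1 0)
    (fun s hs => by rw [hcomp₁]; exact (hfreq s hs).submatrix Sum.inl) hs₀
    (by rw [hcomp₁]; exact h₁₁.det_pos.ne') a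
  obtain ⟨C₂, hC₂⟩ := hA.exists_symmForm_sq_le (Matrix.fromCols B₁ B₂) (-Q) (Matrix.fromRows 0 1)
    (fun s hs => by rw [hcomp₂]; exact (hfreq s hs).submatrix Sum.inr) hs₀
    (by rw [hcomp₂]; exact h₂₂.det_pos.ne') a
  have hnonneg := hA.symmForm_nonneg B₁ B₂ Q ε hfreq rfl rfl
  set F := hA.response (Matrix.fromCols B₁ B₂) a 0 with hF
  set G₁ := hA.inputL (Matrix.fromCols B₁ B₂)
    (Matrix.fromRows 1 0 : Matrix (Fin k ⊕ Fin q) (Fin k) ℝ) with hG₁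
  set G₂ := hA.inputL (Matrix.fromCols B₁ B₂)
    (Matrix.fromRows 0 1 : Matrix (Fin k ⊕ Fin q) (Fin q) ℝ) with hG₂
  -- The second form is built from `-Q`, since the functional is concave in `w`; the constant `(ε ^
  -- 2)⁻¹` comes from the discriminant bound.
  refine MinimaxCT.minimax_of_forms
    ((MinimaxCT.symmForm Q).compl₁₂ G₁.toLinearMap G₁.toLinearMap)
    ((MinimaxCT.symmForm (-Q)).compl₁₂ G₂.toLinearMap G₂.toLinearMap)
    ((MinimaxCT.symmForm Q).compl₁₂ G₁.toLinearMap G₂.toLinearMap)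
    ((MinimaxCT.symmForm Q F).comp G₁.toLinearMap) ((MinimaxCT.symmForm Q F).comp G₂.toLinearMap)
    (MinimaxCT.symmForm Q F F) (C := (ε ^ 2)⁻¹) (C₁ := C₁) (C₂ := C₂)
    (fun x y => MinimaxCT.symmForm_comm _ _ _) (fun x y => MinimaxCT.symmForm_comm _ _ _)
    (fun v => ?_) (fun w => ?_)
    (MinimaxCT.continuous_symmForm Q G₁.continuous G₁.continuous)
    (MinimaxCT.continuous_symmForm (-Q) G₂.continuous G₂.continuous) (by positivity)
    (MinimaxCT.sq_le_of_forall_nonneg _ _ _ hε fun v w => ?_) hC₁ (fun w => ?_) (fun v w => ?_)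
  -- Setting one signal to zero in the joint inequality gives the nonnegativity of each form.
  · simpa using hnonneg v 0
  · simpa [MinimaxCT.symmForm_neg] using hnonneg 0 w
  · simpa [MinimaxCT.symmForm_neg, sub_eq_add_neg] using hnonneg v w
  · simpa [MinimaxCT.symmForm_neg] using hC₂ w
  · rw [hA.cost_eq_symmForm B₁ B₂ Q a v w hF rfl rfl, ← hG₁, ← hG₂]
    simp [MinimaxCT.symmForm_neg]
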